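/- Let $N \ge 1$ be an integer. For a complex polynomial $f(x) = a\prod_{n}(x-\gamma_n)$ let $\mu(f) = |a|\prod_{n}\max\{1,|\gamma_n|\}$ be its Mahler measure, and for $\mathbf b = (b_1,\dots,b_N) \in \mathbb C^N$ put \[ \widetilde\mu(\mathbf b) = \mu\Big(x^N + \sum_{n=1}^N b_n x^{N-n}\Big). \] Let $\lambda_N$ and $\lambda_{2N}$ denote Lebesgue measure on $\mathbb R^N$ and on $\mathbb C^N \cong \mathbb R^{2N}$ respectively, and define the real and complex moment functions \[ F_N(\mu;s) = \int_{\mathbb R^N} \widetilde\mu(\mathbf b)^{-s}\, d\lambda_N(\mathbf b), \qquad H_N(\mu;s) = \int_{\mathbb C^N} \widetilde\mu(\mathbf b)^{-2s}\, d\lambda_{2N}(\mathbf b). \] Both integrals converge absolutely for all complex $s$ with $\Re(s) > N$ and define analytic functions of $s$ in this half plane, and $F_N(\mu;s)$ and $H_N(\mu;s)$ continue analytically to rational functions of $s$, which have no poles in this half plane. Explicitly, \[ H_N(\mu;s) = \frac{\pi^N}{N!}\prod_{n=1}^N \frac{s}{s-n}, \] and, with $M$ the integer part of $(N-1)/2$,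 \[ F_N(\mu;s) = \mathcal C_N \prod_{m=0}^M \frac{s}{s-(N-2m)}, \qquad \text{where} \qquad \mathcal C_N = 2^N \prod_{m=1}^M \left(\frac{2m}{2m+1}\right)^{N-2m}; \] these formulas hold as identities of the integrals for $\Re(s) > N$, and as identities of rational functions for the continuations. -/

import Mathlib

open MeasureTheory
open scoped Polynomial

noncomputable section

/-- The monic polynomial `x ^ N + b₁ x ^ (N - 1) + ⋯ + b_N`; the coordinate `b i` of the vector,
with `i = 0, …, N - 1`, is the coefficient `b_{i + 1}` of `x ^ (N - (i + 1))`. -/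
def monicPoly {N : ℕ} (b : Fin N → ℂ) : ℂ[X] :=
  Polynomial.X ^ N +
    ∑ i : Fin N, Polynomial.C (b i) * Polynomial.X ^ (N - ((i : ℕ) + 1))

/-- The degree `N` monic restriction of a function `Φ` on complex polynomials. -/
def monicRestriction (Φ : ℂ[X] → ℝ) {N : ℕ} (b : Fin N → ℂ) : ℝ :=
  Φ (monicPoly b)

/-- The integrand of the complex moment function. -/
def complexMomentIntegrand (Φ : ℂ[X] → ℝ) (N : ℕ) (s : ℂ) (b : Fin N → ℂ) : ℂ :=
  (monicRestriction Φ b : ℂ) ^ (-(2 * s))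

/-- The integrand of the real moment function. -/
def realMomentIntegrand (Φ : ℂ[X] → ℝ) (N : ℕ) (s : ℂ) (b : Fin N → ℝ) : ℂ :=
  (monicRestriction Φ (fun i => (b i : ℂ)) : ℂ) ^ (-s)

/-- The complex degree `N` moment function of `Φ`, an integral for Lebesgue measure on `ℂ ^ N`. -/
def complexMoment (Φ : ℂ[X] → ℝ) (N : ℕ) (s : ℂ) : ℂ :=
  ∫ b : Fin N → ℂ, complexMomentIntegrand Φ N s b

/-- The real degree `N` moment function of `Φ`, an integral for Lebesgue measure on `ℝ ^ N`. -/
def realMoment (Φ : ℂ[X] → ℝ) (N : ℕ) (s : ℂ) : ℂ :=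
  ∫ b : Fin N → ℝ, realMomentIntegrand Φ N s b

/-- Mahler's measure `Polynomial.mahlerMeasure` is `|a| * ∏ max 1 |γ|` over the roots `γ` counted
with multiplicity, where `a` is the leading coefficient. -/
theorem mahlerMeasure_eq_root_product (f : ℂ[X]) :
    f.mahlerMeasure = ‖f.leadingCoeff‖ * (f.roots.map (fun γ => max 1 ‖γ‖)).prod :=
  Polynomial.mahlerMeasure_eq_leadingCoeff_mul_prod_roots f

/-- The function `F` is analytic on the half plane `Re s > σ`, and `R` is a rational function
without poles there that agrees with `F` there. Since `R` is meromorphic on all of `ℂ`,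
it is the analytic continuation of `F`. -/
def ContinuesToRational (F : ℂ → ℂ) (σ : ℝ) (R : RatFunc ℂ) : Prop :=
  AnalyticOnNhd ℂ F {s : ℂ | σ < s.re} ∧
    ∀ s : ℂ, σ < s.re →
      R.denom.eval s ≠ 0 ∧ F s = R.eval (RingHom.id ℂ) s

/-- The constant `2 ^ N * ∏_{m = 1}^M (2 m / (2 m + 1)) ^ (N - 2 m)` with `M = ⌊(N - 1) / 2⌋`. -/
def mahlerConst (N : ℕ) : ℚ :=
  2 ^ N * ∏ m ∈ Finset.Icc 1 ((N - 1) / 2),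
    ((2 * (m : ℚ)) / (2 * (m : ℚ) + 1)) ^ (N - 2 * m)

end

/-!
Multiplication `(f, q) ↦ f * q` of monic polynomials of degrees `d` and `k` has as its Jacobian
determinant the resultant of `f` and `q` (over `ℂ`, the squared norm of the resultant). Over `ℂ`
and for `k = 1` the map is `(d + 1)`-to-one almost everywhere; over `ℝ` and for `k = 2` its
preimages, counted with the sign of the resultant, number `⌊(d + 2) / 2⌋` almost everywhere. Since
Mahler's measure is multiplicative, the average of `μ(f)⁻ˢ`, multiplied by the values of `f` at
some given points, reduces to an average over a lower degree in which the roots of `q` have joined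
the points. After multiplication by the Vandermonde determinant of the points this recursion
becomes a product in an exterior algebra. In the complex case the monomials are orthogonal for the
weight `max(1, |z|)⁻²ˢ`, so that only `N!` times the product of their norms remains. In the real
case the result is the determinant of the moments of `(αᵖ βʳ - αʳ βᵖ) / (β - α)`, over the real
quadratics with roots `α`, `β`. These vanish when `p` and `r` have the same parity, which leaves a
Cauchy determinant.
-/

section AreaFormula

open Set Function
open scoped ENNReal NNReal

theorem toReal_encard_eq_ncard {α : Type*} (s : Set α) : ((s.encard : ℝ≥0∞)).toReal = s.ncard := by
  rcases s.finite_or_infinite with hs | hs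
  · rw [← hs.cast_ncard_eq]
    simp
  · simp [hs.encard_eq, hs.ncard]

theorem encard_inter_preimage_singleton_eq_tsum {α β : Type*} {f : α → β} {s : Set α}
    {t : ℕ → Set α} (ht : Pairwise (Disjoint on t)) (hst : s ⊆ ⋃ n, t n)
    (hinj : ∀ n, InjOn f (s ∩ t n)) (y : β) :
    ((s ∩ f ⁻¹' {y}).encard : ℝ≥0∞) = ∑' n, (f '' (s ∩ t n)).indicator 1 y := by
  let _ : MeasurableSpace α := ⊤
  have hpieces : s ∩ f ⁻¹' {y} = ⋃ n, s ∩ t n ∩ f ⁻¹' {y} := by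
    rw [← iUnion_inter, ← inter_iUnion, inter_eq_left.2 hst]
  rw [← Measure.count_apply MeasurableSpace.measurableSet_top, hpieces, measure_iUnion
    (fun i j hij => (ht hij).mono (fun x hx => hx.1.2) fun x hx => hx.1.2)
    fun _ => MeasurableSpace.measurableSet_top]
  refine tsum_congr fun n => ?_
  have hsub : (s ∩ t n ∩ f ⁻¹' {y}).Subsingleton := fun a ha b hb =>
    hinj n ha.1 hb.1 (ha.2.trans hb.2.symm)
  by_cases hy : y ∈ f '' (s ∩ t n)
  · obtain ⟨x, hx, rfl⟩ := hy
    rw [hsub.eq_singleton_of_mem ⟨hx, rfl⟩, indicator_of_mem (mem_image_of_mem f hx)]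
    simp
  · have hempty : s ∩ t n ∩ f ⁻¹' {y} = ∅ :=
      eq_empty_of_forall_notMem fun x hx => hy ⟨x, hx.1, hx.2⟩
    rw [hempty, indicator_of_notMem hy]
    simp

variable {E : Type*} [NormedAddCommGroup E] [NormedSpace ℝ E] {f : E → E} {f' : E → E →L[ℝ] E}

/-- The fibre of `f` over `y` is finite with at most `C` points, and the signs of the Jacobian
determinants of `f` at these points add up to `d`: then `d` is the degree of `f` at the regular
value `y`. -/
def HasDegreeAt (f : E → E) (f' : E → E →L[ℝ] E) (d : ℤ) (C : ℕ) (y : E) : Prop :=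
  ∃ T : Finset E, (T : Set E) = f ⁻¹' {y} ∧ T.card ≤ C ∧
    ∑ x ∈ T, (SignType.sign (f' x).det : ℤ) = d

theorem HasDegreeAt.encard_le_and_ncard_sub {d : ℤ} {C : ℕ} {y : E} (h : HasDegreeAt f f' d C y) :
    (f ⁻¹' {y}).encard ≤ C ∧
      (({x | 0 < (f' x).det} ∩ f ⁻¹' {y}).ncard : ℤ) -
        ({x | (f' x).det < 0} ∩ f ⁻¹' {y}).ncard = d := by
  classical
  obtain ⟨T, hT, hcard, hsum⟩ := h
  have hsign : ∀ x, (SignType.sign (f' x).det : ℤ) =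
      (if 0 < (f' x).det then 1 else 0) - if (f' x).det < 0 then 1 else 0 := by
    intro x
    rcases lt_trichotomy (f' x).det 0 with h | h | h
    · simp [sign_neg h, h, h.not_gt]
    · simp [h]
    · simp [sign_pos h, h, h.not_gt]
  refine ⟨by rw [← hT, encard_coe_eq_coe_finsetCard]; exact_mod_cast hcard, ?_⟩
  have hfilter : ∀ p : E → Prop, ({x | p x} ∩ f ⁻¹' {y}).ncard = (T.filter p).card := by
    intro p
    rw [← ncard_coe_finset, ← hT, Finset.coe_filter]
    congr 1
    ext x
    simp [and_comm]
  rw [hfilter, hfilter, ← hsum, Finset.sum_congr rfl fun x _ => hsign x, Finset.sum_sub_distrib,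
    Finset.sum_boole, Finset.sum_boole]

variable [FiniteDimensional ℝ E] {s : Set E}

theorem exists_partition_injOn_of_det_ne_zero [MeasurableSpace E] [BorelSpace E]
    (hf' : ∀ x ∈ s, HasFDerivWithinAt f (f' x) s x) (hdet : ∀ x ∈ s, (f' x).det ≠ 0) :
    ∃ t : ℕ → Set E, Pairwise (Disjoint on t) ∧ (∀ n, MeasurableSet (t n)) ∧ (s ⊆ ⋃ n, t n) ∧
      ∀ n, InjOn f (s ∩ t n) := by
  classical
  rcases s.eq_empty_or_nonempty with rfl | hs
  · exact ⟨fun _ => ∅, fun _ _ _ => disjoint_empty _, by simp, by simp, by simp⟩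
  rcases subsingleton_or_nontrivial E with hE | hE
  · obtain ⟨t, -, ht, htm, hst, -⟩ := exists_partition_approximatesLinearOn_of_hasFDerivWithinAt
      f s f' hf' (fun _ => 1) fun _ => one_ne_zero
    exact ⟨t, ht, htm, hst, fun n x _ y _ _ => Subsingleton.elim x y⟩
  -- A map approximating an invertible `A` up to an error below `‖A⁻¹‖⁻¹` is injective.
  let r : (E →L[ℝ] E) → ℝ≥0 := fun A =>
    if hA : A.det ≠ 0 then ‖((A.toContinuousLinearEquivOfDetNeZero hA).symm : E →L[ℝ] E)‖₊⁻¹ / 2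
    else 1
  have hr : ∀ A, r A ≠ 0 := by
    intro A
    by_cases hA : A.det ≠ 0
    · have := (A.toContinuousLinearEquivOfDetNeZero hA).nnnorm_symm_pos
      simp only [r, dif_pos hA]
      positivity
    · simp only [r, dif_neg hA, ne_eq, one_ne_zero, not_false_iff]
  obtain ⟨t, A, ht, htm, hst, happrox, hA⟩ :=
    exists_partition_approximatesLinearOn_of_hasFDerivWithinAt f s f' hf' r hr
  refine ⟨t, ht, htm, hst, fun n => ?_⟩
  obtain ⟨y, hy, hAy⟩ := hA hs n
  have hdetA : (A n).det ≠ 0 := hAy ▸ hdet y hy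
  set B := (A n).toContinuousLinearEquivOfDetNeZero hdetA
  have hfB : ApproximatesLinearOn f (B : E →L[ℝ] E) (s ∩ t n) (‖(B.symm : E →L[ℝ] E)‖₊⁻¹ / 2) := by
    simpa only [r, dif_pos hdetA, B, ContinuousLinearMap.coe_toContinuousLinearEquivOfDetNeZero]
      using happrox n
  exact hfB.injOn (.inr (NNReal.half_lt_self (inv_ne_zero B.nnnorm_symm_pos.ne')))

variable [MeasurableSpace E] [BorelSpace E] (μ : Measure E) [μ.IsAddHaarMeasure]

theorem measurable_encard_inter_preimage_singleton (hs : MeasurableSet s)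
    (hf' : ∀ x ∈ s, HasFDerivWithinAt f (f' x) s x) (hdet : ∀ x ∈ s, (f' x).det ≠ 0) :
    Measurable fun y => ((s ∩ f ⁻¹' {y}).encard : ℝ≥0∞) := by
  obtain ⟨t, ht, htm, hst, hinj⟩ := exists_partition_injOn_of_det_ne_zero hf' hdet
  simp only [encard_inter_preimage_singleton_eq_tsum ht hst hinj]
  exact .tsum fun n => measurable_one.indicator <|
    measurable_image_of_fderivWithin (hs.inter (htm n))
      (fun x hx => (hf' x hx.1).mono inter_subset_left) (hinj n)

theorem map_withDensity_abs_det_fderiv_eq_withDensity_encard (hs : MeasurableSet s)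
    (hf : Measurable f) (hf' : ∀ x ∈ s, HasFDerivWithinAt f (f' x) s x)
    (hdet : ∀ x ∈ s, (f' x).det ≠ 0) :
    ((μ.restrict s).withDensity fun x => ENNReal.ofReal |(f' x).det|).map f =
      μ.withDensity fun y => (s ∩ f ⁻¹' {y}).encard := by
  obtain ⟨t, ht, htm, hst, hinj⟩ := exists_partition_injOn_of_det_ne_zero hf' hdet
  have hstm : ∀ n, MeasurableSet (s ∩ t n) := fun n => hs.inter (htm n)
  have hderiv : ∀ n, ∀ x ∈ s ∩ t n, HasFDerivWithinAt f (f' x) (s ∩ t n) x := fun n x hx =>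
    (hf' x hx.1).mono inter_subset_left
  have himage : ∀ n, MeasurableSet (f '' (s ∩ t n)) := fun n =>
    measurable_image_of_fderivWithin (hstm n) (hderiv n) (hinj n)
  ext B hB
  have hpiece : ∀ n, ∫⁻ x in s ∩ t n ∩ f ⁻¹' B, ENNReal.ofReal |(f' x).det| ∂μ =
      ∫⁻ y in B, (f '' (s ∩ t n)).indicator 1 y ∂μ := by
    intro n
    rw [lintegral_abs_det_fderiv_eq_addHaar_image μ ((hstm n).inter (hf hB))
      (fun x hx => (hderiv n x hx.1).mono inter_subset_left) ((hinj n).mono inter_subset_left),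
      lintegral_indicator_one (himage n), Measure.restrict_apply (himage n), image_inter_preimage]
  have hpieces : f ⁻¹' B ∩ s = ⋃ n, s ∩ t n ∩ f ⁻¹' B := by
    rw [← iUnion_inter, ← inter_iUnion, inter_eq_left.2 hst, inter_comm]
  rw [Measure.map_apply hf hB, withDensity_apply _ (hf hB), withDensity_apply _ hB,
    Measure.restrict_restrict (hf hB), hpieces,
    lintegral_iUnion (fun n => (hstm n).inter (hf hB)) fun i j hij =>
      (ht hij).mono (fun x hx => hx.1.2) fun x hx => hx.1.2]
  simp only [hpiece, encard_inter_preimage_singleton_eq_tsum ht hst hinj]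
  exact (lintegral_tsum fun n => (measurable_one.indicator (himage n)).aemeasurable).symm

variable {F : Type*} [NormedAddCommGroup F] [NormedSpace ℝ F] {g : E → F}

theorem setIntegral_abs_det_fderiv_smul_comp (hs : MeasurableSet s) (hf : Measurable f)
    (hf' : ∀ x ∈ s, HasFDerivWithinAt f (f' x) s x) (hdetm : Measurable fun x => (f' x).det)
    (hdet : ∀ x ∈ s, (f' x).det ≠ 0) {C : ℕ} (hC : ∀ᵐ y ∂μ, (s ∩ f ⁻¹' {y}).encard ≤ C)
    (hg : Integrable g μ) :
    Integrable (fun y => ((s ∩ f ⁻¹' {y}).ncard : ℝ) • g y) μ ∧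
      IntegrableOn (fun x => |(f' x).det| • g (f x)) s μ ∧
      ∫ x in s, |(f' x).det| • g (f x) ∂μ = ∫ y, ((s ∩ f ⁻¹' {y}).ncard : ℝ) • g y ∂μ := by
  have hmap := map_withDensity_abs_det_fderiv_eq_withDensity_encard μ hs hf hf' hdet
  have hcount := measurable_encard_inter_preimage_singleton hs hf' hdet
  have hcount_lt : ∀ᵐ y ∂μ, ((s ∩ f ⁻¹' {y}).encard : ℝ≥0∞) < ∞ := by
    filter_upwards [hC] with y hy
    exact (ENat.toENNReal_le.2 hy).trans_lt (by simp)
  have hdet_lt : ∀ᵐ x ∂μ.restrict s, ENNReal.ofReal |(f' x).det| < ∞ := by simp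
  have hncard : ∀ y, ((s ∩ f ⁻¹' {y}).encard : ℝ≥0∞).toReal = (s ∩ f ⁻¹' {y}).ncard := fun y =>
    toReal_encard_eq_ncard _
  simp only [← hncard]
  have hcount_int : Integrable (fun y => ((s ∩ f ⁻¹' {y}).encard : ℝ≥0∞).toReal • g y) μ := by
    refine hg.bdd_smul C hcount.ennreal_toReal.aestronglyMeasurable ?_
    filter_upwards [hC] with y hy
    rw [hncard, Real.norm_natCast, Nat.cast_le]
    exact ENat.toNat_le_of_le_natCast hy
  have hg_map : Integrable g (((μ.restrict s).withDensity
      fun x => ENNReal.ofReal |(f' x).det|).map f) := by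
    rw [hmap, integrable_withDensity_iff_integrable_smul' hcount hcount_lt]
    exact hcount_int
  refine ⟨hcount_int, ?_, ?_⟩
  · simpa [ENNReal.toReal_ofReal, IntegrableOn] using
      (integrable_withDensity_iff_integrable_smul' hdetm.abs.ennreal_ofReal hdet_lt).1
        ((integrable_map_measure hg_map.1 hf.aemeasurable).1 hg_map)
  · have h := integral_map hf.aemeasurable hg_map.1
    rw [integral_withDensity_eq_integral_toReal_smul hdetm.abs.ennreal_ofReal hdet_lt, hmap,
      integral_withDensity_eq_integral_toReal_smul hcount hcount_lt] at h
    simpa [ENNReal.toReal_ofReal] using h.symm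

theorem integral_det_fderiv_smul_comp (hf' : ∀ x, HasFDerivAt f (f' x) x)
    (hcont : Continuous fun x => (f' x).det) {d : ℤ} {C : ℕ}
    (hdeg : ∀ᵐ y ∂μ, HasDegreeAt f f' d C y) (hg : Integrable g μ) :
    Integrable (fun x => (f' x).det • g (f x)) μ ∧
      ∫ x, (f' x).det • g (f x) ∂μ = d • ∫ y, g y ∂μ := by
  have hf : Measurable f :=
    (continuous_iff_continuousAt.2 fun x => (hf' x).continuousAt).measurable
  set P : Set E := {x | 0 < (f' x).det}
  set Q : Set E := {x | (f' x).det < 0}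
  have hP : MeasurableSet P := (isOpen_lt continuous_const hcont).measurableSet
  have hQ : MeasurableSet Q := (isOpen_lt hcont continuous_const).measurableSet
  have hbound : ∀ s : Set E, ∀ᵐ y ∂μ, (s ∩ f ⁻¹' {y}).encard ≤ C := fun s =>
    hdeg.mono fun y hy => (encard_le_encard inter_subset_right).trans hy.encard_le_and_ncard_sub.1
  obtain ⟨hcountP, hintP, hP_eq⟩ := setIntegral_abs_det_fderiv_smul_comp μ hP hf
    (fun x _ => (hf' x).hasFDerivWithinAt) hcont.measurable (fun x (hx : 0 < _) => hx.ne')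
    (hbound P) hg
  obtain ⟨hcountQ, hintQ, hQ_eq⟩ := setIntegral_abs_det_fderiv_smul_comp μ hQ hf
    (fun x _ => (hf' x).hasFDerivWithinAt) hcont.measurable (fun x (hx : _ < 0) => hx.ne)
    (hbound Q) hg
  have hsplit : (fun x => (f' x).det • g (f x)) = fun x =>
      P.indicator (fun x => |(f' x).det| • g (f x)) x -
        Q.indicator (fun x => |(f' x).det| • g (f x)) x := by
    funext x
    rcases lt_trichotomy (f' x).det 0 with h | h | h
    · simp [P, Q, h, h.not_gt, abs_of_neg h]
    · simp [P, Q, h]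
    · simp [P, Q, h, h.not_gt, abs_of_pos h]
  have hindP := hintP.integrable_indicator hP
  have hindQ := hintQ.integrable_indicator hQ
  rw [hsplit]
  refine ⟨hindP.sub hindQ, ?_⟩
  rw [integral_sub hindP hindQ, integral_indicator hP, integral_indicator hQ, hP_eq, hQ_eq,
    ← integral_sub hcountP hcountQ, ← Int.cast_smul_eq_zsmul ℝ, ← integral_smul]
  refine integral_congr_ae (hdeg.mono fun y hy => ?_)
  dsimp only
  rw [← sub_smul, ← hy.encard_le_and_ncard_sub.2]
  push_cast
  rfl

end AreaFormula

section Coefficients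

open Polynomial

section Ring

variable {R : Type*} [CommRing R] {m n : ℕ}

/-- The polynomial of degree less than `n` with the given coefficients, lowest degree first. -/
noncomputable def polyOfCoeffs (n : ℕ) : (Fin n → R) →ₗ[R] R[X] :=
  Fintype.linearCombination R fun i : Fin n => X ^ (i : ℕ)

/-- The monic polynomial of degree `n` whose lower coefficients are given, lowest degree first.
The vector of `monicPoly` lists them highest degree first. -/
noncomputable def monicOfCoeffs (a : Fin n → R) : R[X] :=
  X ^ n + polyOfCoeffs n a

theorem coeff_polyOfCoeffs (a : Fin n → R) (k : ℕ) :
    (polyOfCoeffs n a).coeff k = if h : k < n then a ⟨k, h⟩ else 0 := by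
  simp only [polyOfCoeffs, Fintype.linearCombination_apply, finsetSum_coeff, coeff_smul,
    coeff_X_pow, smul_eq_mul, mul_ite, mul_one, mul_zero]
  split_ifs with h
  · rw [Finset.sum_eq_single_of_mem ⟨k, h⟩ (Finset.mem_univ _) fun i _ hi =>
      if_neg fun hki => hi (Fin.ext hki.symm)]
    simp
  · exact Finset.sum_eq_zero fun i _ => if_neg fun hki : k = i => h (hki ▸ i.2)

theorem degree_polyOfCoeffs_lt (a : Fin n → R) : (polyOfCoeffs n a).degree < n :=
  (degree_lt_iff_coeff_zero _ _).2 fun k hk => by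
    rw [coeff_polyOfCoeffs, dif_neg (not_lt.2 hk)]

theorem coeff_monicOfCoeffs (a : Fin n → R) (k : ℕ) :
    (monicOfCoeffs a).coeff k = if h : k < n then a ⟨k, h⟩ else if k = n then 1 else 0 := by
  rw [monicOfCoeffs, coeff_add, coeff_X_pow, coeff_polyOfCoeffs]
  split_ifs <;> first | lia | simp

theorem coeff_monicOfCoeffs_fin (a : Fin n → R) (i : Fin n) : (monicOfCoeffs a).coeff i = a i := by
  simp [coeff_monicOfCoeffs]

theorem monic_monicOfCoeffs (a : Fin n → R) : (monicOfCoeffs a).Monic :=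
  monic_X_pow_add (degree_polyOfCoeffs_lt a)

theorem natDegree_monicOfCoeffs [Nontrivial R] (a : Fin n → R) :
    (monicOfCoeffs a).natDegree = n := by
  rw [monicOfCoeffs, natDegree_add_eq_left_of_degree_lt, natDegree_X_pow]
  simpa using degree_polyOfCoeffs_lt a

theorem monicOfCoeffs_coeff [Nontrivial R] {p : R[X]} (hp : p.Monic) (hpn : p.natDegree = n) :
    monicOfCoeffs (fun i : Fin n => p.coeff i) = p := by
  ext k
  rw [coeff_monicOfCoeffs]
  split_ifs with hlt heq
  · rfl
  · rw [heq, ← hpn, coeff_natDegree, hp.leadingCoeff]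
  · exact (coeff_eq_zero_of_natDegree_lt (by lia)).symm

theorem monicOfCoeffs_injective : Function.Injective (monicOfCoeffs : (Fin n → R) → R[X]) :=
  fun a b hab => funext fun i => by
    rw [← coeff_monicOfCoeffs_fin a, hab, coeff_monicOfCoeffs_fin]

theorem map_monicOfCoeffs {S : Type*} [CommRing S] (φ : R →+* S) (a : Fin n → R) :
    (monicOfCoeffs a).map φ = monicOfCoeffs fun i => φ (a i) := by
  simp [monicOfCoeffs, polyOfCoeffs, Fintype.linearCombination_apply, Polynomial.map_sum,
    smul_eq_C_mul]

/-- The monic polynomial whose lower coefficients are the first `m` entries of `x`. -/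
noncomputable def leftFactor (x : Fin (m + n) → R) : R[X] :=
  monicOfCoeffs fun i : Fin m => x (Fin.castAdd n i)

/-- The monic polynomial whose lower coefficients are the last `n` entries of `x`. -/
noncomputable def rightFactor (x : Fin (m + n) → R) : R[X] :=
  monicOfCoeffs fun i : Fin n => x (Fin.natAdd m i)

/-- Multiplication of a monic polynomial of degree `m` by one of degree `n`, in coordinates. -/
noncomputable def mulCoeffs (m n : ℕ) (x : Fin (m + n) → R) : Fin (m + n) → R :=
  fun i => (leftFactor x * rightFactor x).coeff i

theorem monic_leftFactor (x : Fin (m + n) → R) : (leftFactor x).Monic :=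
  monic_monicOfCoeffs _

theorem monic_rightFactor (x : Fin (m + n) → R) : (rightFactor x).Monic :=
  monic_monicOfCoeffs _

theorem monicOfCoeffs_mulCoeffs [Nontrivial R] (x : Fin (m + n) → R) :
    monicOfCoeffs (mulCoeffs m n x) = leftFactor x * rightFactor x := by
  refine monicOfCoeffs_coeff ((monic_leftFactor x).mul (monic_rightFactor x)) ?_
  rw [(monic_leftFactor x).natDegree_mul (monic_rightFactor x), leftFactor, rightFactor,
    natDegree_monicOfCoeffs, natDegree_monicOfCoeffs]

theorem sylvester_mulVec {f g : R[X]} (hf : f.natDegree ≤ m) (hg : g.natDegree ≤ n)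
    (h : Fin (m + n) → R) (i : Fin (m + n)) :
    (sylvester f g m n).mulVec h i =
      (f * polyOfCoeffs n (fun j => h (Fin.natAdd m j)) +
        polyOfCoeffs m (fun j => h (Fin.castAdd n j)) * g).coeff i := by
  let p : degreeLT R m × degreeLT R n :=
    (⟨_, mem_degreeLT.2 (degree_polyOfCoeffs_lt fun j => h (Fin.castAdd n j))⟩,
      ⟨_, mem_degreeLT.2 (degree_polyOfCoeffs_lt fun j => h (Fin.natAdd m j))⟩)
  have hp :
      h = (((degreeLT.basis R m).prod (degreeLT.basis R n)).reindex finSumFinEquiv).repr p := by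
    funext j
    refine Fin.addCases (fun j => ?_) (fun j => ?_) j <;> simp [p, coeff_polyOfCoeffs]
  conv_lhs => rw [hp, ← toMatrix_sylvesterMap' f g hf hg, LinearMap.toMatrix_mulVec_repr]
  simp [p, mul_comm]

end Ring

section Derivative

variable {K : Type*} [NontriviallyNormedField K] [CompleteSpace K] {m n : ℕ}

theorem hasFDerivAt_coeff_monicOfCoeffs {k : ℕ} (e : Fin n → Fin k) (j : ℕ)
    (x : Fin k → K) :
    HasFDerivAt (fun x : Fin k → K => (monicOfCoeffs fun i => x (e i)).coeff j)
      (LinearMap.toContinuousLinearMap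
        (lcoeff K j ∘ₗ polyOfCoeffs n ∘ₗ LinearMap.funLeft K K e)) x := by
  simp only [monicOfCoeffs, coeff_add]
  exact (LinearMap.toContinuousLinearMap
    (lcoeff K j ∘ₗ polyOfCoeffs n ∘ₗ LinearMap.funLeft K K e)).hasFDerivAt.const_add _

/-- The derivative of `mulCoeffs`, given by the Sylvester matrix of the two factors. -/
noncomputable def mulCoeffsDeriv (m n : ℕ) (x : Fin (m + n) → K) :
    (Fin (m + n) → K) →L[K] (Fin (m + n) → K) :=
  LinearMap.toContinuousLinearMap (Matrix.toLin' (sylvester (leftFactor x) (rightFactor x) m n))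

theorem hasFDerivAt_mulCoeffs (x : Fin (m + n) → K) :
    HasFDerivAt (mulCoeffs m n) (mulCoeffsDeriv m n x) x := by
  refine hasFDerivAt_pi'.2 fun i => ?_
  simp only [mulCoeffs, coeff_mul]
  refine (HasFDerivAt.fun_sum fun p _ =>
    (hasFDerivAt_coeff_monicOfCoeffs (Fin.castAdd n) p.1 x).mul
      (hasFDerivAt_coeff_monicOfCoeffs (Fin.natAdd m) p.2 x)).congr_fderiv ?_
  ext1 h
  have hsylvester := sylvester_mulVec (natDegree_monicOfCoeffs fun j => x (Fin.castAdd n j)).le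
    (natDegree_monicOfCoeffs fun j => x (Fin.natAdd m j)).le h i
  rw [coeff_add, coeff_mul, coeff_mul, ← Finset.sum_add_distrib] at hsylvester
  simp [mulCoeffsDeriv, leftFactor, rightFactor, hsylvester, LinearMap.funLeft, Function.comp_def,
    mul_comm]

theorem det_mulCoeffsDeriv (x : Fin (m + n) → K) :
    (mulCoeffsDeriv m n x).det = resultant (leftFactor x) (rightFactor x) m n := by
  rw [mulCoeffsDeriv, ContinuousLinearMap.det, LinearMap.coe_toContinuousLinearMap,
    LinearMap.det_toLin', resultant]

theorem continuous_mulCoeffsDeriv :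
    Continuous (mulCoeffsDeriv m n : (Fin (m + n) → K) → _) := by
  have hcoeff {k : ℕ} (e : Fin k → Fin (m + n)) (j : ℕ) :
      Continuous fun x : Fin (m + n) → K => (monicOfCoeffs fun i => x (e i)).coeff j :=
    continuous_iff_continuousAt.2 fun x => (hasFDerivAt_coeff_monicOfCoeffs e j x).continuousAt
  have hsylvester : Continuous fun x : Fin (m + n) → K =>
      sylvester (leftFactor x) (rightFactor x) m n := by
    refine continuous_matrix fun i j => Fin.addCases (fun j => ?_) (fun j => ?_) j
    · simp only [sylvester, Matrix.of_apply, Fin.addCases_left]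
      split_ifs
      exacts [hcoeff _ _, continuous_const]
    · simp only [sylvester, Matrix.of_apply, Fin.addCases_right]
      split_ifs
      exacts [hcoeff _ _, continuous_const]
  exact (LinearMap.continuous_of_finiteDimensional
    (LinearMap.toContinuousLinearMap.toLinearMap ∘ₗ Matrix.toLin'.toLinearMap)).comp hsylvester

end Derivative

section Divisors

variable {K : Type*} [Field K] {m n : ℕ}

theorem divByMonic_mul_eq_of_dvd {f q : K[X]} (hq : q.Monic) (hqf : q ∣ f) : f /ₘ q * q = f := by
  obtain ⟨g, rfl⟩ := hqf
  rw [mul_divByMonic_cancel_left _ hq, mul_comm]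

theorem natDegree_monicOfCoeffs_divByMonic (y : Fin (m + n) → K) {q : K[X]} (hq : q.Monic)
    (hqn : q.natDegree = n) : (monicOfCoeffs y /ₘ q).natDegree = m := by
  rw [natDegree_divByMonic _ hq, natDegree_monicOfCoeffs, hqn, Nat.add_sub_cancel]

theorem resultant_divByMonic_ne_zero_iff {y : Fin (m + n) → K} {q : K[X]} (hq : q.Monic)
    (hqn : q.natDegree = n) :
    resultant (monicOfCoeffs y /ₘ q) q m n ≠ 0 ↔ IsCoprime (monicOfCoeffs y /ₘ q) q := by
  have hzero := resultant_eq_zero_iff (f := monicOfCoeffs y /ₘ q) (g := q)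
  rw [natDegree_monicOfCoeffs_divByMonic y hq hqn, hqn] at hzero
  simp [hzero, hq.ne_zero]

/-- The lower coefficients of the cofactor of `q` in `monicOfCoeffs y`, followed by those
of `q`: the point of the fibre of `mulCoeffs` over `y` that corresponds to the divisor `q`. -/
noncomputable def splitCoeffs (m n : ℕ) (y : Fin (m + n) → K) (q : K[X]) : Fin (m + n) → K :=
  Fin.append (fun i : Fin m => (monicOfCoeffs y /ₘ q).coeff i) fun i : Fin n => q.coeff i

theorem rightFactor_splitCoeffs {y : Fin (m + n) → K} {q : K[X]} (hq : q.Monic)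
    (hqn : q.natDegree = n) : rightFactor (splitCoeffs m n y q) = q := by
  simp only [rightFactor, splitCoeffs, Fin.append_right]
  exact monicOfCoeffs_coeff hq hqn

theorem leftFactor_splitCoeffs {y : Fin (m + n) → K} {q : K[X]} (hq : q.Monic)
    (hqn : q.natDegree = n) (hqy : q ∣ monicOfCoeffs y) :
    leftFactor (splitCoeffs m n y q) = monicOfCoeffs y /ₘ q := by
  simp only [leftFactor, splitCoeffs, Fin.append_left]
  have hmul := divByMonic_mul_eq_of_dvd hq hqy
  refine monicOfCoeffs_coeff (hq.of_mul_monic_right (hmul.symm ▸ monic_monicOfCoeffs y))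
    (natDegree_monicOfCoeffs_divByMonic y hq hqn)

theorem mulCoeffs_splitCoeffs {y : Fin (m + n) → K} {q : K[X]} (hq : q.Monic)
    (hqn : q.natDegree = n) (hqy : q ∣ monicOfCoeffs y) :
    mulCoeffs m n (splitCoeffs m n y q) = y := by
  apply monicOfCoeffs_injective
  rw [monicOfCoeffs_mulCoeffs, rightFactor_splitCoeffs hq hqn, leftFactor_splitCoeffs hq hqn hqy,
    divByMonic_mul_eq_of_dvd hq hqy]

theorem splitCoeffs_mulCoeffs (x : Fin (m + n) → K) :
    splitCoeffs m n (mulCoeffs m n x) (rightFactor x) = x := by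
  funext i
  refine Fin.addCases (fun j => ?_) (fun j => ?_) i
  · rw [splitCoeffs, monicOfCoeffs_mulCoeffs, mul_comm,
      mul_divByMonic_cancel_left _ (monic_rightFactor x), Fin.append_left, leftFactor,
      coeff_monicOfCoeffs_fin]
  · rw [splitCoeffs, Fin.append_right, rightFactor, coeff_monicOfCoeffs_fin]

end Divisors

section RCLike

variable {K : Type*} [RCLike K] {m n : ℕ}

theorem det_restrictScalars_mulCoeffsDeriv (x : Fin (m + n) → K) :
    ((mulCoeffsDeriv m n x).restrictScalars ℝ).det =
      Algebra.norm ℝ (resultant (leftFactor x) (rightFactor x) m n) := by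
  rw [← det_mulCoeffsDeriv, ContinuousLinearMap.det, ← LinearMap.det_restrictScalars]
  rfl

theorem integral_norm_resultant_smul_comp_mulCoeffs [MeasurableSpace K] [BorelSpace K]
    (μ : Measure (Fin (m + n) → K)) [μ.IsAddHaarMeasure] {d : ℤ} {C : ℕ}
    (hdeg : ∀ᵐ y ∂μ, HasDegreeAt (mulCoeffs m n) (fun x => (mulCoeffsDeriv m n x).restrictScalars ℝ)
      d C y) {E : Type*} [NormedAddCommGroup E] [NormedSpace ℝ E] {g : (Fin (m + n) → K) → E}
    (hg : Integrable g μ) :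
    Integrable (fun x => Algebra.norm ℝ (resultant (leftFactor x) (rightFactor x) m n) •
        g (mulCoeffs m n x)) μ ∧
      ∫ x, Algebra.norm ℝ (resultant (leftFactor x) (rightFactor x) m n) • g (mulCoeffs m n x) ∂μ =
        d • ∫ y, g y ∂μ := by
  simp only [← det_restrictScalars_mulCoeffsDeriv]
  exact integral_det_fderiv_smul_comp μ (fun x => (hasFDerivAt_mulCoeffs x).restrictScalars ℝ)
    (ContinuousLinearMap.continuous_det.comp
      ((ContinuousLinearMap.restrictScalarsL K _ _ ℝ ℝ).continuous.comp continuous_mulCoeffsDeriv))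
    hdeg hg

theorem hasDegreeAt_mulCoeffs {y : Fin (m + n) → K} {D : Finset K[X]}
    (hD : ∀ q, q ∈ D ↔ q.Monic ∧ q.natDegree = n ∧ q ∣ monicOfCoeffs y) {d : ℤ} {C : ℕ}
    (hC : D.card ≤ C)
    (hd : ∑ q ∈ D, (SignType.sign (Algebra.norm ℝ (resultant (monicOfCoeffs y /ₘ q) q m n)) : ℤ) =
      d) :
    HasDegreeAt (mulCoeffs m n) (fun x => (mulCoeffsDeriv m n x).restrictScalars ℝ) d C y := by
  classical
  refine ⟨D.image (splitCoeffs m n y), ?_, Finset.card_image_le.trans hC, ?_⟩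
  · ext x
    simp only [Finset.coe_image, Set.mem_image, SetLike.mem_coe, Set.mem_preimage,
      Set.mem_singleton_iff]
    constructor
    · rintro ⟨q, hq, rfl⟩
      obtain ⟨hmonic, hdeg, hdvd⟩ := (hD q).1 hq
      exact mulCoeffs_splitCoeffs hmonic hdeg hdvd
    · rintro rfl
      refine ⟨_, (hD _).2 ⟨monic_rightFactor x, natDegree_monicOfCoeffs _, ?_⟩,
        splitCoeffs_mulCoeffs x⟩
      exact monicOfCoeffs_mulCoeffs x ▸ dvd_mul_left _ _
  · have hinj : Set.InjOn (splitCoeffs m n y) D := fun p hp q hq hpq => by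
      obtain ⟨hp_monic, hp_deg, -⟩ := (hD p).1 hp
      obtain ⟨hq_monic, hq_deg, -⟩ := (hD q).1 hq
      rw [← rightFactor_splitCoeffs (m := m) (y := y) hp_monic hp_deg, hpq,
        rightFactor_splitCoeffs hq_monic hq_deg]
    rw [Finset.sum_image hinj, ← hd]
    refine Finset.sum_congr rfl fun q hq => ?_
    obtain ⟨hmonic, hdeg, hdvd⟩ := (hD q).1 hq
    rw [det_restrictScalars_mulCoeffsDeriv, leftFactor_splitCoeffs hmonic hdeg hdvd,
      rightFactor_splitCoeffs hmonic hdeg]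

theorem ae_not_mul_self_dvd_monicOfCoeffs [MeasurableSpace K] [BorelSpace K]
    (μ : Measure (Fin (m + n) → K)) [μ.IsAddHaarMeasure] (hn : n ≠ 0) :
    ∀ᵐ y ∂μ, ∀ p : K[X], p.Monic → p.natDegree = n → ¬ p * p ∣ monicOfCoeffs y := by
  -- By Sard, the critical values of `mulCoeffs` are null; a double factor is a critical point.
  have hcritical := addHaar_image_eq_zero_of_det_fderivWithin_eq_zero μ
    (s := {x : Fin (m + n) → K | ((mulCoeffsDeriv m n x).restrictScalars ℝ).det = 0})
    (fun x _ => ((hasFDerivAt_mulCoeffs x).restrictScalars ℝ).hasFDerivWithinAt) fun _ hx => hx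
  rw [ae_iff]
  refine measure_mono_null (fun y hy => ?_) hcritical
  simp only [not_forall, not_not, Set.mem_ofPred_eq] at hy
  obtain ⟨p, hp, hpn, hppy⟩ := hy
  have hpy : p ∣ monicOfCoeffs y := (dvd_mul_left p p).trans hppy
  refine ⟨splitCoeffs m n y p, ?_, mulCoeffs_splitCoeffs hp hpn hpy⟩
  have hnot_coprime : ¬ IsCoprime (monicOfCoeffs y /ₘ p) p := by
    intro hcoprime
    obtain ⟨r, hr⟩ := hppy
    rw [hr, mul_assoc, mul_divByMonic_cancel_left _ hp] at hcoprime
    have hunit := hcoprime.isUnit_of_dvd' (dvd_mul_right p r) dvd_rfl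
    exact hn (hpn.symm.trans (natDegree_eq_zero_of_isUnit hunit))
  have hleft := leftFactor_splitCoeffs hp hpn hpy
  have hresultant : resultant (leftFactor (splitCoeffs m n y p))
      (rightFactor (splitCoeffs m n y p)) m n = 0 := by
    by_contra hne
    rw [hleft, rightFactor_splitCoeffs hp hpn] at hne
    exact hnot_coprime ((resultant_divByMonic_ne_zero_iff hp hpn).1 hne)
  rw [Set.mem_ofPred_eq, det_restrictScalars_mulCoeffsDeriv, hresultant, Algebra.norm_zero]

theorem ae_separable_monicOfCoeffs [MeasurableSpace K] [BorelSpace K]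
    (μ : Measure (Fin n → K)) [μ.IsAddHaarMeasure] :
    ∀ᵐ y ∂μ, (monicOfCoeffs y).Separable := by
  have hsquare : ∀ᵐ y ∂μ, ∀ k ≠ 0, k ≤ n → ∀ p : K[X], p.Monic → p.natDegree = k →
      ¬ p * p ∣ monicOfCoeffs y := by
    refine ae_all_iff.2 fun k => ?_
    by_cases hk : k ≠ 0 ∧ k ≤ n
    · obtain ⟨m, rfl⟩ := Nat.exists_eq_add_of_le' hk.2
      filter_upwards [ae_not_mul_self_dvd_monicOfCoeffs μ hk.1] with y hy _ _ using hy
    · exact .of_forall fun y hk0 hkn => (hk ⟨hk0, hkn⟩).elim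
  filter_upwards [hsquare] with y hy
  rw [PerfectField.separable_iff_squarefree]
  intro p hpp
  by_contra hunit
  have hp0 : p ≠ 0 := by
    rintro rfl
    exact (monic_monicOfCoeffs y).ne_zero (by simpa using hpp)
  have hpn : p.natDegree ≤ n := by
    simpa [natDegree_monicOfCoeffs] using
      natDegree_le_of_dvd ((dvd_mul_left p p).trans hpp) (monic_monicOfCoeffs y).ne_zero
  refine hy p.natDegree (fun h => hunit ?_) hpn (normalize p) (monic_normalize hp0)
    (natDegree_eq_of_degree_eq degree_normalize) ?_
  · exact isUnit_iff_degree_eq_zero.2 (by rw [degree_eq_natDegree hp0, h]; rfl)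
  · exact (mul_dvd_mul (normalize_associated p).dvd (normalize_associated p).dvd).trans hpp

end RCLike

end Coefficients

section LinearFactors

open Polynomial

variable {K : Type*} [Field K]

theorem mem_image_X_sub_C_roots_iff {f : K[X]} (hf : f ≠ 0) [DecidableEq K]
    [DecidableEq K[X]] (q : K[X]) :
    q ∈ f.roots.toFinset.image (fun z => X - C z) ↔ q.Monic ∧ q.natDegree = 1 ∧ q ∣ f := by
  simp only [Finset.mem_image, Multiset.mem_toFinset, mem_roots hf]
  constructor
  · rintro ⟨z, hz, rfl⟩
    exact ⟨monic_X_sub_C z, natDegree_X_sub_C z, dvd_iff_isRoot.2 hz⟩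
  · rintro ⟨hmonic, hdeg, hdvd⟩
    have hq : X - C (-q.coeff 0) = q := by
      rw [map_neg, sub_neg_eq_add, ← hmonic.eq_X_add_C hdeg]
    exact ⟨_, dvd_iff_isRoot.1 (hq.symm ▸ hdvd), hq⟩

theorem isCoprime_divByMonic_of_separable {f q : K[X]} (hf : f.Separable) (hq : q.Monic)
    (hqf : q ∣ f) : IsCoprime (f /ₘ q) q :=
  Separable.isCoprime (by rwa [divByMonic_mul_eq_of_dvd hq hqf])

theorem ae_hasDegreeAt_mulCoeffs_one (m : ℕ) : ∀ᵐ y : Fin (m + 1) → ℂ,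
    HasDegreeAt (mulCoeffs m 1) (fun x => (mulCoeffsDeriv m 1 x).restrictScalars ℝ)
      (m + 1 : ℕ) (m + 1) y := by
  classical
  filter_upwards [ae_separable_monicOfCoeffs (volume : Measure (Fin (m + 1) → ℂ))] with y hy
  have hmem := mem_image_X_sub_C_roots_iff (monic_monicOfCoeffs y).ne_zero
  have hcard : ((monicOfCoeffs y).roots.toFinset.image fun z => X - C z).card = m + 1 := by
    rw [Finset.card_image_of_injective _ fun a b h => by simpa using h,
      Multiset.toFinset_card_of_nodup (nodup_roots hy),
      ← (IsAlgClosed.splits _).natDegree_eq_card_roots, natDegree_monicOfCoeffs]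
  refine hasDegreeAt_mulCoeffs hmem hcard.le ?_
  suffices hsign : ∀ q ∈ (monicOfCoeffs y).roots.toFinset.image fun z => X - C z,
      (SignType.sign (Algebra.norm ℝ (resultant (monicOfCoeffs y /ₘ q) q m 1)) : ℤ) = 1 by
    rw [Finset.sum_congr rfl hsign, Finset.sum_const, hcard, nsmul_one]
  intro q hq
  obtain ⟨hmonic, hdeg, hdvd⟩ := (hmem q).1 hq
  have hne := (resultant_divByMonic_ne_zero_iff hmonic hdeg).2
    (isCoprime_divByMonic_of_separable hy hmonic hdvd)
  simp [Algebra.norm_complex_apply, sign_pos (Complex.normSq_pos.2 hne)]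

end LinearFactors

section QuadraticFactors

open Polynomial

theorem resultant_quadratic_right {R : Type*} [CommRing R] [IsDomain R] {g : R[X]} {m : ℕ}
    (hg : g.natDegree ≤ m) (a b : R) :
    resultant g ((X - C a) * (X - C b)) m 2 = g.eval a * g.eval b := by
  have hmul := resultant_mul_right g (X - C a) (X - C b) m hg
  simp only [natDegree_X_sub_C, resultant_X_sub_C_right _ _ _ hg, Nat.reduceAdd] at hmul
  rw [hmul, mul_mul_mul_comm, ← pow_add, ← two_mul, pow_mul, neg_one_sq, one_pow, one_mul]

theorem sum_sign_prod_erase_sub (A : Finset ℝ) :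
    ∑ x ∈ A, (SignType.sign (∏ a ∈ A.erase x, (x - a)) : ℤ) = (A.card % 2 : ℕ) := by
  induction A using Finset.induction_on_max with
  | empty => simp
  | insert M A hM ih =>
    have hMA : M ∉ A := fun h => lt_irrefl _ (hM M h)
    have hmax : SignType.sign (∏ a ∈ A, (M - a)) = 1 :=
      sign_pos (Finset.prod_pos fun a ha => sub_pos.2 (hM a ha))
    have hflip : ∀ x ∈ A, (SignType.sign (∏ a ∈ (insert M A).erase x, (x - a)) : ℤ) =
        -SignType.sign (∏ a ∈ A.erase x, (x - a)) := fun x hx => by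
      rw [Finset.erase_insert_of_ne (hM x hx).ne',
        Finset.prod_insert fun h => hMA (Finset.mem_of_mem_erase h), sign_mul,
        sign_neg (sub_neg.2 (hM x hx))]
      simp
    rw [Finset.sum_insert hMA, Finset.erase_insert hMA, Finset.card_insert_of_notMem hMA, hmax,
      SignType.coe_one, Finset.sum_congr rfl hflip, Finset.sum_neg_distrib, ih]
    lia

theorem two_mul_sum_lt_mul {ι R : Type*} [LinearOrder ι] [CommRing R] (A : Finset ι) (ε : ι → R) :
    2 * ∑ p ∈ A ×ˢ A with p.1 < p.2, ε p.1 * ε p.2 = (∑ x ∈ A, ε x) ^ 2 - ∑ x ∈ A, ε x ^ 2 := by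
  have htrichotomy (x y : ι) : ε x * ε y = (if x < y then ε x * ε y else 0) +
      (if y < x then ε x * ε y else 0) + if x = y then ε x ^ 2 else 0 := by
    rcases lt_trichotomy x y with h | rfl | h
    · simp [h, h.not_gt, h.ne]
    · simp [sq]
    · simp [h, h.not_gt, h.ne']
  have hswap : ∑ x ∈ A, ∑ y ∈ A, (if y < x then ε x * ε y else 0) =
      ∑ x ∈ A, ∑ y ∈ A, if x < y then ε x * ε y else 0 := by
    rw [Finset.sum_comm]
    simp only [mul_comm]
  have hdiag : ∑ x ∈ A, ∑ y ∈ A, (if x = y then ε x ^ 2 else 0) = ∑ x ∈ A, ε x ^ 2 :=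
    Finset.sum_congr rfl fun x hx => by rw [Finset.sum_ite_eq, if_pos hx]
  rw [sq, Finset.sum_mul_sum, Finset.sum_congr rfl fun x _ => Finset.sum_congr rfl fun y _ =>
    htrichotomy x y]
  simp only [Finset.sum_add_distrib]
  rw [hswap, hdiag, Finset.sum_filter, Finset.sum_product]
  ring

theorem eval_pos_of_monic_of_not_isRoot {h : ℝ[X]} (hmonic : h.Monic) (hroot : ∀ x, ¬ h.IsRoot x)
    (x : ℝ) : 0 < h.eval x := by
  by_contra! hx
  rcases lt_or_ge 0 h.degree with hdeg | hdeg
  · have hlim := tendsto_atTop_of_leadingCoeff_nonneg h hdeg (by simp [hmonic.leadingCoeff])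
    obtain ⟨y, hxy, hy⟩ :=
      ((Filter.eventually_ge_atTop x).and (hlim.eventually_ge_atTop 0)).exists
    obtain ⟨c, -, hc⟩ := intermediate_value_Icc hxy h.continuous.continuousOn ⟨hx, hy⟩
    exact hroot c hc
  · rw [hmonic.degree_le_zero_iff_eq_one.1 hdeg, eval_one] at hx
    exact hx.not_gt one_pos

theorem sum_sign_eval_derivative {f : ℝ[X]} (hf : f.Monic) (hroots : f.roots.Nodup) :
    ∑ x ∈ f.roots.toFinset, (SignType.sign (f.derivative.eval x) : ℤ) =
      (f.roots.toFinset.card % 2 : ℕ) := by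
  rw [← sum_sign_prod_erase_sub]
  refine Finset.sum_congr rfl fun x hx => ?_
  obtain ⟨h, hfactor, -, hh⟩ := exists_prod_multiset_X_sub_C_mul f
  have hmonic : h.Monic :=
    (monic_multisetProd_X_sub_C f.roots).of_mul_monic_left (by rwa [hfactor])
  have hpos : 0 < h.eval x := eval_pos_of_monic_of_not_isRoot hmonic
    (fun y hy => by simpa [hh] using (mem_roots hmonic.ne_zero).2 hy) x
  have hprod : (f.roots.map fun a => X - C a).prod = ∏ a ∈ f.roots.toFinset, (X - C a) := by
    rw [Finset.prod, Multiset.toFinset_val, hroots.dedup]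
  have hderiv : f.derivative.eval x = (∏ a ∈ f.roots.toFinset.erase x, (x - a)) * h.eval x := by
    rw [hprod, ← Finset.mul_prod_erase _ _ hx, mul_assoc] at hfactor
    conv_lhs => rw [← hfactor]
    simp [derivative_mul, eval_prod]
  rw [hderiv, sign_mul, sign_pos hpos, mul_one]

/-- The monic real quadratic polynomial with roots `z` and its conjugate. -/
noncomputable def conjQuadratic (z : ℂ) : ℝ[X] :=
  X ^ 2 - C (2 * z.re) * X + C (Complex.normSq z)

theorem map_conjQuadratic (z : ℂ) :
    (conjQuadratic z).map (algebraMap ℝ ℂ) = (X - C z) * (X - C (starRingEnd ℂ z)) := by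
  simp only [conjQuadratic, Polynomial.map_add, Polynomial.map_sub, Polynomial.map_mul,
    Polynomial.map_pow, map_X, map_C, Complex.coe_algebraMap]
  rw [← Complex.add_conj z, ← Complex.mul_conj z, C_add, C_mul]
  ring

theorem monic_conjQuadratic (z : ℂ) : (conjQuadratic z).Monic := by
  rw [conjQuadratic]
  monicity!

theorem natDegree_conjQuadratic (z : ℂ) : (conjQuadratic z).natDegree = 2 := by
  rw [conjQuadratic]
  compute_degree!

theorem conjQuadratic_dvd {f : ℝ[X]} {z : ℂ} (hz : z.im ≠ 0) (hroot : aeval z f = 0) :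
    conjQuadratic z ∣ f := by
  rw [conjQuadratic, Complex.normSq_eq_norm_sq]
  exact quadratic_dvd_of_aeval_eq_zero_im_ne_zero f hroot hz

theorem injOn_conjQuadratic : Set.InjOn conjQuadratic {z : ℂ | 0 < z.im} := by
  intro z (hz : 0 < z.im) w (hw : 0 < w.im) hzw
  have hre : z.re = w.re := by
    simpa [conjQuadratic, coeff_X] using congrArg (coeff · 1) hzw
  have hnorm : z.re * z.re + z.im * z.im = w.re * w.re + w.im * w.im := by
    simpa [conjQuadratic, Complex.normSq_apply] using congrArg (coeff · 0) hzw
  refine Complex.ext hre ?_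
  rw [hre] at hnorm
  nlinarith

theorem eq_and_eq_of_X_sub_C_mul_X_sub_C_eq {K : Type*} [CommRing K] [IsDomain K] [LinearOrder K]
    {a b c d : K} (hab : a < b) (hcd : c < d)
    (h : (X - C a) * (X - C b) = (X - C c) * (X - C d)) : a = c ∧ b = d := by
  have hroots : ({a, b} : Multiset K) = {c, d} := by
    simpa [roots_mul, X_sub_C_ne_zero] using congrArg roots h
  rcases Multiset.cons_eq_cons.1 hroots with ⟨hac, hbd⟩ | ⟨hac, s, hb, hd⟩
  · exact ⟨hac, by simpa using hbd⟩
  · obtain ⟨rfl, rfl⟩ : b = c ∧ a = d := by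
      simp_all
    exact absurd hab hcd.not_gt

theorem aeval_ofReal_eq_zero_iff {f : ℝ[X]} {x : ℝ} : aeval (x : ℂ) f = 0 ↔ f.IsRoot x := by
  rw [← Complex.coe_algebraMap, aeval_algebraMap_eq_zero_iff, coe_aeval_eq_eval, IsRoot.def]

theorem monic_quadratic_eq_conjQuadratic_or_mul {q : ℝ[X]} (hmonic : q.Monic)
    (hdeg : q.natDegree = 2) :
    (∃ z : ℂ, 0 < z.im ∧ q = conjQuadratic z) ∨ ∃ a b, a ≤ b ∧ q = (X - C a) * (X - C b) := by
  by_cases hroot : ∃ a, q.IsRoot a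
  · right
    obtain ⟨a, ha⟩ := hroot
    have hsplits := Splits.of_natDegree_eq_two hdeg ha
    obtain ⟨b, c, hbc⟩ := Multiset.card_eq_two.1 (hsplits.natDegree_eq_card_roots.symm.trans hdeg)
    have hq : q = (X - C b) * (X - C c) := by
      simpa [hbc] using hsplits.eq_prod_roots_of_monic hmonic
    rcases le_total b c with h | h
    · exact ⟨b, c, h, hq⟩
    · exact ⟨c, b, h, hq.trans (mul_comm _ _)⟩
  · left
    obtain ⟨z, hz⟩ := IsAlgClosed.exists_aeval_eq_zero ℂ q (by
      rw [degree_eq_natDegree hmonic.ne_zero, hdeg]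
      norm_num)
    have him : z.im ≠ 0 := fun him => hroot ⟨z.re, aeval_ofReal_eq_zero_iff.1 (by
      rwa [Complex.conj_eq_iff_re.1 (Complex.conj_eq_iff_im.2 him)])⟩
    have heq {w : ℂ} (hw : 0 < w.im) (hroot : aeval w q = 0) :
        ∃ z : ℂ, 0 < z.im ∧ q = conjQuadratic z :=
      ⟨w, hw, eq_of_monic_of_dvd_of_natDegree_le (monic_conjQuadratic w) hmonic
        (conjQuadratic_dvd hw.ne' hroot) (by rw [hdeg, natDegree_conjQuadratic])⟩
    rcases him.lt_or_gt with h | h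
    · exact heq (w := starRingEnd ℂ z) (by simpa using h) (by rw [aeval_conj, hz, map_zero])
    · exact heq h hz

/-- The roots of a real polynomial in the open upper half plane. -/
noncomputable def upperRoots (f : ℝ[X]) : Finset ℂ :=
  {z ∈ (f.aroots ℂ).toFinset | 0 < z.im}

/-- The pairs of distinct real roots of a polynomial, each listed in increasing order. -/
noncomputable def realRootPairs (f : ℝ[X]) : Finset (ℝ × ℝ) :=
  {p ∈ f.roots.toFinset ×ˢ f.roots.toFinset | p.1 < p.2}

theorem mem_upperRoots {f : ℝ[X]} (hf : f ≠ 0) {z : ℂ} :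
    z ∈ upperRoots f ↔ aeval z f = 0 ∧ 0 < z.im := by
  simp [upperRoots, hf]

theorem mem_realRootPairs {f : ℝ[X]} (hf : f ≠ 0) {p : ℝ × ℝ} :
    p ∈ realRootPairs f ↔ (f.IsRoot p.1 ∧ f.IsRoot p.2) ∧ p.1 < p.2 := by
  simp [realRootPairs, hf]

theorem natDegree_eq_card_roots_add_two_mul_card_upperRoots {f : ℝ[X]} (hf : f.Separable) :
    f.natDegree = f.roots.toFinset.card + 2 * (upperRoots f).card := by
  have hf0 : f ≠ 0 := hf.ne_zero
  let Z := (f.aroots ℂ).toFinset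
  have hZ {z : ℂ} : z ∈ Z ↔ aeval z f = 0 := by simp [Z, hf0]
  have hcard : Z.card = f.natDegree := by
    rw [Multiset.toFinset_card_of_nodup (nodup_roots hf.map),
      ← (IsAlgClosed.splits _).natDegree_eq_card_roots, natDegree_map]
  have hreal : {z ∈ Z | z.im = 0}.card = f.roots.toFinset.card := by
    refine (Finset.card_nbij' ((↑) : ℝ → ℂ) Complex.re ?_ ?_ ?_ ?_).symm
    · intro x hx
      simp_all [aeval_ofReal_eq_zero_iff]
    · intro z hz
      obtain ⟨hroot, him⟩ : aeval z f = 0 ∧ z.im = 0 := by simpa [hZ] using hz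
      rw [← Complex.conj_eq_iff_re.1 (Complex.conj_eq_iff_im.2 him)] at hroot
      simpa [hf0] using aeval_ofReal_eq_zero_iff.1 hroot
    · exact fun x _ => Complex.ofReal_re x
    · exact fun z hz => Complex.conj_eq_iff_re.1
        (Complex.conj_eq_iff_im.2 (Finset.mem_filter.1 hz).2)
  have hlower : {z ∈ Z | z.im < 0}.card = (upperRoots f).card := by
    refine Finset.card_nbij' (starRingEnd ℂ) (starRingEnd ℂ) ?_ ?_
      (fun z _ => Complex.conj_conj z) (fun z _ => Complex.conj_conj z)
    · intro z hz
      simp_all [mem_upperRoots, aeval_conj]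
    · intro z hz
      simp_all [mem_upperRoots, aeval_conj]
  have htrichotomy :
      Z.card = {z ∈ Z | z.im = 0}.card + (upperRoots f).card + {z ∈ Z | z.im < 0}.card := by
    have hupper : upperRoots f = {z ∈ Z | 0 < z.im} := rfl
    rw [hupper, Finset.card_eq_sum_ones, Finset.card_filter, Finset.card_filter,
      Finset.card_filter, ← Finset.sum_add_distrib, ← Finset.sum_add_distrib]
    refine Finset.sum_congr rfl fun z _ => ?_
    rcases lt_trichotomy z.im 0 with h | h | h <;> simp [h, LT.lt.ne, LT.lt.ne', LT.lt.not_gt]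
  lia

/-- The monic quadratic divisors of a separable real polynomial. -/
noncomputable def quadraticDivisors (f : ℝ[X]) : Finset ℝ[X] :=
  open scoped Classical in
  (upperRoots f).image conjQuadratic ∪ (realRootPairs f).image fun p => (X - C p.1) * (X - C p.2)

theorem mem_quadraticDivisors {f : ℝ[X]} (hf : f.Separable) (q : ℝ[X]) :
    q ∈ quadraticDivisors f ↔ q.Monic ∧ q.natDegree = 2 ∧ q ∣ f := by
  classical
  simp only [quadraticDivisors, Finset.mem_union, Finset.mem_image, mem_upperRoots hf.ne_zero,
    mem_realRootPairs hf.ne_zero, Prod.exists]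
  constructor
  · rintro (⟨z, ⟨hz, him⟩, rfl⟩ | ⟨a, b, ⟨⟨ha, hb⟩, hab⟩, rfl⟩)
    · exact ⟨monic_conjQuadratic z, natDegree_conjQuadratic z, conjQuadratic_dvd him.ne' hz⟩
    · refine ⟨(monic_X_sub_C a).mul (monic_X_sub_C b), ?_, ?_⟩
      · rw [(monic_X_sub_C a).natDegree_mul (monic_X_sub_C b), natDegree_X_sub_C,
          natDegree_X_sub_C]
      · exact (isCoprime_X_sub_C_of_isUnit_sub (sub_ne_zero.2 hab.ne).isUnit).mul_dvd
          (dvd_iff_isRoot.2 ha) (dvd_iff_isRoot.2 hb)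
  · rintro ⟨hmonic, hdeg, hdvd⟩
    rcases monic_quadratic_eq_conjQuadratic_or_mul hmonic hdeg with ⟨z, hz, rfl⟩ | ⟨a, b, hab, rfl⟩
    · have hroot : aeval z (conjQuadratic z) = 0 := by
        rw [← eval_map_algebraMap, map_conjQuadratic]
        simp
      exact .inl ⟨z, ⟨aeval_eq_zero_of_dvd_aeval_eq_zero hdvd hroot, hz⟩, rfl⟩
    · have hne : a ≠ b := by
        rintro rfl
        exact not_isUnit_X_sub_C a (hf.squarefree _ hdvd)
      exact .inr ⟨a, b, ⟨⟨dvd_iff_isRoot.1 ((dvd_mul_right _ _).trans hdvd),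
        dvd_iff_isRoot.1 ((dvd_mul_left _ _).trans hdvd)⟩, hab.lt_of_ne hne⟩, rfl⟩

theorem conjQuadratic_ne_X_sub_C_mul_X_sub_C {z : ℂ} (hz : 0 < z.im) (a b : ℝ) :
    conjQuadratic z ≠ (X - C a) * (X - C b) := by
  intro h
  have hroot : ((a : ℂ) - z) * (a - starRingEnd ℂ z) = 0 := by
    simpa [map_conjQuadratic] using congrArg (fun p => (p.map (algebraMap ℝ ℂ)).eval (a : ℂ)) h
  rcases mul_eq_zero.1 hroot with h | h <;> simpa [hz.ne'] using congrArg Complex.im h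

theorem sum_quadraticDivisors {f : ℝ[X]} (hf : f ≠ 0) {M : Type*} [AddCommMonoid M]
    (φ : ℝ[X] → M) :
    ∑ q ∈ quadraticDivisors f, φ q = ∑ z ∈ upperRoots f, φ (conjQuadratic z) +
      ∑ p ∈ realRootPairs f, φ ((X - C p.1) * (X - C p.2)) := by
  classical
  rw [quadraticDivisors, Finset.sum_union, Finset.sum_image, Finset.sum_image]
  · rintro ⟨a, b⟩ hab ⟨c, d⟩ hcd h
    exact Prod.ext_iff.2 (eq_and_eq_of_X_sub_C_mul_X_sub_C_eq ((mem_realRootPairs hf).1 hab).2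
      ((mem_realRootPairs hf).1 hcd).2 h)
  · exact fun z hz w hw => injOn_conjQuadratic ((mem_upperRoots hf).1 hz).2
      ((mem_upperRoots hf).1 hw).2
  · simp only [Finset.disjoint_left, Finset.mem_image, not_exists, not_and]
    rintro _ ⟨z, hz, rfl⟩ p - h
    exact conjQuadratic_ne_X_sub_C_mul_X_sub_C ((mem_upperRoots hf).1 hz).2 _ _ h.symm

theorem sign_resultant_conjQuadratic {g : ℝ[X]} {m : ℕ} {z : ℂ} (hg : g.natDegree ≤ m)
    (hcoprime : IsCoprime g (conjQuadratic z)) (hz : 0 < z.im) :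
    SignType.sign (resultant g (conjQuadratic z) m 2) = 1 := by
  have hresultant : resultant g (conjQuadratic z) m 2 = Complex.normSq (aeval z g) := by
    apply Complex.ofReal_injective
    rw [← Complex.coe_algebraMap, ← resultant_map_map, map_conjQuadratic,
      resultant_quadratic_right (natDegree_map_le.trans hg), eval_map_algebraMap,
      eval_map_algebraMap, aeval_conj, Complex.mul_conj, Complex.coe_algebraMap]
  rw [hresultant, sign_pos (Complex.normSq_pos.2 fun h => ?_)]
  have hunit := hcoprime.isUnit_of_dvd' (conjQuadratic_dvd hz.ne' h) dvd_rfl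
  simpa [natDegree_conjQuadratic] using natDegree_eq_zero_of_isUnit hunit

theorem sign_resultant_X_sub_C_mul_X_sub_C {g : ℝ[X]} {m : ℕ} {a b : ℝ} (hg : g.natDegree ≤ m)
    (hab : a < b) :
    SignType.sign (resultant g ((X - C a) * (X - C b)) m 2) =
      -(SignType.sign ((derivative (g * ((X - C a) * (X - C b)))).eval a) *
        SignType.sign ((derivative (g * ((X - C a) * (X - C b)))).eval b)) := by
  have ha : (derivative (g * ((X - C a) * (X - C b)))).eval a = g.eval a * (a - b) := by
    simp [derivative_mul]
  have hb : (derivative (g * ((X - C a) * (X - C b)))).eval b = g.eval b * (b - a) := by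
    simp [derivative_mul]
  rw [resultant_quadratic_right hg, ha, hb, sign_mul, sign_mul, sign_mul,
    sign_neg (sub_neg.2 hab), sign_pos (sub_pos.2 hab)]
  simp

theorem sum_sign_resultant_quadratic {f : ℝ[X]} (hsep : f.Separable) (hmonic : f.Monic) {m : ℕ}
    (hdeg : f.natDegree = m + 2) :
    ∑ q ∈ quadraticDivisors f, (SignType.sign (resultant (f /ₘ q) q m 2) : ℤ) =
      ((m + 2) / 2 : ℕ) := by
  let ε : ℝ → ℤ := fun x => SignType.sign (f.derivative.eval x)
  have hcofactor {q : ℝ[X]} (hq : q.Monic) (hq2 : q.natDegree = 2) : (f /ₘ q).natDegree ≤ m := by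
    rw [natDegree_divByMonic _ hq, hdeg, hq2, Nat.add_sub_cancel]
  have hupper : ∀ z ∈ upperRoots f,
      (SignType.sign (resultant (f /ₘ conjQuadratic z) (conjQuadratic z) m 2) : ℤ) = 1 := by
    intro z hz
    obtain ⟨hroot, him⟩ := (mem_upperRoots hsep.ne_zero).1 hz
    rw [sign_resultant_conjQuadratic
      (hcofactor (monic_conjQuadratic z) (natDegree_conjQuadratic z))
      (isCoprime_divByMonic_of_separable hsep (monic_conjQuadratic z)
        (conjQuadratic_dvd him.ne' hroot)) him, SignType.coe_one]
  have hreal : ∀ p ∈ realRootPairs f, (SignType.sign (resultant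
      (f /ₘ ((X - C p.1) * (X - C p.2))) ((X - C p.1) * (X - C p.2)) m 2) : ℤ) =
      -(ε p.1 * ε p.2) := by
    intro p hp
    classical
    obtain ⟨hq, hq2, hqf⟩ := (mem_quadraticDivisors hsep _).1
      (Finset.mem_union_right _ (Finset.mem_image_of_mem _ hp))
    rw [sign_resultant_X_sub_C_mul_X_sub_C (hcofactor hq hq2)
      ((mem_realRootPairs hsep.ne_zero).1 hp).2, divByMonic_mul_eq_of_dvd hq hqf]
    push_cast
    rfl
  have hε : ∀ x ∈ f.roots.toFinset, ε x ^ 2 = 1 := by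
    intro x hx
    have hroot : f.eval x = 0 := by simpa [hsep.ne_zero] using hx
    have hne : f.derivative.eval x ≠ 0 := hsep.eval₂_derivative_ne_zero (RingHom.id ℝ) hroot
    rcases hne.lt_or_gt with h | h
    · simp [ε, sign_neg h]
    · simp [ε, sign_pos h]
  have hpairs := two_mul_sum_lt_mul f.roots.toFinset ε
  rw [sum_sign_eval_derivative hmonic (nodup_roots hsep), Finset.sum_congr rfl hε] at hpairs
  rw [sum_quadraticDivisors hsep.ne_zero, Finset.sum_congr rfl hupper, Finset.sum_congr rfl hreal,
    Finset.sum_neg_distrib, realRootPairs]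
  have hcount := natDegree_eq_card_roots_add_two_mul_card_upperRoots hsep
  have hparity := Nat.mod_two_eq_zero_or_one f.roots.toFinset.card
  simp only [Finset.sum_const, nsmul_one] at hpairs ⊢
  rcases hparity with h | h <;> simp only [h] at hpairs <;> lia

theorem card_quadraticDivisors_le {f : ℝ[X]} (hf : f ≠ 0) :
    (quadraticDivisors f).card ≤ f.natDegree + f.natDegree * f.natDegree := by
  have hreal : f.roots.toFinset.card ≤ f.natDegree :=
    (Multiset.toFinset_card_le _).trans (card_roots' f)
  have hcomplex : (f.aroots ℂ).toFinset.card ≤ f.natDegree :=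
    (Multiset.toFinset_card_le _).trans ((card_roots' _).trans_eq (natDegree_map _))
  rw [Finset.card_eq_sum_ones, sum_quadraticDivisors hf, ← Finset.card_eq_sum_ones,
    ← Finset.card_eq_sum_ones]
  refine add_le_add ((Finset.card_filter_le _ _).trans hcomplex)
    ((Finset.card_filter_le _ _).trans ?_)
  rw [Finset.card_product]
  exact Nat.mul_le_mul hreal hreal

theorem ae_hasDegreeAt_mulCoeffs_two (m : ℕ) : ∀ᵐ y : Fin (m + 2) → ℝ,
    HasDegreeAt (mulCoeffs m 2) (fun x => (mulCoeffsDeriv m 2 x).restrictScalars ℝ)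
      ((m + 2) / 2 : ℕ) (m + 2 + (m + 2) * (m + 2)) y := by
  filter_upwards [ae_separable_monicOfCoeffs (volume : Measure (Fin (m + 2) → ℝ))] with y hy
  refine hasDegreeAt_mulCoeffs (mem_quadraticDivisors hy) ?_ ?_
  · simpa [natDegree_monicOfCoeffs] using card_quadraticDivisors_le hy.ne_zero
  · simpa using sum_sign_resultant_quadratic hy (monic_monicOfCoeffs y) (natDegree_monicOfCoeffs y)

end QuadraticFactors

theorem integrable_cpow_mul_of_one_add_norm_le {E : Type*} [NormedAddCommGroup E]
    [NormedSpace ℝ E] [FiniteDimensional ℝ E] [MeasurableSpace E] [BorelSpace E] (μ : Measure E)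
    [μ.IsAddHaarMeasure] {M : E → ℝ} (hM : Measurable M) {c : ℝ} (hc : 0 < c)
    (hcM : ∀ x, 1 + ‖x‖ ≤ c * M x) {w : ℂ} {F : E → ℂ} (hF : Measurable F) {B : ℝ} {k : ℕ}
    (hFB : ∀ x, ‖F x‖ ≤ B * M x ^ k) (hw : (Module.finrank ℝ E : ℝ) < w.re - k) :
    Integrable (fun x => (M x : ℂ) ^ (-w) * F x) μ := by
  have hMpos (x : E) : 0 < M x :=
    pos_of_mul_pos_right ((by positivity : 0 < 1 + ‖x‖).trans_le (hcM x)) hc.le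
  have hB : 0 ≤ B := nonneg_of_mul_nonneg_left ((norm_nonneg _).trans (hFB 0)) (pow_pos (hMpos 0) k)
  set r := w.re - k with hr
  have hrpos : 0 ≤ r := (by positivity : (0 : ℝ) ≤ _).trans hw.le
  refine ((integrable_one_add_norm (μ := μ) hw).const_mul (B * c ^ r)).mono'
    (((Complex.measurable_ofReal.comp hM).pow_const _).mul hF).aestronglyMeasurable
    (.of_forall fun x => ?_)
  have hle : (1 + ‖x‖) / c ≤ M x := by
    rw [div_le_iff₀' hc]
    exact hcM x
  rw [norm_mul, Complex.norm_cpow_eq_rpow_re_of_pos (hMpos x), Complex.neg_re]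
  calc M x ^ (-w.re) * ‖F x‖ ≤ M x ^ (-w.re) * (B * M x ^ k) :=
        mul_le_mul_of_nonneg_left (hFB x) (Real.rpow_nonneg (hMpos x).le _)
    _ = B * M x ^ (-r) := by
        rw [hr, neg_sub, sub_eq_neg_add, Real.rpow_add (hMpos x), Real.rpow_natCast]
        ring
    _ ≤ B * ((1 + ‖x‖) / c) ^ (-r) := mul_le_mul_of_nonneg_left
        (Real.rpow_le_rpow_of_nonpos (by positivity) hle (neg_nonpos.2 hrpos)) hB
    _ = B * c ^ r * (1 + ‖x‖) ^ (-r) := by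
        rw [Real.div_rpow (by positivity) hc.le, Real.rpow_neg hc.le, div_inv_eq_mul]
        ring

section MahlerIntegrals

open Polynomial

variable {K : Type*} [RCLike K] [NormedAlgebra K ℂ] {n : ℕ}

theorem one_le_mahlerMeasure_of_monic {f : ℂ[X]} (hf : f.Monic) : 1 ≤ f.mahlerMeasure := by
  simpa [hf.leadingCoeff] using leadingCoeff_le_mahlerMeasure f

theorem eval_monicOfCoeffs {R : Type*} [CommRing R] (a : Fin n → R) (t : R) :
    (monicOfCoeffs a).eval t = t ^ n + ∑ i, a i * t ^ (i : ℕ) := by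
  simp [monicOfCoeffs, polyOfCoeffs, Fintype.linearCombination_apply, eval_finsetSum]

theorem continuous_eval_map_monicOfCoeffs (t : ℂ) :
    Continuous fun a : Fin n → K => ((monicOfCoeffs a).map (algebraMap K ℂ)).eval t := by
  simp only [map_monicOfCoeffs, eval_monicOfCoeffs]
  have := continuous_algebraMap K ℂ
  fun_prop

theorem measurable_mahlerMeasure_monicOfCoeffs :
    Measurable fun a : Fin n → ℂ => (monicOfCoeffs a).mahlerMeasure := by
  have hdef (a : Fin n → ℂ) : (monicOfCoeffs a).mahlerMeasure =
      Real.exp ((2 * Real.pi)⁻¹ * ∫ x in Set.Ioc 0 (2 * Real.pi),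
        Real.log ‖(monicOfCoeffs a).eval (circleMap 0 1 x)‖) := by
    rw [mahlerMeasure_def_of_ne_zero (monic_monicOfCoeffs a).ne_zero,
      intervalIntegral.integral_of_le (by positivity)]
  have heval : Continuous fun p : (Fin n → ℂ) × ℝ =>
      (monicOfCoeffs p.1).eval (circleMap 0 1 p.2) := by
    simp only [eval_monicOfCoeffs]
    have := continuous_circleMap 0 1
    fun_prop
  have hlog : Measurable (Function.uncurry fun (a : Fin n → ℂ) (x : ℝ) =>
      Real.log ‖(monicOfCoeffs a).eval (circleMap 0 1 x)‖) :=
    Real.measurable_log.comp heval.norm.measurable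
  simp only [hdef]
  exact Real.measurable_exp.comp
    ((hlog.stronglyMeasurable.integral_prod_right (ν := volume.restrict _)).measurable.const_mul _)

theorem one_add_norm_le_mahlerMeasure (a : Fin n → ℂ) :
    1 + ‖a‖ ≤ (1 + 2 ^ n) * (monicOfCoeffs a).mahlerMeasure := by
  have hone := one_le_mahlerMeasure_of_monic (monic_monicOfCoeffs a)
  have hnorm : ‖a‖ ≤ 2 ^ n * (monicOfCoeffs a).mahlerMeasure := by
    rw [pi_norm_le_iff_of_nonneg (by positivity)]
    intro i
    have hcoeff := norm_coeff_le_choose_mul_mahlerMeasure (i : ℕ) (monicOfCoeffs a)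
    rw [natDegree_monicOfCoeffs, coeff_monicOfCoeffs_fin] at hcoeff
    refine hcoeff.trans (mul_le_mul_of_nonneg_right ?_ (zero_le_one.trans hone))
    exact_mod_cast Nat.choose_le_two_pow n i
  linarith

theorem norm_eval_le_mahlerMeasure (f : ℂ[X]) (t : ℂ) :
    ‖f.eval t‖ ≤ (1 + ‖t‖) ^ f.natDegree * f.mahlerMeasure := by
  rw [eval_eq_sum_range]
  calc _ ≤ ∑ i ∈ Finset.range (f.natDegree + 1), ‖f.coeff i‖ * ‖t‖ ^ i :=
        (norm_sum_le _ _).trans_eq (Finset.sum_congr rfl fun i _ => by rw [norm_mul, norm_pow])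
    _ ≤ ∑ i ∈ Finset.range (f.natDegree + 1),
          (f.natDegree.choose i * f.mahlerMeasure) * ‖t‖ ^ i := by
        gcongr with i
        exact norm_coeff_le_choose_mul_mahlerMeasure i f
    _ = (1 + ‖t‖) ^ f.natDegree * f.mahlerMeasure := by
        rw [add_comm (1 : ℝ), add_pow, Finset.sum_mul]
        exact Finset.sum_congr rfl fun i _ => by ring

theorem norm_prod_eval_le_mahlerMeasure {m : ℕ} (f : ℂ[X]) (t : Fin m → ℂ) :
    ‖∏ i, f.eval (t i)‖ ≤ (∏ i, (1 + ‖t i‖) ^ f.natDegree) * f.mahlerMeasure ^ m := by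
  rw [norm_prod]
  calc _ ≤ ∏ i, ((1 + ‖t i‖) ^ f.natDegree * f.mahlerMeasure) := by
        gcongr with i
        exact norm_eval_le_mahlerMeasure f (t i)
    _ = _ := by simp [Finset.prod_mul_distrib]

theorem norm_algebraMap_comp (a : Fin n → K) : ‖fun i => algebraMap K ℂ (a i)‖ = ‖a‖ := by
  simp [Pi.norm_def]

theorem integrable_mahlerMeasure_cpow_mul [MeasurableSpace K] [BorelSpace K]
    (μ : Measure (Fin n → K)) [μ.IsAddHaarMeasure] {w : ℂ} {F : (Fin n → K) → ℂ}
    (hF : Continuous F) {B : ℝ} {k : ℕ}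
    (hFB : ∀ a, ‖F a‖ ≤ B * ((monicOfCoeffs a).map (algebraMap K ℂ)).mahlerMeasure ^ k)
    (hw : (n * Module.finrank ℝ K : ℝ) < w.re - k) :
    Integrable (fun a =>
      (((monicOfCoeffs a).map (algebraMap K ℂ)).mahlerMeasure : ℂ) ^ (-w) * F a) μ := by
  have hmeas : Measurable fun a : Fin n → K =>
      ((monicOfCoeffs a).map (algebraMap K ℂ)).mahlerMeasure := by
    simp only [map_monicOfCoeffs]
    have := (continuous_algebraMap K ℂ).measurable
    exact measurable_mahlerMeasure_monicOfCoeffs.comp (by fun_prop)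
  refine integrable_cpow_mul_of_one_add_norm_le μ hmeas (by positivity : (0 : ℝ) < 1 + 2 ^ n)
    (fun a => ?_) hF.measurable hFB (by simpa [Module.finrank_pi_fintype] using hw)
  rw [map_monicOfCoeffs, ← norm_algebraMap_comp a]
  exact one_add_norm_le_mahlerMeasure _

theorem mahlerMeasure_mul_cpow (p q : ℂ[X]) (w : ℂ) :
    (((p * q).mahlerMeasure : ℝ) : ℂ) ^ w =
      (p.mahlerMeasure : ℂ) ^ w * (q.mahlerMeasure : ℂ) ^ w := by
  rw [mahlerMeasure_mul, Complex.ofReal_mul,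
    Complex.mul_cpow_ofReal_nonneg (mahlerMeasure_nonneg p) (mahlerMeasure_nonneg q)]

end MahlerIntegrals

section Averages

open Polynomial

variable {n m : ℕ}

/-- The weight `μ(f)⁻ˢ ∏ f(tᵢ)` of a real polynomial, which is averaged over monic polynomials of a
given degree. The points `tᵢ` are the roots of the factors that have been split off. -/
noncomputable def realWeight (s : ℂ) (t : Fin m → ℂ) (f : ℝ[X]) : ℂ :=
  ((f.map (algebraMap ℝ ℂ)).mahlerMeasure : ℂ) ^ (-s) *
    ∏ i, (f.map (algebraMap ℝ ℂ)).eval (t i)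

/-- The weight `μ(f)⁻²ˢ ∏ |f(tᵢ)|²` of a complex polynomial, which is averaged over monic
polynomials of a given degree. The points `tᵢ` are the roots that have been split off. -/
noncomputable def complexWeight (s : ℂ) (t : Fin m → ℂ) (f : ℂ[X]) : ℂ :=
  (f.mahlerMeasure : ℂ) ^ (-(2 * s)) * ∏ i, (‖f.eval (t i)‖ ^ 2 : ℂ)

/-- The integral of `realWeight s t` over the real monic polynomials of degree `n`. -/
noncomputable def realAverage (s : ℂ) (n : ℕ) (t : Fin m → ℂ) : ℂ :=
  ∫ a : Fin n → ℝ, realWeight s t (monicOfCoeffs a)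

/-- The integral of `complexWeight s t` over the complex monic polynomials of degree `n`. -/
noncomputable def complexAverage (s : ℂ) (n : ℕ) (t : Fin m → ℂ) : ℂ :=
  ∫ a : Fin n → ℂ, complexWeight s t (monicOfCoeffs a)

theorem realWeight_mul (s : ℂ) (t : Fin m → ℂ) (p q : ℝ[X]) :
    realWeight s t (p * q) = realWeight s t p * realWeight s t q := by
  simp only [realWeight, Polynomial.map_mul, mahlerMeasure_mul_cpow, eval_mul,
    Finset.prod_mul_distrib]
  ring

theorem complexWeight_mul (s : ℂ) (t : Fin m → ℂ) (p q : ℂ[X]) :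
    complexWeight s t (p * q) = complexWeight s t p * complexWeight s t q := by
  simp only [complexWeight, mahlerMeasure_mul_cpow, eval_mul, norm_mul, Complex.ofReal_mul, mul_pow,
    Finset.prod_mul_distrib]
  ring

theorem realWeight_vecCons (s : ℂ) (z : ℂ) (t : Fin m → ℂ) (f : ℝ[X]) :
    realWeight s (Matrix.vecCons z t) f =
      (f.map (algebraMap ℝ ℂ)).eval z * realWeight s t f := by
  simp only [realWeight, Fin.prod_univ_succ, Matrix.cons_val_zero, Matrix.cons_val_succ]
  ring

theorem complexWeight_vecCons (s : ℂ) (z : ℂ) (t : Fin m → ℂ) (f : ℂ[X]) :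
    complexWeight s (Matrix.vecCons z t) f = (‖f.eval z‖ ^ 2 : ℂ) * complexWeight s t f := by
  simp only [complexWeight, Fin.prod_univ_succ, Matrix.cons_val_zero, Matrix.cons_val_succ]
  ring

theorem integrable_realWeight {s : ℂ} (t : Fin m → ℂ) (hs : ((n + m : ℕ) : ℝ) < s.re) :
    Integrable fun a : Fin n → ℝ => realWeight s t (monicOfCoeffs a) := by
  refine integrable_mahlerMeasure_cpow_mul (volume : Measure (Fin n → ℝ))
    (B := ∏ i, (1 + ‖t i‖) ^ n) (k := m)
    (continuous_finsetProd _ fun i _ => continuous_eval_map_monicOfCoeffs (t i)) (fun a => ?_) ?_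
  · simpa [(monic_monicOfCoeffs a).natDegree_map, natDegree_monicOfCoeffs] using
      norm_prod_eval_le_mahlerMeasure ((monicOfCoeffs a).map (algebraMap ℝ ℂ)) t
  · push_cast at hs
    rw [Module.finrank_self, Nat.cast_one]
    linarith

theorem integrable_complexWeight {s : ℂ} (t : Fin m → ℂ) (hs : ((n + m : ℕ) : ℝ) < s.re) :
    Integrable fun a : Fin n → ℂ => complexWeight s t (monicOfCoeffs a) := by
  have hcont : Continuous fun a : Fin n → ℂ =>
      ∏ i, (‖((monicOfCoeffs a).map (algebraMap ℂ ℂ)).eval (t i)‖ ^ 2 : ℂ) :=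
    continuous_finsetProd _ fun i _ => (Complex.continuous_ofReal.comp
      (continuous_eval_map_monicOfCoeffs (K := ℂ) (n := n) (t i)).norm).pow 2
  have hbound (a : Fin n → ℂ) : ‖∏ i, (‖(monicOfCoeffs a).eval (t i)‖ ^ 2 : ℂ)‖ ≤
      (∏ i, (1 + ‖t i‖) ^ n) ^ 2 * (monicOfCoeffs a).mahlerMeasure ^ (2 * m) := by
    have hprod := norm_prod_eval_le_mahlerMeasure (monicOfCoeffs a) t
    rw [natDegree_monicOfCoeffs, norm_prod] at hprod
    rw [mul_comm 2 m, pow_mul, ← mul_pow]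
    simpa [norm_prod, Finset.prod_pow] using
      pow_le_pow_left₀ (Finset.prod_nonneg fun i _ => norm_nonneg _) hprod 2
  have hre : (n * Module.finrank ℝ ℂ : ℝ) < (2 * s).re - (2 * m : ℕ) := by
    push_cast at hs ⊢
    simp only [Complex.finrank_real_complex, Complex.mul_re, Complex.re_ofNat, Complex.im_ofNat]
    push_cast
    linarith
  simpa [complexWeight] using integrable_mahlerMeasure_cpow_mul
    (volume : Measure (Fin n → ℂ)) hcont (by simpa using hbound) hre

end Averages

section PeelingFactors

open Polynomial

/-- A vector of length `m + n` as a pair of vectors of lengths `m` and `n`. -/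
def splitVec (K : Type*) [MeasurableSpace K] (m n : ℕ) :
    (Fin (m + n) → K) ≃ᵐ (Fin m → K) × (Fin n → K) :=
  (MeasurableEquiv.piCongrLeft (fun _ => K) finSumFinEquiv).symm.trans
    (MeasurableEquiv.sumPiEquivProdPi fun _ => K)

theorem volume_preserving_splitVec (K : Type*) [MeasureSpace K]
    [SigmaFinite (volume : Measure K)] (m n : ℕ) :
    MeasurePreserving (splitVec K m n) volume volume :=
  (volume_measurePreserving_sumPiEquivProdPi _).comp
    ((volume_measurePreserving_piCongrLeft (fun _ => K) finSumFinEquiv).symm _)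

theorem integral_integral_norm_resultant_smul {K : Type*} [RCLike K] [MeasureSpace K]
    [BorelSpace K] [(volume : Measure K).IsAddHaarMeasure] {m n : ℕ} {d : ℤ} {C : ℕ}
    (hdeg : ∀ᵐ y : Fin (m + n) → K, HasDegreeAt (mulCoeffs m n)
      (fun x => (mulCoeffsDeriv m n x).restrictScalars ℝ) d C y)
    {E : Type*} [NormedAddCommGroup E] [NormedSpace ℝ E] {g : K[X] → E}
    (hg : Integrable fun a : Fin (m + n) → K => g (monicOfCoeffs a)) :
    ∫ b : Fin n → K, ∫ a : Fin m → K, Algebra.norm ℝ (resultant (monicOfCoeffs a)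
      (monicOfCoeffs b) m n) • g (monicOfCoeffs a * monicOfCoeffs b) =
    d • ∫ a : Fin (m + n) → K, g (monicOfCoeffs a) := by
  obtain ⟨hint, heq⟩ :=
    integral_norm_resultant_smul_comp_mulCoeffs (volume : Measure (Fin (m + n) → K)) hdeg hg
  let G : (Fin m → K) × (Fin n → K) → E := fun p => Algebra.norm ℝ (resultant (monicOfCoeffs p.1)
    (monicOfCoeffs p.2) m n) • g (monicOfCoeffs p.1 * monicOfCoeffs p.2)
  have hsplit (x : Fin (m + n) → K) :
      Algebra.norm ℝ (resultant (leftFactor x) (rightFactor x) m n) •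
        g (monicOfCoeffs (mulCoeffs m n x)) = G (splitVec K m n x) := by
    rw [monicOfCoeffs_mulCoeffs]
    rfl
  simp only [hsplit] at hint heq
  have hpres := volume_preserving_splitVec K m n
  have hintG := (hpres.integrable_comp_emb (g := G) (splitVec K m n).measurableEmbedding).1 hint
  rw [hpres.integral_comp' (g := G)] at heq
  rw [Measure.volume_eq_prod] at hintG heq
  rw [← heq, integral_prod_symm G hintG]

theorem realAverage_add_two {s : ℂ} {n m : ℕ} (t : Fin m → ℂ)
    (hs : ((n + 2 + m : ℕ) : ℝ) < s.re) {α β : (Fin 2 → ℝ) → ℂ}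
    (hαβ : ∀ q, (monicOfCoeffs q).map (algebraMap ℝ ℂ) = (X - C (α q)) * (X - C (β q))) :
    ((n + 2) / 2 : ℕ) * realAverage s (n + 2) t =
      ∫ q : Fin 2 → ℝ, realWeight s t (monicOfCoeffs q) *
        realAverage s n (Matrix.vecCons (α q) (Matrix.vecCons (β q) t)) := by
  have hpeel := integral_integral_norm_resultant_smul (ae_hasDegreeAt_mulCoeffs_two n)
    (integrable_realWeight (n := n + 2) t hs)
  rw [natCast_zsmul, nsmul_eq_mul] at hpeel
  rw [realAverage, ← hpeel]
  congr 1 with q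
  simp only [realAverage, ← integral_const_mul]
  congr 1 with a
  have hres : ((resultant (monicOfCoeffs a) (monicOfCoeffs q) n 2 : ℝ) : ℂ) =
      ((monicOfCoeffs a).map (algebraMap ℝ ℂ)).eval (α q) *
        ((monicOfCoeffs a).map (algebraMap ℝ ℂ)).eval (β q) := by
    rw [← Complex.coe_algebraMap, ← resultant_map_map, hαβ, resultant_quadratic_right]
    rw [(monic_monicOfCoeffs a).natDegree_map, natDegree_monicOfCoeffs]
  rw [Algebra.norm_self, MonoidHom.id_apply, Complex.real_smul, hres, realWeight_mul,
    realWeight_vecCons, realWeight_vecCons]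
  ring

theorem monicOfCoeffs_one {R : Type*} [CommRing R] (b : Fin 1 → R) :
    monicOfCoeffs b = X - C (-b 0) := by
  simp [monicOfCoeffs, polyOfCoeffs, Fintype.linearCombination_apply, smul_eq_C_mul]

theorem integral_monicOfCoeffs_one {K : Type*} [RCLike K] [MeasureSpace K] [BorelSpace K]
    [(volume : Measure K).IsAddHaarMeasure] {E : Type*} [NormedAddCommGroup E] [NormedSpace ℝ E]
    (g : K[X] → E) : ∫ b : Fin 1 → K, g (monicOfCoeffs b) = ∫ z : K, g (X - C z) := by
  rw [← integral_neg_eq_self (fun z : K => g (X - C z)),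
    ← (volume_preserving_funUnique (Fin 1) K).integral_comp'
      (g := fun z : K => g (X - C (-z)))]
  simp only [monicOfCoeffs_one]
  rfl

theorem complexWeight_X_sub_C (s : ℂ) {m : ℕ} (t : Fin m → ℂ) (z : ℂ) :
    complexWeight s t (X - C z) =
      ((max 1 ‖z‖ : ℝ) : ℂ) ^ (-(2 * s)) * ∏ i, (‖t i - z‖ ^ 2 : ℂ) := by
  simp [complexWeight, mahlerMeasure_X_sub_C]

theorem complexAverage_succ {s : ℂ} {n m : ℕ} (t : Fin m → ℂ)
    (hs : ((n + 1 + m : ℕ) : ℝ) < s.re) :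
    ((n + 1 : ℕ) : ℂ) * complexAverage s (n + 1) t =
      ∫ z : ℂ, complexWeight s t (X - C z) * complexAverage s n (Matrix.vecCons z t) := by
  have hpeel := integral_integral_norm_resultant_smul (ae_hasDegreeAt_mulCoeffs_one n)
    (integrable_complexWeight (n := n + 1) t hs)
  rw [natCast_zsmul, nsmul_eq_mul, integral_monicOfCoeffs_one fun q => ∫ a : Fin n → ℂ,
    Algebra.norm ℝ (resultant (monicOfCoeffs a) q n 1) •
      complexWeight s t (monicOfCoeffs a * q)] at hpeel
  rw [complexAverage, ← hpeel]
  congr 1 with z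
  simp only [complexAverage, ← integral_const_mul]
  congr 1 with a
  rw [Algebra.norm_complex_apply, Complex.normSq_eq_norm_sq,
    resultant_X_sub_C_right _ _ _ (natDegree_monicOfCoeffs a).le, norm_mul, norm_pow, norm_neg,
    norm_one, one_pow, one_mul, Complex.real_smul, complexWeight_mul, complexWeight_vecCons,
    Complex.ofReal_pow]
  ring

end PeelingFactors

section LayerCake

open Set

theorem integral_Ici_cpow_mul_pow {s : ℂ} {κ : ℕ} (hs : (κ : ℝ) < s.re) :
    ∫ T : ℝ in Ici 1, (T : ℂ) ^ (-s - 1) * (T : ℂ) ^ κ = 1 / (s - κ) := by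
  have hcombine : ∫ T : ℝ in Ioi 1, (T : ℂ) ^ (-s - 1) * (T : ℂ) ^ κ =
      ∫ T : ℝ in Ioi 1, (T : ℂ) ^ (-s - 1 + κ) := by
    refine setIntegral_congr_fun measurableSet_Ioi fun T hT => ?_
    have hT0 : (T : ℂ) ≠ 0 := Complex.ofReal_ne_zero.2 (one_pos.trans hT).ne'
    rw [Complex.cpow_add _ _ hT0, Complex.cpow_natCast]
  rw [integral_Ici_eq_integral_Ioi, hcombine,
    integral_Ioi_cpow_of_lt (by simp; linarith) one_pos, Complex.ofReal_one, Complex.one_cpow,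
    show -s - 1 + (κ : ℂ) + 1 = -(s - κ) by ring, neg_div_neg_eq]

theorem integral_Ici_cpow {s : ℂ} {M : ℝ} (hM : 0 < M) (hs : 0 < s.re) :
    ∫ T : ℝ in Ici M, (T : ℂ) ^ (-s - 1) = (M : ℂ) ^ (-s) / s := by
  rw [integral_Ici_eq_integral_Ioi, integral_Ioi_cpow_of_lt (by simp; linarith) hM,
    show -s - 1 + 1 = -s by ring, neg_div_neg_eq]

theorem integral_Ici_norm_cpow {s : ℂ} {M : ℝ} (hM : 0 < M) (hs : 0 < s.re) :
    ∫ T : ℝ in Ici M, ‖(T : ℂ) ^ (-s - 1)‖ = ‖(M : ℂ) ^ (-s)‖ / s.re := by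
  have hnorm : ∫ T : ℝ in Ici M, ‖(T : ℂ) ^ (-s - 1)‖ = ∫ T : ℝ in Ici M, T ^ (-s.re - 1) := by
    refine setIntegral_congr_fun measurableSet_Ici fun T hT => ?_
    rw [Complex.norm_cpow_eq_rpow_re_of_pos (hM.trans_le hT)]
    simp
  rw [hnorm, integral_Ici_eq_integral_Ioi, integral_Ioi_rpow_of_lt (by linarith) hM,
    show -s.re - 1 + 1 = -s.re by ring, neg_div_neg_eq, Complex.norm_cpow_eq_rpow_re_of_pos hM,
    Complex.neg_re]

variable {X : Type*} {M : X → ℝ} {S : X → ℂ} {s : ℂ}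

/-- The function `(x, T) ↦ S(x) T⁻ˢ⁻¹` on the region `M(x) ≤ T`. It has integral `M(x)⁻ˢ S(x) / s`
along `T`, while its integral along `x` only involves the sublevel sets of `M`. -/
noncomputable def layer (M : X → ℝ) (S : X → ℂ) (s : ℂ) : X × ℝ → ℂ :=
  {p | M p.1 ≤ p.2}.indicator fun p => S p.1 * (p.2 : ℂ) ^ (-s - 1)

theorem layer_left (x : X) :
    (fun T => layer M S s (x, T)) = (Ici (M x)).indicator fun T => S x * (T : ℂ) ^ (-s - 1) :=
  rfl

theorem layer_right (T : ℝ) :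
    (fun x => layer M S s (x, T)) = {x | M x ≤ T}.indicator fun x => S x * (T : ℂ) ^ (-s - 1) :=
  rfl

theorem restrict_Ici_restrict_Ici {a b : ℝ} (hab : a ≤ b) :
    (volume.restrict (Ici a)).restrict (Ici b) = volume.restrict (Ici b) := by
  rw [Measure.restrict_restrict measurableSet_Ici, Ici_inter_Ici, sup_eq_left.2 hab]

variable [MeasurableSpace X] {μ : Measure X}

theorem integrable_layer [SFinite μ] (hM : Measurable M) (hM1 : ∀ x, 1 ≤ M x)
    (hS : Measurable S) (hs : 0 < s.re) (hint : Integrable (fun x => (M x : ℂ) ^ (-s) * S x) μ) :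
    Integrable (layer M S s) (μ.prod (volume.restrict (Ici 1))) := by
  have hmeas : Measurable (layer M S s) :=
    ((hS.comp measurable_fst).mul
      ((Complex.measurable_ofReal.comp measurable_snd).pow_const _)).indicator
        (measurableSet_le (hM.comp measurable_fst) measurable_snd)
  have hMpos (x : X) : 0 < M x := one_pos.trans_le (hM1 x)
  refine (integrable_prod_iff hmeas.aestronglyMeasurable).2 ⟨.of_forall fun x => ?_, ?_⟩
  · rw [layer_left, integrable_indicator_iff measurableSet_Ici, IntegrableOn,
      restrict_Ici_restrict_Ici (hM1 x)]
    refine Integrable.const_mul ?_ _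
    rw [← IntegrableOn, integrableOn_Ici_iff_integrableOn_Ioi]
    exact integrableOn_Ioi_cpow_of_lt (by simp; linarith) (hMpos x)
  · have hnorm (x : X) : ∫ T in Ici 1, ‖layer M S s (x, T)‖ =
        ‖(M x : ℂ) ^ (-s) * S x‖ / s.re := by
      have hind (T : ℝ) : ‖layer M S s (x, T)‖ =
          (Ici (M x)).indicator (fun T : ℝ => ‖S x‖ * ‖(T : ℂ) ^ (-s - 1)‖) T := by
        rw [congrFun (layer_left x) T, norm_indicator_eq_indicator_norm]
        simp only [norm_mul]
      simp only [hind]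
      rw [integral_indicator measurableSet_Ici, restrict_Ici_restrict_Ici (hM1 x),
        integral_const_mul, integral_Ici_norm_cpow (hMpos x) hs, norm_mul]
      ring
    simp only [hnorm]
    exact hint.norm.div_const _

theorem integral_cpow_mul_of_sublevel [SFinite μ] (hM : Measurable M) (hM1 : ∀ x, 1 ≤ M x)
    (hS : Measurable S) {A : ℂ} {κ : ℕ} (hs : (κ : ℝ) < s.re)
    (hint : Integrable (fun x => (M x : ℂ) ^ (-s) * S x) μ)
    (hsublevel : ∀ T : ℝ, 1 ≤ T → ∫ x in {x | M x ≤ T}, S x ∂μ = A * (T : ℂ) ^ κ) :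
    ∫ x, (M x : ℂ) ^ (-s) * S x ∂μ = A * (s / (s - κ)) := by
  have hs0 : 0 < s.re := (Nat.cast_nonneg _).trans_lt hs
  have hsne : s ≠ 0 := by
    rintro rfl
    simp at hs0
  have hleft (x : X) :
      (M x : ℂ) ^ (-s) * S x = s * ∫ T in Ici 1, layer M S s (x, T) := by
    rw [layer_left, integral_indicator measurableSet_Ici, restrict_Ici_restrict_Ici (hM1 x),
      integral_const_mul, integral_Ici_cpow (one_pos.trans_le (hM1 x)) hs0]
    field_simp
  have hright : ∀ T ∈ Ici (1 : ℝ), ∫ x, layer M S s (x, T) ∂μ =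
      A * ((T : ℂ) ^ (-s - 1) * (T : ℂ) ^ κ) := fun T hT => by
    rw [layer_right, integral_indicator (measurableSet_le hM measurable_const),
      integral_mul_const, hsublevel T hT]
    ring
  calc ∫ x, (M x : ℂ) ^ (-s) * S x ∂μ
      = s * ∫ x, (∫ T in Ici 1, layer M S s (x, T)) ∂μ := by
        simp only [hleft, integral_const_mul]
    _ = s * ∫ T in Ici (1 : ℝ), (∫ x, layer M S s (x, T) ∂μ) := by
        rw [integral_integral_swap (f := fun x T => layer M S s (x, T))
          (integrable_layer hM hM1 hS hs0 hint)]
    _ = s * ∫ T : ℝ in Ici 1, A * ((T : ℂ) ^ (-s - 1) * (T : ℂ) ^ κ) := by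
        rw [setIntegral_congr_fun measurableSet_Ici hright]
    _ = A * (s / (s - κ)) := by
        rw [integral_const_mul, integral_Ici_cpow_mul_pow hs]
        ring

end LayerCake

section OneVariableMoments

open Set

theorem integrable_max_norm_cpow_mul {E : Type*} [NormedAddCommGroup E] [NormedSpace ℝ E]
    [FiniteDimensional ℝ E] [MeasurableSpace E] [BorelSpace E] (μ : Measure E)
    [μ.IsAddHaarMeasure] {s : ℂ} {F : E → ℂ} (hF : Measurable F) {k : ℕ}
    (hFB : ∀ x, ‖F x‖ ≤ ‖x‖ ^ k) (hs : (Module.finrank ℝ E : ℝ) < s.re - k) :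
    Integrable (fun x => ((max 1 ‖x‖ : ℝ) : ℂ) ^ (-s) * F x) μ := by
  refine integrable_cpow_mul_of_one_add_norm_le μ (by fun_prop) two_pos (fun x => ?_) hF
    (B := 1) (k := k) (fun x => ?_) hs
  · linarith [le_max_left 1 ‖x‖, le_max_right 1 ‖x‖]
  · rw [one_mul]
    exact (hFB x).trans (by gcongr; exact le_max_right _ _)

theorem integrable_max_abs_cpow_mul_pow {s : ℂ} {p : ℕ} (hs : ((p + 1 : ℕ) : ℝ) < s.re) :
    Integrable fun x : ℝ => ((max 1 |x| : ℝ) : ℂ) ^ (-s) * (x : ℂ) ^ p := by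
  refine integrable_max_norm_cpow_mul volume (E := ℝ) (k := p) (by fun_prop) (fun x => ?_) ?_
  · simp
  · push_cast at hs
    rw [Module.finrank_self, Nat.cast_one]
    linarith

theorem integral_Icc_neg_pow {T : ℝ} (hT : 0 ≤ T) (p : ℕ) :
    ∫ x in Icc (-T) T, x ^ p = (1 + (-1) ^ p) * T ^ (p + 1) / (p + 1) := by
  rw [integral_Icc_eq_integral_Ioc, ← intervalIntegral.integral_of_le (by linarith), integral_pow,
    neg_pow, pow_succ (-1 : ℝ)]
  ring

theorem integral_max_abs_cpow_mul_pow {s : ℂ} {p : ℕ} (hs : ((p + 1 : ℕ) : ℝ) < s.re) :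
    ∫ x : ℝ, ((max 1 |x| : ℝ) : ℂ) ^ (-s) * (x : ℂ) ^ p =
      ((1 + (-1) ^ p) / (p + 1)) * (s / (s - (p + 1 : ℕ))) := by
  refine integral_cpow_mul_of_sublevel (by fun_prop) (fun x => le_max_left _ _) (by fun_prop) hs
    (integrable_max_abs_cpow_mul_pow hs) fun T hT => ?_
  have hIcc : {x : ℝ | max 1 |x| ≤ T} = Icc (-T) T := by
    ext x
    simp [hT, abs_le]
  simp only [hIcc, ← Complex.ofReal_pow]
  rw [integral_complex_ofReal, integral_Icc_neg_pow (by linarith)]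
  push_cast
  ring

theorem integrable_max_norm_cpow_mul_pow_mul_conj {s : ℂ} {p q : ℕ}
    (hs : ((p + q + 2 : ℕ) : ℝ) < s.re) :
    Integrable fun z : ℂ => ((max 1 ‖z‖ : ℝ) : ℂ) ^ (-s) * (z ^ p * starRingEnd ℂ z ^ q) := by
  refine integrable_max_norm_cpow_mul volume (k := p + q)
    (Continuous.measurable (by fun_prop)) (fun x => ?_) ?_
  · rw [norm_mul, norm_pow, norm_pow, Complex.norm_conj, ← pow_add]
  · push_cast at hs
    rw [Complex.finrank_real_complex]
    push_cast
    linarith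

theorem integral_comp_norm_mul_pow_mul_conj_pow {p q : ℕ} (hpq : p ≠ q) (φ : ℝ → ℂ) :
    ∫ z : ℂ, φ ‖z‖ * (z ^ p * starRingEnd ℂ z ^ q) = 0 := by
  -- the rotation by `π / (p - q)` changes the sign of the integrand
  let u : Circle := Circle.exp (Real.pi / (p - q))
  have hu : (u : ℂ) ^ p * starRingEnd ℂ (u : ℂ) ^ q = -1 := by
    have hne : (p : ℂ) - q ≠ 0 := sub_ne_zero.2 (Nat.cast_injective.ne hpq)
    rw [Circle.coe_exp, ← Complex.exp_conj, ← Complex.exp_nat_mul, ← Complex.exp_nat_mul,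
      ← Complex.exp_add, ← Complex.exp_pi_mul_I]
    congr 1
    rw [map_mul, Complex.conj_ofReal, Complex.conj_I]
    push_cast
    field_simp
    ring
  have hrot := (rotation u).measurePreserving.integral_comp'
    (f := (rotation u).toHomeomorph.toMeasurableEquiv)
    (g := fun z : ℂ => φ ‖z‖ * (z ^ p * starRingEnd ℂ z ^ q))
  have hneg (z : ℂ) : φ ‖rotation u z‖ * (rotation u z ^ p * starRingEnd ℂ (rotation u z) ^ q) =
      -(φ ‖z‖ * (z ^ p * starRingEnd ℂ z ^ q)) := by
    rw [LinearIsometryEquiv.norm_map, rotation_apply, map_mul]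
    linear_combination φ ‖z‖ * z ^ p * starRingEnd ℂ z ^ q * hu
  change ∫ z : ℂ, φ ‖rotation u z‖ * (rotation u z ^ p * starRingEnd ℂ (rotation u z) ^ q) = _
    at hrot
  simp only [hneg, integral_neg] at hrot
  exact CharZero.neg_eq_self_iff.1 hrot

theorem setIntegral_norm_le_norm_pow {T : ℝ} (hT : 0 ≤ T) (p : ℕ) :
    ∫ z in {z : ℂ | ‖z‖ ≤ T}, ‖z‖ ^ (2 * p) = Real.pi / (p + 1) * T ^ (2 * p + 2) := by
  have hind (z : ℂ) : {z : ℂ | ‖z‖ ≤ T}.indicator (fun z => ‖z‖ ^ (2 * p)) z =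
      (Iic T).indicator (fun r => r ^ (2 * p)) ‖z‖ := rfl
  rw [← integral_indicator (measurableSet_le (by fun_prop) measurable_const)]
  simp only [hind]
  rw [integral_fun_norm_addHaar volume fun r => (Iic T).indicator (fun r : ℝ => r ^ (2 * p)) r]
  have hradial : ∫ r in Ioi (0 : ℝ), r ^ 1 • (Iic T).indicator (fun r : ℝ => r ^ (2 * p)) r =
      T ^ (2 * p + 2) / (2 * p + 2) := by
    have hmul (r : ℝ) : r ^ 1 • (Iic T).indicator (fun r : ℝ => r ^ (2 * p)) r =
        (Iic T).indicator (fun r : ℝ => r ^ (2 * p + 1)) r := by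
      by_cases hr : r ∈ Iic T <;> simp [hr, pow_succ']
    simp only [hmul]
    rw [setIntegral_indicator measurableSet_Iic, Ioi_inter_Iic,
      ← intervalIntegral.integral_of_le hT, integral_pow, zero_pow (by lia), sub_zero]
    push_cast
    ring
  rw [Complex.finrank_real_complex, hradial, measureReal_def, Complex.volume_ball]
  simp
  field_simp

theorem integral_max_norm_cpow_mul_pow_mul_conj {s : ℂ} {p q : ℕ}
    (hp : ((p + 1 : ℕ) : ℝ) < s.re) :
    ∫ z : ℂ, ((max 1 ‖z‖ : ℝ) : ℂ) ^ (-(2 * s)) * (z ^ p * starRingEnd ℂ z ^ q) =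
      if p = q then (Real.pi : ℂ) / (p + 1) * (s / (s - (p + 1 : ℕ))) else 0 := by
  split_ifs with hpq
  swap
  · exact integral_comp_norm_mul_pow_mul_conj_pow hpq fun r => ((max 1 r : ℝ) : ℂ) ^ (-(2 * s))
  subst hpq
  have hre : ((p + p + 2 : ℕ) : ℝ) < (2 * s).re := by
    push_cast at hp ⊢
    simp only [Complex.mul_re, Complex.re_ofNat, Complex.im_ofNat]
    linarith
  have hnorm (z : ℂ) : z ^ p * starRingEnd ℂ z ^ p = ((‖z‖ ^ (2 * p) : ℝ) : ℂ) := by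
    rw [← mul_pow, Complex.mul_conj', pow_mul]
    push_cast
    rfl
  rw [integral_cpow_mul_of_sublevel (s := 2 * s) (A := (Real.pi : ℂ) / (p + 1)) (by fun_prop)
    (fun x => le_max_left _ _) (Continuous.measurable (by fun_prop)) hre
    (integrable_max_norm_cpow_mul_pow_mul_conj hre)]
  · rw [show 2 * s - ((p + p + 2 : ℕ) : ℂ) = 2 * (s - (p + 1 : ℕ)) by push_cast; ring,
      mul_div_mul_left _ _ two_ne_zero]
  · intro T hT
    have hball : {x : ℂ | max 1 ‖x‖ ≤ T} = {x : ℂ | ‖x‖ ≤ T} := by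
      ext x
      simp [hT]
    simp only [hball, hnorm]
    rw [integral_complex_ofReal, setIntegral_norm_le_norm_pow (by linarith)]
    push_cast
    ring

end OneVariableMoments

section SymmetricFunctions

variable {R : Type*} [CommRing R]

/-- The complete homogeneous symmetric function `(βᵏ - αᵏ) / (β - α)` of degree `k - 1` in the roots
`α`, `β` of `x² + u x + v`, defined by its recursion so that it makes sense for `α = β`. -/
def homSym (v u : R) : ℕ → R
  | 0 => 0
  | 1 => 1
  | k + 2 => -u * homSym v u (k + 1) - v * homSym v u k

/-- The power sum `αᵏ + βᵏ` of the roots `α`, `β` of `x² + u x + v`. It is, up to a factor, a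
primitive of `homSym` in the variable `u`. -/
def powSum (v u : R) : ℕ → R
  | 0 => 2
  | 1 => -u
  | k + 2 => -u * powSum v u (k + 1) - v * powSum v u k

/-- The symmetric function `(αᵖ βʳ - αʳ βᵖ) / (β - α)` of the roots `α`, `β` of `x² + u x + v`,
which appears when a `2 × 2` minor of a Vandermonde matrix is divided by the difference of the
nodes. -/
def altSym (v u : R) (p r : ℕ) : R :=
  if p ≤ r then v ^ p * homSym v u (r - p) else -(v ^ r * homSym v u (p - r))

theorem sub_mul_homSym (α β : R) (k : ℕ) :
    (β - α) * homSym (α * β) (-(α + β)) k = β ^ k - α ^ k := by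
  induction k using Nat.twoStepInduction with
  | zero => simp [homSym]
  | one => simp [homSym]
  | more k ihk ihsucc =>
    rw [homSym]
    linear_combination (α + β) * ihsucc - α * β * ihk

theorem powSum_mul_neg_add (α β : R) (k : ℕ) :
    powSum (α * β) (-(α + β)) k = α ^ k + β ^ k := by
  induction k using Nat.twoStepInduction with
  | zero => norm_num [powSum]
  | one => simp [powSum]
  | more k ihk ihsucc =>
    rw [powSum, ihk, ihsucc]
    ring

theorem powSum_succ_eq_homSym (v u : R) (k : ℕ) :
    powSum v u (k + 1) = -u * homSym v u (k + 1) - 2 * v * homSym v u k := by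
  induction k using Nat.twoStepInduction with
  | zero => simp [powSum, homSym]
  | one =>
    simp only [powSum, homSym]
    ring
  | more k ihk ihsucc =>
    rw [powSum, ihsucc, ihk]
    simp only [homSym]
    ring

theorem map_homSym {S : Type*} [CommRing S] (φ : R →+* S) (v u : R) (k : ℕ) :
    φ (homSym v u k) = homSym (φ v) (φ u) k := by
  induction k using Nat.twoStepInduction with
  | zero => simp [homSym]
  | one => simp [homSym]
  | more k ihk ihsucc => simp [homSym, ihk, ihsucc]

theorem altSym_self (v u : R) (p : ℕ) : altSym v u p p = 0 := by
  simp [altSym, homSym]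

theorem altSym_swap (v u : R) (p r : ℕ) : altSym v u r p = -altSym v u p r := by
  rcases lt_trichotomy p r with h | rfl | h
  · simp [altSym, h.le, h.not_ge]
  · simp [altSym_self]
  · simp [altSym, h.le, h.not_ge]

theorem sub_mul_altSym (α β : R) (p r : ℕ) :
    (β - α) * altSym (α * β) (-(α + β)) p r = α ^ p * β ^ r - α ^ r * β ^ p := by
  wlog h : p ≤ r generalizing p r
  · rw [altSym_swap]
    linear_combination -this r p (not_le.1 h).le
  obtain ⟨k, rfl⟩ := Nat.exists_eq_add_of_le h
  rw [altSym, if_pos h, Nat.add_sub_cancel_left]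
  linear_combination (α * β) ^ p * sub_mul_homSym α β k

theorem map_altSym {S : Type*} [CommRing S] (φ : R →+* S) (v u : R) (p r : ℕ) :
    φ (altSym v u p r) = altSym (φ v) (φ u) p r := by
  unfold altSym
  split_ifs <;> simp [map_homSym]

section Topology

variable [TopologicalSpace R] [IsTopologicalRing R] {E : Type*} [TopologicalSpace E] {v u : E → R}

theorem continuous_homSym (hv : Continuous v) (hu : Continuous u) (k : ℕ) :
    Continuous fun x => homSym (v x) (u x) k := by
  induction k using Nat.twoStepInduction with
  | zero => exact continuous_const
  | one => exact continuous_const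
  | more k ihk ihsucc =>
    simp only [homSym]
    fun_prop

theorem continuous_altSym (hv : Continuous v) (hu : Continuous u) (p r : ℕ) :
    Continuous fun x => altSym (v x) (u x) p r := by
  have hpr := continuous_homSym hv hu (r - p)
  have hrp := continuous_homSym hv hu (p - r)
  unfold altSym
  split_ifs <;> fun_prop

end Topology

theorem hasDerivAt_powSum (v u : ℝ) (k : ℕ) :
    HasDerivAt (fun u => powSum v u k) (-k * homSym v u k) u := by
  induction k using Nat.twoStepInduction with
  | zero => simpa [powSum, homSym] using hasDerivAt_const u (2 : ℝ)
  | one => simpa [powSum, homSym] using hasDerivAt_neg u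
  | more k ihk ihsucc =>
    refine (((hasDerivAt_id u).neg.mul ihsucc).sub (ihk.const_mul v)).congr_deriv ?_
    simp only [homSym, Pi.neg_apply, id]
    push_cast
    linear_combination -powSum_succ_eq_homSym v u k

theorem mul_integral_homSym (v c : ℝ) (k : ℕ) :
    k * ∫ u in (-c)..c, homSym v u k = powSum v (-c) k - powSum v c k := by
  have hftc := intervalIntegral.integral_eq_sub_of_hasDerivAt (a := -c) (b := c)
    (fun u _ => hasDerivAt_powSum v u k)
    ((continuous_const.mul
      (continuous_homSym continuous_const continuous_id k)).intervalIntegrable _ _)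
  rw [intervalIntegral.integral_const_mul] at hftc
  linarith

section Norm

variable {𝕜 : Type*} [NormedField 𝕜] {v u : 𝕜} {B : ℝ}

theorem norm_homSym_succ_le (hB : 1 ≤ B) (hv : ‖v‖ ≤ B) (hu : ‖u‖ ≤ 2 * B) (k : ℕ) :
    ‖homSym v u (k + 1)‖ ≤ (3 * B) ^ k := by
  induction k using Nat.twoStepInduction with
  | zero => simp [homSym]
  | one =>
    simp only [homSym, mul_one, mul_zero, sub_zero, norm_neg, pow_one]
    linarith
  | more k ihk ihsucc =>
    calc ‖homSym v u (k + 3)‖ ≤ ‖u‖ * ‖homSym v u (k + 2)‖ + ‖v‖ * ‖homSym v u (k + 1)‖ := by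
          rw [homSym, ← norm_mul, ← norm_mul, ← norm_neg (u * _), ← neg_mul]
          exact norm_sub_le _ _
      _ ≤ 2 * B * (3 * B) ^ (k + 1) + B * (3 * B) ^ k := by gcongr
      _ = (3 * B) ^ k * (6 * B * B + B) := by ring
      _ ≤ (3 * B) ^ k * (3 * B) ^ 2 := by
          gcongr
          nlinarith
      _ = (3 * B) ^ (k + 2) := (pow_add _ _ _).symm

theorem norm_altSym_le (hB : 1 ≤ B) (hv : ‖v‖ ≤ B) (hu : ‖u‖ ≤ 2 * B) (p k : ℕ) :
    ‖altSym v u p (p + k + 1)‖ ≤ 3 ^ k * B ^ (p + k) := by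
  rw [altSym, if_pos (by lia), show p + k + 1 - p = k + 1 by lia, norm_mul, norm_pow]
  calc ‖v‖ ^ p * ‖homSym v u (k + 1)‖ ≤ B ^ p * (3 * B) ^ k := by
        gcongr
        exact norm_homSym_succ_le hB hv hu k
    _ = 3 ^ k * B ^ (p + k) := by ring

end Norm

end SymmetricFunctions

section Trapezoid

open Set Polynomial

theorem monicOfCoeffs_eq_X_sub_C_mul_X_sub_C {R : Type*} [CommRing R] {q : Fin 2 → R} {α β : R}
    (h : monicOfCoeffs q = (X - C α) * (X - C β)) : q 0 = α * β ∧ q 1 = -(α + β) := by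
  have hexpand : (X - C α) * (X - C β) = X ^ 2 + C (-(α + β)) * X + C (α * β) := by
    simp only [C_neg, C_add, C_mul]
    ring
  rw [← coeff_monicOfCoeffs_fin q 0, ← coeff_monicOfCoeffs_fin q 1, h, hexpand]
  simp

theorem max_one_mul_max_one_le_iff {a b T : ℝ} (ha : 0 ≤ a) (hT : 1 ≤ T) :
    max 1 a * max 1 b ≤ T ↔ a ≤ T ∧ b ≤ T ∧ a * b ≤ T := by
  rw [max_mul_of_nonneg _ _ (by positivity), mul_max_of_nonneg _ _ ha, one_mul, mul_one]
  simp only [max_le_iff]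
  tauto

theorem mahlerMeasure_X_sub_C_mul_X_sub_C_le_iff {α β : ℂ} {T : ℝ} (hT : 1 ≤ T) :
    ((X - C α) * (X - C β)).mahlerMeasure ≤ T ↔ ‖α‖ ≤ T ∧ ‖β‖ ≤ T ∧ ‖α‖ * ‖β‖ ≤ T := by
  rw [mahlerMeasure_mul, mahlerMeasure_X_sub_C, mahlerMeasure_X_sub_C,
    max_one_mul_max_one_le_iff (norm_nonneg _) hT]

theorem le_of_mul_le_of_sub_mul_sub_nonneg {a b T : ℝ} (hT : 1 ≤ T) (hab : a * b ≤ T)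
    (h : 0 ≤ (T - a) * (T - b)) : a ≤ T := by
  by_contra! ha
  have hb : T ≤ b := by
    by_contra! hb
    exact (mul_neg_of_neg_of_pos (sub_neg.2 ha) (sub_pos.2 hb)).not_ge h
  nlinarith

theorem abs_le_and_abs_le_and_mul_le_iff {a b T : ℝ} (hT : 1 ≤ T) :
    (|a| ≤ T ∧ |b| ≤ T ∧ |a| * |b| ≤ T) ↔ |a * b| ≤ T ∧ |a + b| ≤ T + a * b / T := by
  have hT0 : 0 < T := by linarith
  have hfactor : |a + b| ≤ T + a * b / T ↔
      0 ≤ (T - a) * (T - b) ∧ 0 ≤ (-T - a) * (-T - b) := by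
    rw [show T + a * b / T = (T * T + a * b) / T by field_simp, le_div_iff₀ hT0, abs_eq_max_neg,
      max_mul_of_nonneg _ _ hT0.le, max_le_iff]
    constructor <;> rintro ⟨hpos, hneg⟩ <;> constructor <;> linarith
  rw [hfactor, ← abs_mul]
  simp only [abs_le]
  constructor
  · rintro ⟨ha, hb, hab⟩
    exact ⟨hab, mul_nonneg (by linarith) (by linarith),
      mul_nonneg_of_nonpos_of_nonpos (by linarith) (by linarith)⟩
  · rintro ⟨hab, hpos, hneg⟩
    have haT := le_of_mul_le_of_sub_mul_sub_nonneg hT hab.2 hpos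
    have hbT := le_of_mul_le_of_sub_mul_sub_nonneg (a := b) (b := a) hT (by linarith) (by linarith)
    have haT' := le_of_mul_le_of_sub_mul_sub_nonneg (a := -a) (b := -b) hT (by linarith)
      (by linarith)
    have hbT' := le_of_mul_le_of_sub_mul_sub_nonneg (a := -b) (b := -a) hT (by linarith)
      (by linarith)
    exact ⟨⟨by linarith, haT⟩, ⟨by linarith, hbT⟩, hab⟩

theorem norm_le_and_normSq_le_iff {z : ℂ} {T : ℝ} (hT : 1 ≤ T) :
    (‖z‖ ≤ T ∧ ‖z‖ ≤ T ∧ ‖z‖ * ‖z‖ ≤ T) ↔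
      |Complex.normSq z| ≤ T ∧ |2 * z.re| ≤ T + Complex.normSq z / T := by
  have hre : |2 * z.re| ≤ T + Complex.normSq z / T := by
    have hmul : T * (Complex.normSq z / T) = Complex.normSq z := by field_simp
    refine abs_le_of_sq_le_sq ?_ (by have := Complex.normSq_nonneg z; positivity)
    nlinarith [sq_nonneg (T - Complex.normSq z / T), Complex.re_sq_le_normSq z]
  rw [abs_of_nonneg (Complex.normSq_nonneg z), ← sq, ← Complex.normSq_eq_norm_sq]
  refine ⟨fun ⟨_, _, hsq⟩ => ⟨hsq, hre⟩, fun ⟨hsq, _⟩ => ?_⟩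
  have hz : ‖z‖ ≤ T := by
    rw [Complex.normSq_eq_norm_sq] at hsq
    nlinarith
  exact ⟨hz, hz, hsq⟩

theorem mahlerMeasure_quadratic_le_iff {T : ℝ} (hT : 1 ≤ T) (q : Fin 2 → ℝ) :
    ((monicOfCoeffs q).map (algebraMap ℝ ℂ)).mahlerMeasure ≤ T ↔
      |q 0| ≤ T ∧ |q 1| ≤ T + q 0 / T := by
  rcases monic_quadratic_eq_conjQuadratic_or_mul (monic_monicOfCoeffs q)
    (natDegree_monicOfCoeffs q) with ⟨z, -, hq⟩ | ⟨a, b, -, hq⟩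
  · have hmap : (monicOfCoeffs q).map (algebraMap ℝ ℂ) =
        (X - C z) * (X - C (starRingEnd ℂ z)) := by rw [hq, map_conjQuadratic]
    obtain ⟨hq0, hq1⟩ := monicOfCoeffs_eq_X_sub_C_mul_X_sub_C ((map_monicOfCoeffs _ q).symm.trans
      hmap)
    rw [Complex.mul_conj] at hq0
    rw [Complex.add_conj, ← Complex.ofReal_neg] at hq1
    rw [hmap, mahlerMeasure_X_sub_C_mul_X_sub_C_le_iff hT, Complex.norm_conj,
      norm_le_and_normSq_le_iff hT, show q 0 = Complex.normSq z from Complex.ofReal_injective hq0,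
      show q 1 = -(2 * z.re) from Complex.ofReal_injective hq1, abs_neg]
  · obtain ⟨hq0, hq1⟩ := monicOfCoeffs_eq_X_sub_C_mul_X_sub_C hq
    have hmap : (monicOfCoeffs q).map (algebraMap ℝ ℂ) = (X - C (a : ℂ)) * (X - C (b : ℂ)) := by
      simp [hq]
    rw [hmap, mahlerMeasure_X_sub_C_mul_X_sub_C_le_iff hT, Complex.norm_real, Complex.norm_real,
      Real.norm_eq_abs, Real.norm_eq_abs, abs_le_and_abs_le_and_mul_le_iff hT, hq0, hq1, abs_neg]

theorem setIntegral_abs_le_and_abs_le {T : ℝ} {c : ℝ → ℝ} (hc : Continuous c) {F : ℝ → ℝ → ℝ}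
    (hF : Continuous fun z : ℝ × ℝ => F z.1 z.2) :
    ∫ q in {q : Fin 2 → ℝ | |q 0| ≤ T ∧ |q 1| ≤ c (q 0)}, F (q 0) (q 1) =
      ∫ v in Icc (-T) T, ∫ u in Icc (-c v) (c v), F v u := by
  set S : Set (ℝ × ℝ) := {z | |z.1| ≤ T ∧ |z.2| ≤ c z.1} with hS
  have hclosed : IsClosed S :=
    (isClosed_le (f := fun z : ℝ × ℝ => |z.1|) (by fun_prop) continuous_const).inter
      (isClosed_le (f := fun z : ℝ × ℝ => |z.2|) (by fun_prop) (hc.comp continuous_fst))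
  have hcompact : IsCompact S := by
    obtain ⟨C, hC⟩ := (isCompact_Icc (a := -T) (b := T)).exists_bound_of_continuousOn
      hc.continuousOn
    refine ((isCompact_Icc (a := -T) (b := T)).prod (isCompact_Icc (a := -C) (b := C))
      ).of_isClosed_subset hclosed ?_
    rintro ⟨v, u⟩ ⟨hv, hu⟩
    exact ⟨abs_le.1 hv, abs_le.1 (hu.trans ((le_abs_self _).trans (hC v (abs_le.1 hv))))⟩
  have hint : Integrable (S.indicator fun z : ℝ × ℝ => F z.1 z.2) (volume.prod volume) :=
    (integrable_indicator_iff hclosed.measurableSet).2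
      (hF.continuousOn.integrableOn_compact hcompact)
  have hiterate (v u : ℝ) : S.indicator (fun z : ℝ × ℝ => F z.1 z.2) (v, u) =
      (Icc (-T) T).indicator (fun v => (Icc (-c v) (c v)).indicator (F v) u) v := by
    simp only [indicator_apply, hS, mem_ofPred_eq, abs_le, mem_Icc, ite_and]
  calc ∫ q in {q : Fin 2 → ℝ | |q 0| ≤ T ∧ |q 1| ≤ c (q 0)}, F (q 0) (q 1)
      = ∫ z in S, F z.1 z.2 :=
        (volume_preserving_finTwoArrow ℝ).setIntegral_preimage_emb
          (MeasurableEquiv.finTwoArrow (α := ℝ)).measurableEmbedding (fun z => F z.1 z.2) S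
    _ = ∫ v, ∫ u, S.indicator (fun z : ℝ × ℝ => F z.1 z.2) (v, u) := by
        rw [← integral_indicator hclosed.measurableSet, Measure.volume_eq_prod,
          integral_prod _ hint]
    _ = ∫ v in Icc (-T) T, ∫ u in Icc (-c v) (c v), F v u := by
        simp only [hiterate, ← integral_indicator measurableSet_Icc]
        congr with v
        by_cases hv : v ∈ Icc (-T) T <;> simp [hv]

end Trapezoid

section QuadraticMoments

open Set Polynomial

theorem powSum_neg_sub_powSum {T : ℝ} (hT : T ≠ 0) (v : ℝ) (k : ℕ) :
    powSum v (-(T + v / T)) k - powSum v (T + v / T) k =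
      (1 - (-1) ^ k) * (T ^ k + (v / T) ^ k) := by
  have hplus := powSum_mul_neg_add T (v / T) k
  have hminus := powSum_mul_neg_add (-T) (-(v / T)) k
  rw [mul_div_cancel₀ v hT] at hplus
  rw [neg_mul_neg, mul_div_cancel₀ v hT, ← neg_add, neg_neg] at hminus
  rw [hplus, hminus, neg_pow T, neg_pow (v / T)]
  ring

theorem integral_altSym_section {T v : ℝ} (hT : 1 ≤ T) (hv : |v| ≤ T) {p r : ℕ} (hpr : p < r) :
    ∫ u in Icc (-(T + v / T)) (T + v / T), altSym v u p r =
      (1 - (-1) ^ (p + r)) / (r - p) * (T ^ r / T ^ p * v ^ p + T ^ p / T ^ r * v ^ r) := by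
  obtain ⟨k, rfl⟩ := Nat.exists_eq_add_of_le hpr.le
  have hT0 : 0 < T := by linarith
  have hnonneg : 0 ≤ T + v / T := by
    have hle : -1 ≤ v / T := by
      rw [le_div_iff₀ hT0]
      linarith [(abs_le.1 hv).1]
    linarith
  have hk : (k : ℝ) ≠ 0 := Nat.cast_ne_zero.2 (by lia)
  have hhom : ∫ u in (-(T + v / T))..(T + v / T), homSym v u k =
      (1 - (-1) ^ k) / k * (T ^ k + (v / T) ^ k) := by
    rw [div_mul_eq_mul_div, eq_div_iff hk, mul_comm, mul_integral_homSym,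
      powSum_neg_sub_powSum hT0.ne']
  have hsign : (-1 : ℝ) ^ (p + (p + k)) = (-1) ^ k := by
    rw [← add_assoc, pow_add, Even.neg_one_pow ⟨p, rfl⟩, one_mul]
  simp only [altSym, hpr.le, if_true, Nat.add_sub_cancel_left]
  rw [integral_Icc_eq_integral_Ioc, ← intervalIntegral.integral_of_le (by linarith),
    intervalIntegral.integral_const_mul, hhom, hsign, Nat.cast_add, add_sub_cancel_left, div_pow,
    pow_add, pow_add]
  field_simp

theorem integral_altSym_mahlerMeasure_le {T : ℝ} (hT : 1 ≤ T) (p r : ℕ) :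
    ∫ q in {q : Fin 2 → ℝ | ((monicOfCoeffs q).map (algebraMap ℝ ℂ)).mahlerMeasure ≤ T},
      altSym (q 0) (q 1) p r =
    (1 - (-1) ^ (p + r)) / (r - p) * ((1 + (-1) ^ p) * T ^ (r + 1) / (p + 1) +
      (1 + (-1) ^ r) * T ^ (p + 1) / (r + 1)) := by
  have hT0 : 0 < T := by linarith
  wlog hpr : p < r generalizing p r
  · rcases (not_lt.1 hpr).eq_or_lt with rfl | hrp
    · simp [altSym_self]
    · simp only [altSym_swap _ _ r p]
      rw [integral_neg, this r p hrp, add_comm r p, ← neg_sub (r : ℝ), div_neg]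
      ring
  have hpow (n : ℕ) : IntegrableOn (fun v : ℝ => v ^ n) (Icc (-T) T) :=
    (continuous_pow n).continuousOn.integrableOn_Icc
  simp only [mahlerMeasure_quadratic_le_iff hT]
  rw [setIntegral_abs_le_and_abs_le (c := fun v => T + v / T) (F := fun v u => altSym v u p r)
      (by fun_prop) (continuous_altSym continuous_fst continuous_snd p r),
    setIntegral_congr_fun measurableSet_Icc
      (fun v hv => integral_altSym_section hT (abs_le.2 hv) hpr),
    integral_const_mul, integral_add ((hpow p).const_mul _) ((hpow r).const_mul _),
    integral_const_mul, integral_const_mul, integral_Icc_neg_pow hT0.le,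
    integral_Icc_neg_pow hT0.le, pow_succ, pow_succ]
  field_simp

/-- The moment `∫ μ(q)⁻ˢ (αᵖ βʳ - αʳ βᵖ) / (β - α)` over the real monic quadratics `q` with roots
`α`, `β`. These moments are the entries of the determinant that computes `realAverage`. -/
noncomputable def quadraticMoment (s : ℂ) (p r : ℕ) : ℂ :=
  ∫ q : Fin 2 → ℝ, (((monicOfCoeffs q).map (algebraMap ℝ ℂ)).mahlerMeasure : ℂ) ^ (-s) *
    altSym (q 0 : ℂ) (q 1 : ℂ) p r

theorem quadraticMoment_swap (s : ℂ) (p r : ℕ) :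
    quadraticMoment s r p = -quadraticMoment s p r := by
  simp only [quadraticMoment, altSym_swap _ _ p r, mul_neg]
  exact integral_neg _

theorem integrable_mahlerMeasure_cpow_mul_altSym {s : ℂ} {p r : ℕ} (hp : ((p + 1 : ℕ) : ℝ) < s.re)
    (hr : ((r + 1 : ℕ) : ℝ) < s.re) :
    Integrable fun q : Fin 2 → ℝ =>
      (((monicOfCoeffs q).map (algebraMap ℝ ℂ)).mahlerMeasure : ℂ) ^ (-s) *
        altSym (q 0 : ℂ) (q 1 : ℂ) p r := by
  wlog hpr : p < r generalizing p r
  · rcases (not_lt.1 hpr).eq_or_lt with rfl | hrp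
    · simp [altSym_self]
    · simp only [altSym_swap _ _ r p, mul_neg]
      exact (this hr hp hrp).neg
  obtain ⟨k, rfl⟩ := Nat.exists_eq_add_of_lt hpr
  refine integrable_mahlerMeasure_cpow_mul (volume : Measure (Fin 2 → ℝ))
    (continuous_altSym (by fun_prop) (by fun_prop) p (p + k + 1)) (B := 3 ^ k) (k := p + k)
    (fun q => ?_) ?_
  · rw [map_monicOfCoeffs]
    have hcoeff (i : Fin 2) :=
      norm_coeff_le_choose_mul_mahlerMeasure i (monicOfCoeffs fun i => (q i : ℂ))
    simp only [natDegree_monicOfCoeffs, coeff_monicOfCoeffs_fin] at hcoeff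
    refine norm_altSym_le (one_le_mahlerMeasure_of_monic (monic_monicOfCoeffs _)) ?_ ?_ p k
    · simpa using hcoeff 0
    · simpa using hcoeff 1
  · push_cast at hr ⊢
    rw [Module.finrank_self, Nat.cast_one]
    linarith

theorem measurable_mahlerMeasure_map_monicOfCoeffs {n : ℕ} :
    Measurable fun a : Fin n → ℝ => ((monicOfCoeffs a).map (algebraMap ℝ ℂ)).mahlerMeasure := by
  simp only [map_monicOfCoeffs]
  exact measurable_mahlerMeasure_monicOfCoeffs.comp
    (f := fun (a : Fin n → ℝ) i => (a i : ℂ)) (by fun_prop)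

theorem quadraticMoment_eq_of_sublevel {s : ℂ} {p r κ : ℕ} {A : ℂ}
    (hp : ((p + 1 : ℕ) : ℝ) < s.re) (hr : ((r + 1 : ℕ) : ℝ) < s.re) (hκ : (κ : ℝ) < s.re)
    (hsublevel : ∀ T : ℝ, (1 - (-1) ^ (p + r)) / (r - p) * ((1 + (-1) ^ p) * T ^ (r + 1) / (p + 1) +
      (1 + (-1) ^ r) * T ^ (p + 1) / (r + 1)) = A * (T : ℂ) ^ κ) :
    quadraticMoment s p r = A * (s / (s - κ)) := by
  refine integral_cpow_mul_of_sublevel measurable_mahlerMeasure_map_monicOfCoeffs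
    (fun q => one_le_mahlerMeasure_of_monic ((monic_monicOfCoeffs q).map _))
    (continuous_altSym (by fun_prop) (by fun_prop) p r).measurable hκ
    (integrable_mahlerMeasure_cpow_mul_altSym hp hr) fun T hT => ?_
  have hofReal (q : Fin 2 → ℝ) : altSym (q 0 : ℂ) (q 1 : ℂ) p r = (altSym (q 0) (q 1) p r : ℝ) :=
    (map_altSym Complex.ofRealHom _ _ _ _).symm
  simp only [hofReal]
  rw [integral_complex_ofReal, integral_altSym_mahlerMeasure_le hT, ← hsublevel]
  push_cast
  rfl

theorem quadraticMoment_of_even_of_odd {s : ℂ} {p r : ℕ} (hp : ((p + 1 : ℕ) : ℝ) < s.re)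
    (hr : ((r + 1 : ℕ) : ℝ) < s.re) (hpe : Even p) (hro : Odd r) :
    quadraticMoment s p r = 4 / ((r - p) * (p + 1)) * (s / (s - (r + 1 : ℕ))) :=
  quadraticMoment_eq_of_sublevel hp hr hr fun T => by
    rw [(hpe.add_odd hro).neg_one_pow, hpe.neg_one_pow, hro.neg_one_pow, ← div_div]
    ring

theorem quadraticMoment_of_even_add {s : ℂ} {p r : ℕ} (hp : ((p + 1 : ℕ) : ℝ) < s.re)
    (hr : ((r + 1 : ℕ) : ℝ) < s.re) (hpr : Even (p + r)) : quadraticMoment s p r = 0 := by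
  rw [quadraticMoment_eq_of_sublevel (A := 0) hp hr hr fun T => by simp [hpr.neg_one_pow],
    zero_mul]

end QuadraticMoments

section ExteriorAlgebra

open ExteriorAlgebra

section Generators

variable {R M : Type*} [CommRing R] [AddCommGroup M] [Module R M]

theorem ι_mul_ι_swap (a b : M) : ι R a * ι R b = -(ι R b * ι R a) :=
  eq_neg_of_add_eq_zero_left (ι_add_mul_swap a b)

theorem commute_ι_mul_ι (a b : M) (z : ExteriorAlgebra R M) : Commute (ι R a * ι R b) z := by
  induction z using ExteriorAlgebra.induction with
  | algebraMap r => exact (Algebra.commutes r _).symm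
  | ι x =>
    rw [commute_iff_eq, mul_assoc, ι_mul_ι_swap b x, mul_neg, ← mul_assoc, ι_mul_ι_swap a x,
      neg_mul, neg_neg, mul_assoc]
  | mul u v hu hv => exact hu.mul_right hv
  | add u v hu hv => exact hu.add_right hv

theorem ι_mul_ι_mul_self (a b : M) : ι R a * ι R b * (ι R a * ι R b) = 0 := by
  rw [← mul_assoc, (commute_ι_mul_ι a b _).eq, ← mul_assoc, ι_sq_zero, zero_mul, zero_mul]

theorem ιMulti_succ_last {n : ℕ} (v : Fin (n + 1) → M) :
    ιMulti R (n + 1) v = ιMulti R n (fun i => v i.castSucc) * ι R (v (Fin.last n)) := by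
  simp only [ιMulti_apply, List.ofFn_succ', List.concat_eq_append, List.prod_append,
    List.prod_singleton]

theorem add_pow_succ_of_mul_self_eq_zero {A : Type*} [Semiring A] {y x : A} (h : Commute y x)
    (hx : x * x = 0) (m : ℕ) : (y + x) ^ (m + 1) = y ^ (m + 1) + (m + 1) • (y ^ m * x) := by
  induction m with
  | zero => simp
  | succ m ih =>
    have hcross : y ^ m * x * (y + x) = y ^ (m + 1) * x := by
      rw [mul_add, mul_assoc _ x x, hx, mul_zero, add_zero, mul_assoc, ← h.eq, ← mul_assoc,
        ← pow_succ]
    rw [pow_succ, ih, add_mul, smul_mul_assoc, hcross, mul_add, ← pow_succ, add_assoc,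
      succ_nsmul' _ (m + 1)]

theorem sum_ι_mul_ι_add_pow (z : ℕ → M) (k m : ℕ) :
    (∑ b ∈ Finset.range (k + 1), ι R (z (2 * b)) * ι R (z (2 * b + 1))) ^ (m + 1) =
      (∑ b ∈ Finset.range k, ι R (z (2 * b)) * ι R (z (2 * b + 1))) ^ (m + 1) +
        (m + 1) • ((∑ b ∈ Finset.range k, ι R (z (2 * b)) * ι R (z (2 * b + 1))) ^ m *
          (ι R (z (2 * k)) * ι R (z (2 * k + 1)))) := by
  rw [Finset.sum_range_succ]
  exact add_pow_succ_of_mul_self_eq_zero (commute_ι_mul_ι _ _ _).symm (ι_mul_ι_mul_self _ _) m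

theorem sum_ι_mul_ι_pow_succ (z : ℕ → M) (k : ℕ) :
    (∑ b ∈ Finset.range k, ι R (z (2 * b)) * ι R (z (2 * b + 1))) ^ (k + 1) = 0 := by
  induction k with
  | zero => simp
  | succ k ih => rw [sum_ι_mul_ι_add_pow, pow_succ, ih, zero_mul, zero_mul, smul_zero, add_zero]

theorem sum_ι_mul_ι_pow (z : ℕ → M) (k : ℕ) :
    (∑ b ∈ Finset.range k, ι R (z (2 * b)) * ι R (z (2 * b + 1))) ^ k =
      k.factorial • ιMulti R (2 * k) fun i : Fin (2 * k) => z i := by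
  induction k with
  | zero => simp
  | succ k ih =>
    rw [sum_ι_mul_ι_add_pow, sum_ι_mul_ι_pow_succ, ih, zero_add, smul_mul_assoc, smul_smul,
      ← Nat.factorial_succ, Nat.mul_succ, ιMulti_succ_last, ιMulti_succ_last, mul_assoc]
    rfl

end Generators

section Determinants

variable (R : Type*) [CommRing R]

/-- The linear form on the exterior algebra of `Rⁿ` which takes the wedge of `n` vectors to the
determinant with these rows, and vanishes in all other degrees. -/
noncomputable def detForm (n : ℕ) : ExteriorAlgebra R (Fin n → R) →ₗ[R] R :=
  liftAlternating fun i =>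
    if h : i = n then Matrix.detRowAlternating.domDomCongr (finCongr h.symm) else 0

/-- The coefficient vector in `Rⁿ` of the monomial `xᵖ`, which is zero for `n ≤ p`. -/
def monomialVec (n p : ℕ) : Fin n → R := fun j => if (j : ℕ) = p then 1 else 0

variable {R}

/-- The vector `(1, x, …, xⁿ⁻¹)`. -/
def powerVec (n : ℕ) (x : R) : Fin n → R := fun j => x ^ (j : ℕ)

/-- The wedge of the vectors `(1, tᵢ, …, tᵢⁿ⁻¹)`: the rows at the nodes `tᵢ` of a Vandermonde matrix
whose other rows are still to be integrated. -/
noncomputable def vandermondeBlade (n : ℕ) {m : ℕ} (t : Fin m → R) :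
    ExteriorAlgebra R (Fin n → R) :=
  ιMulti R m fun i => powerVec n (t i)

theorem detForm_ιMulti {n : ℕ} (v : Fin n → Fin n → R) :
    detForm R n (ιMulti R n v) = (Matrix.of v).det := by
  rw [detForm, liftAlternating_apply_ιMulti, dif_pos rfl]
  rfl

theorem sum_smul_monomialVec (n : ℕ) (c : ℕ → R) :
    ∑ p ∈ Finset.range n, c p • monomialVec R n p = fun j : Fin n => c j := by
  ext j
  simp [monomialVec]

theorem powerVec_eq_sum (n : ℕ) (x : R) :
    powerVec n x = ∑ p ∈ Finset.range n, x ^ p • monomialVec R n p :=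
  (sum_smul_monomialVec n fun p => x ^ p).symm

theorem detForm_vandermondeBlade {n : ℕ} (t : Fin n → R) :
    detForm R n (vandermondeBlade n t) = (Matrix.vandermonde t).det :=
  detForm_ιMulti _

theorem vandermondeBlade_vecCons (n : ℕ) {m : ℕ} (x : R) (t : Fin m → R) :
    vandermondeBlade n (Matrix.vecCons x t) = ι R (powerVec n x) * vandermondeBlade n t := by
  rw [vandermondeBlade, ιMulti_succ_apply]
  rfl

theorem det_vandermonde_vecCons {m : ℕ} (x : R) (t : Fin m → R) :
    (Matrix.vandermonde (Matrix.vecCons x t)).det =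
      (∏ i, (t i - x)) * (Matrix.vandermonde t).det := by
  rw [Matrix.det_vandermonde, Matrix.det_vandermonde, Fin.prod_univ_succ, Fin.prod_Ioi_zero]
  simp [Fin.prod_Ioi_succ]

theorem ι_powerVec_mul_ι_powerVec (n : ℕ) (α β : R) :
    ι R (powerVec n α) * ι R (powerVec n β) =
      ∑ p ∈ Finset.range n, ∑ r ∈ Finset.range n,
        (α ^ p * β ^ r) • (ι R (monomialVec R n p) * ι R (monomialVec R n r)) := by
  simp only [powerVec_eq_sum, map_sum, map_smul, Finset.sum_mul_sum, smul_mul_smul_comm]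

theorem two_smul_ι_powerVec_mul_ι_powerVec (n : ℕ) (α β : R) :
    (2 : R) • (ι R (powerVec n α) * ι R (powerVec n β)) =
      (β - α) • ∑ p ∈ Finset.range n, ∑ r ∈ Finset.range n,
        altSym (α * β) (-(α + β)) p r • (ι R (monomialVec R n p) * ι R (monomialVec R n r)) := by
  rw [two_smul]
  nth_rw 2 [ι_mul_ι_swap]
  simp only [ι_powerVec_mul_ι_powerVec, Finset.smul_sum, smul_smul, sub_mul_altSym, sub_smul,
    Finset.sum_sub_distrib, ← sub_eq_add_neg, mul_comm]

end Determinants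

end ExteriorAlgebra

section RealAverages

open Polynomial ExteriorAlgebra

section PairElement

/-- The moment `∫ max(1, |x|)⁻ˢ xᵖ dx` of the Mahler measure over real linear polynomials. -/
noncomputable def linearMoment (s : ℂ) (p : ℕ) : ℂ :=
  ∫ x : ℝ, ((max 1 |x| : ℝ) : ℂ) ^ (-s) * (x : ℂ) ^ p

/-- The rows of the matrix whose determinant is the real average: an odd row is a coordinate vector,
an even row `i` holds the moments pairing `i + 1` with the even exponents and, if there is no such
exponent `i + 1 < n`, the linear moments. -/
noncomputable def momentRow (s : ℂ) (n i : ℕ) : Fin n → ℂ :=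
  if Odd i then monomialVec ℂ n i
  else if i + 1 < n then fun j => if Even (j : ℕ) then quadraticMoment s j (i + 1) else 0
  else fun j => linearMoment s j

/-- The degree two element of the exterior algebra which collects the contribution of one real
quadratic factor. -/
noncomputable def pairElement (n : ℕ) (s : ℂ) : ExteriorAlgebra ℂ (Fin n → ℂ) :=
  ∑ b ∈ Finset.range (n / 2), ι ℂ (momentRow s n (2 * b)) * ι ℂ (momentRow s n (2 * b + 1))

/-- The degree one element of the exterior algebra which collects the contribution of one real
linear factor. -/
noncomputable def linearElement (n : ℕ) (s : ℂ) : ExteriorAlgebra ℂ (Fin n → ℂ) :=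
  ι ℂ fun j => linearMoment s j

theorem momentRow_of_odd (s : ℂ) (n : ℕ) {i : ℕ} (hi : Odd i) :
    momentRow s n i = monomialVec ℂ n i :=
  if_pos hi

theorem momentRow_of_even_of_lt (s : ℂ) {n i : ℕ} (hi : Even i) (hn : i + 1 < n) :
    momentRow s n i = fun j : Fin n => if Even (j : ℕ) then quadraticMoment s j (i + 1) else 0 := by
  rw [momentRow, if_neg (Nat.not_odd_iff_even.2 hi), if_pos hn]

theorem momentRow_of_even_of_le (s : ℂ) {n i : ℕ} (hi : Even i) (hn : n ≤ i + 1) :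
    momentRow s n i = fun j : Fin n => linearMoment s j := by
  rw [momentRow, if_neg (Nat.not_odd_iff_even.2 hi), if_neg hn.not_gt]

theorem commute_pairElement (n : ℕ) (s : ℂ) (z : ExteriorAlgebra ℂ (Fin n → ℂ)) :
    Commute (pairElement n s) z :=
  Commute.sum_left _ _ _ fun _ _ => commute_ι_mul_ι _ _ z

theorem sum_sum_eq_two_nsmul_of_symm {ι A : Type*} [AddCommMonoid A] (S : Finset ι) (P : ι → Prop)
    [DecidablePred P] {f : ι → ι → A} (hsymm : ∀ p ∈ S, ∀ r ∈ S, f r p = f p r)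
    (hsame : ∀ p ∈ S, ∀ r ∈ S, (P p ↔ P r) → f p r = 0) :
    ∑ p ∈ S, ∑ r ∈ S, f p r = 2 • ∑ r ∈ S with ¬P r, ∑ p ∈ S with P p, f p r := by
  have hP : ∀ p ∈ S.filter P, ∑ r ∈ S, f p r = ∑ r ∈ S with ¬P r, f p r := fun p hp => by
    rw [Finset.mem_filter] at hp
    exact (Finset.sum_filter_of_ne (p := (¬P ·)) fun r hr hne hPr =>
      hne (hsame p hp.1 r hr (iff_of_true hp.2 hPr))).symm
  have hnotP : ∀ p ∈ S.filter (¬P ·), ∑ r ∈ S, f p r = ∑ r ∈ S with P r, f r p := fun p hp => by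
    rw [Finset.mem_filter] at hp
    rw [← Finset.sum_filter_of_ne (p := P) fun r hr hne => by_contra fun hPr =>
      hne (hsame p hp.1 r hr (iff_of_false hp.2 hPr))]
    exact Finset.sum_congr rfl fun r hr => hsymm r (Finset.mem_filter.1 hr).1 p hp.1
  rw [← Finset.sum_filter_add_sum_filter_not S P, Finset.sum_congr rfl hP,
    Finset.sum_congr rfl hnotP, Finset.sum_comm, two_nsmul]

theorem sum_range_filter_not_even {A : Type*} [AddCommMonoid A] (F : ℕ → A) (n : ℕ) :
    ∑ r ∈ Finset.range n with ¬Even r, F r = ∑ b ∈ Finset.range (n / 2), F (2 * b + 1) := by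
  symm
  refine Finset.sum_nbij (fun b => 2 * b + 1) (fun b hb => ?_) (fun a _ b _ h => ?_)
    (fun r hr => ?_) fun _ _ => rfl
  · simp only [Finset.mem_filter, Finset.mem_range, Nat.not_even_iff_odd] at hb ⊢
    exact ⟨by lia, odd_two_mul_add_one b⟩
  · simpa using h
  · simp only [Finset.coe_filter, Finset.mem_range, Nat.not_even_iff_odd,
      Set.mem_ofPred_eq] at hr
    obtain ⟨hn, b, rfl⟩ := hr
    exact ⟨b, by simp only [Finset.coe_range, Set.mem_Iio]; lia, rfl⟩

theorem two_smul_pairElement {n : ℕ} {s : ℂ} (hs : (n : ℝ) < s.re) :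
    (2 : ℂ) • pairElement n s = ∑ p ∈ Finset.range n, ∑ r ∈ Finset.range n,
      quadraticMoment s p r • (ι ℂ (monomialVec ℂ n p) * ι ℂ (monomialVec ℂ n r)) := by
  have hre : ∀ p ∈ Finset.range n, ((p + 1 : ℕ) : ℝ) < s.re := fun p hp =>
    (Nat.cast_le.2 (Finset.mem_range.1 hp)).trans_lt hs
  rw [sum_sum_eq_two_nsmul_of_symm (Finset.range n) Even, sum_range_filter_not_even,
    ofNat_smul_eq_nsmul ℂ 2, pairElement]
  · congr 1
    refine Finset.sum_congr rfl fun b hb => ?_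
    rw [Finset.mem_range] at hb
    rw [momentRow_of_even_of_lt s (even_two_mul b) (by lia),
      momentRow_of_odd s n (odd_two_mul_add_one b),
      ← sum_smul_monomialVec n fun p => if Even p then quadraticMoment s p (2 * b + 1) else 0]
    simp only [ite_smul, zero_smul, ← Finset.sum_filter, map_sum, map_smul, Finset.sum_mul,
      smul_mul_assoc]
  · intro p _ r _
    rw [quadraticMoment_swap, ι_mul_ι_swap, neg_smul_neg]
  · intro p hp r hr hpr
    rw [quadraticMoment_of_even_add (hre p hp) (hre r hr) (Nat.even_add.2 hpr), zero_smul]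

theorem pairElement_pow (n : ℕ) (s : ℂ) : pairElement n s ^ (n / 2) =
    (n / 2).factorial • ιMulti ℂ (2 * (n / 2)) fun i => momentRow s n i :=
  sum_ι_mul_ι_pow (momentRow s n) (n / 2)

end PairElement

section Recursion

variable {s : ℂ} {n m : ℕ}

theorem exists_quadratic_roots (q : Fin 2 → ℝ) : ∃ z : ℂ × ℂ,
    (monicOfCoeffs q).map (algebraMap ℝ ℂ) = (X - C z.1) * (X - C z.2) := by
  rcases monic_quadratic_eq_conjQuadratic_or_mul (monic_monicOfCoeffs q)
    (natDegree_monicOfCoeffs q) with ⟨z, -, h⟩ | ⟨a, b, -, h⟩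
  · exact ⟨(z, starRingEnd ℂ z), by rw [h, map_conjQuadratic]⟩
  · exact ⟨(a, b), by simp [h]⟩

theorem ae_quadratic_roots_ne {α β : (Fin 2 → ℝ) → ℂ}
    (hαβ : ∀ q, (monicOfCoeffs q).map (algebraMap ℝ ℂ) = (X - C (α q)) * (X - C (β q))) :
    ∀ᵐ q : Fin 2 → ℝ, α q ≠ β q := by
  filter_upwards [ae_separable_monicOfCoeffs (volume : Measure (Fin 2 → ℝ))] with q hq heq
  have hsep := hq.map (f := algebraMap ℝ ℂ)
  rw [hαβ, heq] at hsep
  exact not_isUnit_X_sub_C _ (isCoprime_self.1 hsep.isCoprime)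

theorem two_mul_det_mul_realWeight_mul (t : Fin m → ℂ) {q : Fin 2 → ℝ} {α β c : ℂ}
    (hαβ : (monicOfCoeffs q).map (algebraMap ℝ ℂ) = (X - C α) * (X - C β)) (hne : α ≠ β)
    (φ : ExteriorAlgebra ℂ (Fin n → ℂ) →ₗ[ℂ] ℂ)
    (hc : (Matrix.vandermonde (Matrix.vecCons α (Matrix.vecCons β t))).det * c =
      φ (ι ℂ (powerVec n α) * ι ℂ (powerVec n β))) :
    2 * ((Matrix.vandermonde t).det * (realWeight s t (monicOfCoeffs q) * c)) =
      ∑ p ∈ Finset.range n, ∑ r ∈ Finset.range n,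
        (((monicOfCoeffs q).map (algebraMap ℝ ℂ)).mahlerMeasure : ℂ) ^ (-s) *
          altSym (q 0 : ℂ) (q 1 : ℂ) p r *
          φ (ι ℂ (monomialVec ℂ n p) * ι ℂ (monomialVec ℂ n r)) := by
  obtain ⟨h0, h1⟩ := monicOfCoeffs_eq_X_sub_C_mul_X_sub_C ((map_monicOfCoeffs _ q).symm.trans hαβ)
  have hpair := congrArg φ (two_smul_ι_powerVec_mul_ι_powerVec n α β)
  rw [map_smul, ← hc, det_vandermonde_vecCons, det_vandermonde_vecCons, Fin.prod_univ_succ] at hpair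
  simp only [Matrix.cons_val_zero, Matrix.cons_val_succ, map_smul, map_sum, smul_eq_mul] at hpair
  simp only [Complex.coe_algebraMap] at h0 h1
  simp_rw [mul_assoc (_ ^ (-s)), ← Finset.mul_sum]
  rw [h0, h1, realWeight, hαβ]
  simp only [eval_mul, eval_sub, eval_X, eval_C, Finset.prod_mul_distrib]
  refine mul_left_cancel₀ (sub_ne_zero.2 hne.symm) ?_
  linear_combination (((X - C α) * (X - C β)).mahlerMeasure : ℂ) ^ (-s) * hpair

theorem integral_sum_sum_altSym (hs : (n : ℝ) < s.re)
    (φ : ExteriorAlgebra ℂ (Fin n → ℂ) →ₗ[ℂ] ℂ) :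
    ∫ q : Fin 2 → ℝ, ∑ p ∈ Finset.range n, ∑ r ∈ Finset.range n,
        (((monicOfCoeffs q).map (algebraMap ℝ ℂ)).mahlerMeasure : ℂ) ^ (-s) *
          altSym (q 0 : ℂ) (q 1 : ℂ) p r *
          φ (ι ℂ (monomialVec ℂ n p) * ι ℂ (monomialVec ℂ n r)) = 2 * φ (pairElement n s) := by
  have hint : ∀ p ∈ Finset.range n, ∀ r ∈ Finset.range n, Integrable fun q : Fin 2 → ℝ =>
      (((monicOfCoeffs q).map (algebraMap ℝ ℂ)).mahlerMeasure : ℂ) ^ (-s) *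
        altSym (q 0 : ℂ) (q 1 : ℂ) p r *
        φ (ι ℂ (monomialVec ℂ n p) * ι ℂ (monomialVec ℂ n r)) := fun p hp r hr =>
    (integrable_mahlerMeasure_cpow_mul_altSym
      ((Nat.cast_le.2 (Finset.mem_range.1 hp)).trans_lt hs)
      ((Nat.cast_le.2 (Finset.mem_range.1 hr)).trans_lt hs)).mul_const _
  rw [← smul_eq_mul, ← map_smul, two_smul_pairElement hs, map_sum,
    integral_finsetSum _ fun p hp => integrable_finsetSum _ (hint p hp)]
  refine Finset.sum_congr rfl fun p hp => ?_
  rw [integral_finsetSum _ (hint p hp), map_sum]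
  refine Finset.sum_congr rfl fun r _ => ?_
  rw [integral_mul_const, map_smul, smul_eq_mul, quadraticMoment]

theorem realAverage_zero (s : ℂ) (t : Fin m → ℂ) : realAverage s 0 t = 1 := by
  have hone (a : Fin 0 → ℝ) : monicOfCoeffs a = 1 :=
    (monic_monicOfCoeffs a).natDegree_eq_zero.1 (natDegree_monicOfCoeffs a)
  simp [realAverage, realWeight, hone, measureReal_def, volume_pi]

theorem det_vandermonde_mul_realAverage_one (t : Fin m → ℂ) (hs : ((m + 1 : ℕ) : ℝ) < s.re) :
    (Matrix.vandermonde t).det * realAverage s 1 t =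
      detForm ℂ (m + 1) (linearElement (m + 1) s * vandermondeBlade (m + 1) t) := by
  set φ : (Fin (m + 1) → ℂ) →ₗ[ℂ] ℂ := detForm ℂ (m + 1) ∘ₗ
    LinearMap.mulRight ℂ (vandermondeBlade (m + 1) t) ∘ₗ ι ℂ
  have hpointwise (x : ℝ) : (Matrix.vandermonde t).det * realWeight s t (X - C x) =
      ∑ p ∈ Finset.range (m + 1),
        ((max 1 |x| : ℝ) : ℂ) ^ (-s) * (x : ℂ) ^ p * φ (monomialVec ℂ (m + 1) p) := by
    have hpower : φ (powerVec (m + 1) (x : ℂ)) =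
        (∏ i, (t i - x)) * (Matrix.vandermonde t).det := by
      rw [← det_vandermonde_vecCons, ← detForm_vandermondeBlade, vandermondeBlade_vecCons]
      rfl
    simp only [powerVec_eq_sum, map_sum, map_smul, smul_eq_mul] at hpower
    simp_rw [mul_assoc, ← Finset.mul_sum]
    rw [hpower]
    simp [realWeight, mahlerMeasure_X_sub_C]
    ring
  have hint : ∀ p ∈ Finset.range (m + 1), Integrable fun x : ℝ =>
      ((max 1 |x| : ℝ) : ℂ) ^ (-s) * (x : ℂ) ^ p * φ (monomialVec ℂ (m + 1) p) := fun p hp =>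
    (integrable_max_abs_cpow_mul_pow
      ((Nat.cast_le.2 (Finset.mem_range.1 hp)).trans_lt hs)).mul_const _
  rw [realAverage, integral_monicOfCoeffs_one, ← integral_const_mul]
  simp_rw [hpointwise]
  rw [integral_finsetSum _ hint]
  change _ = φ fun j => linearMoment s j
  rw [← sum_smul_monomialVec]
  simp only [map_sum, map_smul, smul_eq_mul, integral_mul_const, linearMoment]

theorem factorial_mul_det_vandermonde_mul_realAverage (hs : (n : ℝ) < s.re) (d : ℕ) :
    ∀ {m : ℕ} (t : Fin m → ℂ), m + d = n →
      ((d / 2).factorial : ℂ) * ((Matrix.vandermonde t).det * realAverage s d t) =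
        detForm ℂ n (pairElement n s ^ (d / 2) * linearElement n s ^ (d % 2) *
          vandermondeBlade n t) := by
  induction d using Nat.twoStepInduction with
  | zero =>
    rintro m t rfl
    simp only [realAverage_zero, detForm_vandermondeBlade, Nat.zero_div, Nat.zero_mod,
      pow_zero, one_mul, mul_one, Nat.factorial_zero, Nat.cast_one]
  | one =>
    rintro m t rfl
    simpa using det_vandermonde_mul_realAverage_one t hs
  | more d ih _ =>
    intro m t hm
    choose z hz using exists_quadratic_roots
    set φ : ExteriorAlgebra ℂ (Fin n → ℂ) →ₗ[ℂ] ℂ := detForm ℂ n ∘ₗ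
      LinearMap.mulLeft ℂ (pairElement n s ^ (d / 2) * linearElement n s ^ (d % 2)) ∘ₗ
      LinearMap.mulRight ℂ (vandermondeBlade n t)
    have hpeel := realAverage_add_two t (by rwa [show d + 2 + m = n by lia]) hz
    have hφpair : φ (pairElement n s) = detForm ℂ n (pairElement n s ^ (d / 2 + 1) *
        linearElement n s ^ (d % 2) * vandermondeBlade n t) := by
      rw [pow_succ, mul_assoc (_ ^ _) (pairElement n s), (commute_pairElement n s _).eq,
        ← mul_assoc, mul_assoc _ (pairElement n s)]
      rfl
    have hdouble : ∫ q : Fin 2 → ℝ, 2 * ((Matrix.vandermonde t).det *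
        (realWeight s t (monicOfCoeffs q) * ((d / 2).factorial *
          realAverage s d (Matrix.vecCons (z q).1 (Matrix.vecCons (z q).2 t))))) =
        2 * φ (pairElement n s) := by
      rw [← integral_sum_sum_altSym hs φ]
      refine integral_congr_ae ?_
      filter_upwards [ae_quadratic_roots_ne hz] with q hne
      refine two_mul_det_mul_realWeight_mul t (hz q) hne φ ?_
      rw [mul_left_comm, ih _ (by lia), vandermondeBlade_vecCons, vandermondeBlade_vecCons,
        ← mul_assoc (ι ℂ _)]
      rfl
    simp_rw [mul_left_comm _ ((d / 2).factorial : ℂ)] at hdouble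
    rw [integral_const_mul, integral_const_mul, integral_const_mul, ← hpeel, hφpair] at hdouble
    have hhalf : (d + 2) / 2 = d / 2 + 1 := by lia
    rw [hhalf, mul_left_comm] at hdouble
    rw [hhalf, Nat.add_mod_right, Nat.factorial_succ,
      ← mul_left_cancel₀ (two_ne_zero (α := ℂ)) hdouble]
    push_cast
    ring

theorem realAverage_eq_det (hs : (n : ℝ) < s.re) :
    realAverage s n Fin.elim0 = (Matrix.of fun i : Fin n => momentRow s n i).det := by
  have hfactorial : ((n / 2).factorial : ℂ) ≠ 0 := Nat.cast_ne_zero.2 (Nat.factorial_ne_zero _)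
  have htop := factorial_mul_det_vandermonde_mul_realAverage hs n Fin.elim0 (zero_add n)
  rw [pairElement_pow, smul_mul_assoc, smul_mul_assoc, map_nsmul, nsmul_eq_mul,
    Matrix.det_fin_zero, one_mul, vandermondeBlade, ιMulti_zero_apply, mul_one] at htop
  rw [mul_left_cancel₀ hfactorial htop, ← detForm_ιMulti]
  obtain ⟨k, rfl | rfl⟩ := Nat.even_or_odd' n
  · rw [Nat.mul_mod_right, pow_zero, mul_one, Nat.mul_div_cancel_left k two_pos]
  · have hlast : linearElement (2 * k + 1) s = ι ℂ (momentRow s (2 * k + 1) (2 * k)) := by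
      rw [momentRow_of_even_of_le s (even_two_mul k) le_rfl, linearElement]
    rw [show (2 * k + 1) % 2 = 1 by lia, show (2 * k + 1) / 2 = k by lia, pow_one, hlast,
      ιMulti_succ_last]
    rfl

end Recursion

section EvenRows

/-- The splitting of `Fin n` into its even and its odd elements. -/
def evenOddEquiv (n : ℕ) : Fin ((n + 1) / 2) ⊕ Fin (n / 2) ≃ Fin n where
  toFun := Sum.elim (fun a => ⟨2 * a, by lia⟩) (fun b => ⟨2 * b + 1, by lia⟩)
  invFun i := if h : (i : ℕ) % 2 = 0 then Sum.inl ⟨i / 2, by lia⟩ else Sum.inr ⟨i / 2, by lia⟩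
  left_inv := by
    rintro (a | b)
    · simp
    · have hodd : ¬(2 * (b : ℕ) + 1) % 2 = 0 := by lia
      refine (dif_neg hodd).trans ?_
      congr 2
      simp only [Sum.elim_inr]
      lia
  right_inv i := by
    dsimp only
    split_ifs
    all_goals
      ext
      simp only [Sum.elim_inl, Sum.elim_inr]
      lia

theorem linearMoment_eq {s : ℂ} {p : ℕ} (hs : ((p + 1 : ℕ) : ℝ) < s.re) :
    linearMoment s p = (1 + (-1) ^ p) / (p + 1) * (s / (s - (p + 1 : ℕ))) :=
  integral_max_abs_cpow_mul_pow hs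

variable {s : ℂ} {n : ℕ}

theorem momentRow_even_odd (hs : (n : ℝ) < s.re) (b a : ℕ) (ha : 2 * a + 1 < n) :
    momentRow s n (2 * b) ⟨2 * a + 1, ha⟩ = 0 := by
  rcases lt_or_ge (2 * b + 1) n with hb | hb
  · rw [momentRow_of_even_of_lt s (even_two_mul b) hb]
    exact if_neg (Nat.not_even_two_mul_add_one a)
  · rw [momentRow_of_even_of_le s (even_two_mul b) hb]
    refine (linearMoment_eq ((Nat.cast_le.2 ha).trans_lt hs)).trans ?_
    rw [(odd_two_mul_add_one a).neg_one_pow, add_neg_cancel, zero_div, zero_mul]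

theorem momentRow_even_even (hs : (n : ℝ) < s.re) (b a : ℕ) (ha : 2 * a < n) :
    momentRow s n (2 * b) ⟨2 * a, ha⟩ = if 2 * b + 1 < n then
      4 / ((2 * b + 1 - 2 * a) * (2 * a + 1)) * (s / (s - (2 * b + 2))) else
      2 / (2 * a + 1) * (s / (s - (2 * a + 1))) := by
  have hare : ((2 * a + 1 : ℕ) : ℝ) < s.re := (Nat.cast_le.2 ha).trans_lt hs
  split_ifs with hb
  · rw [momentRow_of_even_of_lt s (even_two_mul b) hb]
    refine (if_pos (even_two_mul a)).trans ?_
    rw [quadraticMoment_of_even_of_odd hare ((Nat.cast_le.2 hb).trans_lt hs) (even_two_mul a)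
      (odd_two_mul_add_one b)]
    push_cast
    ring
  · rw [momentRow_of_even_of_le s (even_two_mul b) (not_lt.1 hb)]
    refine (linearMoment_eq hare).trans ?_
    rw [(even_two_mul a).neg_one_pow]
    push_cast
    ring

theorem realAverage_eq_det_even (hs : (n : ℝ) < s.re) :
    realAverage s n Fin.elim0 =
      (Matrix.of fun b a : Fin ((n + 1) / 2) => if 2 * (b : ℕ) + 1 < n then
        4 / ((2 * b + 1 - 2 * a) * (2 * a + 1)) * (s / (s - (2 * b + 2))) else
        2 / (2 * a + 1) * (s / (s - (2 * a + 1)))).det := by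
  have hblocks (P : Matrix (Fin ((n + 1) / 2)) (Fin ((n + 1) / 2)) ℂ) :
      P.det = (Matrix.fromBlocks P 0 0 (1 : Matrix (Fin (n / 2)) (Fin (n / 2)) ℂ)).det := by
    rw [Matrix.det_fromBlocks_zero₁₂, Matrix.det_one, mul_one]
  rw [realAverage_eq_det hs, ← Matrix.det_submatrix_equiv_self (evenOddEquiv n),
    hblocks (Matrix.of fun b a => ite _ _ _)]
  congr 1
  ext (b | b) (a | a)
  · exact momentRow_even_even hs b a _
  · exact momentRow_even_odd hs b a _
  · refine (congrFun (momentRow_of_odd s n (odd_two_mul_add_one (b : ℕ))) _).trans (if_neg ?_)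
    simp only [evenOddEquiv, Equiv.coe_fn_mk, Sum.elim_inl]
    lia
  · refine (congrFun (momentRow_of_odd s n (odd_two_mul_add_one (b : ℕ))) _).trans ?_
    simp only [monomialVec, evenOddEquiv, Equiv.coe_fn_mk, Sum.elim_inr,
      Matrix.fromBlocks_apply₂₂, Matrix.one_apply, Fin.ext_iff]
    exact if_congr (by lia) rfl rfl

end EvenRows

end RealAverages

section CauchyDeterminant

section Evaluation

variable {K : Type*} [Field K]

/-- The determinant of the `n × n` Cauchy matrix with entries `1 / (yᵢ - xⱼ)`. -/
noncomputable def cauchyDet (x y : ℕ → K) (n : ℕ) : K :=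
  (Matrix.of fun i j : Fin n => (y i - x j)⁻¹).det

theorem cauchyDet_congr {x y y' : ℕ → K} {n : ℕ} (h : ∀ i < n, y i = y' i) :
    cauchyDet x y n = cauchyDet x y' n := by
  simp only [cauchyDet, h _ (Fin.is_lt _)]

theorem det_scaled_cauchy (w v x y : ℕ → K) (n : ℕ) :
    (Matrix.of fun b a : Fin n => w b * (v a * (y b - x a)⁻¹)).det =
      (∏ b ∈ Finset.range n, w b) * ((∏ a ∈ Finset.range n, v a) * cauchyDet x y n) := by
  rw [Finset.prod_range, Finset.prod_range, cauchyDet, ← Matrix.det_mul_row,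
    ← Matrix.det_mul_column]
  rfl

theorem inv_sub_mul_schur {a b c d : K} (hab : a - b ≠ 0) (had : a - d ≠ 0) (hcb : c - b ≠ 0) :
    (a - b)⁻¹ - (a - d)⁻¹ * (c - d) * (c - b)⁻¹ =
      (c - a) / (a - d) * ((b - d) / (c - b) * (a - b)⁻¹) := by
  field_simp
  ring

theorem cauchyDet_succ {x y : ℕ → K} {n : ℕ} (h : ∀ i ≤ n, ∀ j ≤ n, y i - x j ≠ 0) :
    cauchyDet x y (n + 1) = (y n - x n)⁻¹ *
      (∏ i ∈ Finset.range n, (y n - y i) / (y i - x n) * ((x i - x n) / (y n - x i))) *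
      cauchyDet x y n := by
  let A : Matrix (Fin n) (Fin n) K := Matrix.of fun i j => (y i - x j)⁻¹
  let B : Matrix (Fin n) (Fin 1) K := Matrix.of fun i _ => (y i - x n)⁻¹
  let C : Matrix (Fin 1) (Fin n) K := Matrix.of fun _ j => (y n - x j)⁻¹
  let D : Matrix (Fin 1) (Fin 1) K := Matrix.of fun _ _ => (y n - x n)⁻¹
  have hcorner := h n le_rfl n le_rfl
  have hD : IsUnit D.det := by simpa [D] using hcorner
  let := Matrix.invertibleOfIsUnitDet D hD
  have hblocks : (Matrix.of fun i j : Fin (n + 1) => (y i - x j)⁻¹).submatrix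
      (finSumFinEquiv (m := n) (n := 1)) (finSumFinEquiv (m := n) (n := 1)) =
      Matrix.fromBlocks A B C D := by
    ext (i | i) (j | j) <;> simp [A, B, C, D]
  have hinv : ⅟D = Matrix.of fun _ _ => (y n - x n) := by
    refine invOf_eq_right_inv ?_
    ext i j
    rw [Subsingleton.elim i j]
    simp [D, Matrix.mul_apply, inv_mul_cancel₀ hcorner]
  have hschur : A - B * ⅟D * C = Matrix.of fun i j : Fin n => ((y n - y i) / (y i - x n)) *
      Matrix.of (fun i j : Fin n => ((x j - x n) / (y n - x j)) * A i j) i j := by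
    ext i j
    simp only [hinv, Matrix.sub_apply, Matrix.of_apply, Matrix.mul_apply, Finset.univ_unique,
      Finset.sum_singleton, A, B, C]
    exact inv_sub_mul_schur (h i i.2.le j j.2.le) (h i i.2.le n le_rfl) (h n le_rfl j j.2.le)
  rw [cauchyDet, ← Matrix.det_submatrix_equiv_self (finSumFinEquiv (m := n) (n := 1)), hblocks,
    Matrix.det_fromBlocks₂₂, hschur, Matrix.det_mul_column, Matrix.det_mul_row, Finset.prod_range,
    Finset.prod_mul_distrib, Matrix.det_fin_one, cauchyDet, mul_assoc, mul_assoc]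
  rfl

/-- The quotient `(2 * k)‼ / (2 * k + 1)‼` of double factorials: `mahlerConst` acquires a factor
`2 * evenOddRatio k` when its argument passes from `2 * k` to `2 * k + 1`, and again to
`2 * k + 2`. -/
def evenOddRatio (k : ℕ) : ℚ :=
  ∏ m ∈ Finset.Icc 1 k, 2 * (m : ℚ) / (2 * m + 1)

theorem mahlerConst_two_mul_add (k : ℕ) {c : ℕ} (hc0 : c ≠ 0) (hc : c ≤ 2) :
    mahlerConst (2 * k + c) = (2 * evenOddRatio k) ^ c * mahlerConst (2 * k) := by
  have hextend : ∏ m ∈ Finset.Icc 1 ((2 * k - 1) / 2), (2 * (m : ℚ) / (2 * m + 1)) ^ (2 * k - 2 * m)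
      = ∏ m ∈ Finset.Icc 1 k, (2 * (m : ℚ) / (2 * m + 1)) ^ (2 * k - 2 * m) := by
    refine Finset.prod_subset (Finset.Icc_subset_Icc_right (by lia)) fun m hm hm' => ?_
    rw [Finset.mem_Icc] at hm hm'
    rw [show 2 * k - 2 * m = 0 by lia, pow_zero]
  have hsplit : ∏ m ∈ Finset.Icc 1 k, (2 * (m : ℚ) / (2 * m + 1)) ^ (2 * k + c - 2 * m) =
      evenOddRatio k ^ c * ∏ m ∈ Finset.Icc 1 k, (2 * (m : ℚ) / (2 * m + 1)) ^ (2 * k - 2 * m) := by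
    rw [evenOddRatio, ← Finset.prod_pow, ← Finset.prod_mul_distrib]
    refine Finset.prod_congr rfl fun m hm => ?_
    rw [Finset.mem_Icc] at hm
    rw [← pow_add]
    congr 1
    lia
  rw [mahlerConst, mahlerConst, hextend, show (2 * k + c - 1) / 2 = k by lia, hsplit]
  ring

variable [CharZero K]

theorem two_mul_add_one_sub_two_mul_ne_zero (i j : ℕ) : (2 * (i : K) + 1) - 2 * j ≠ 0 := by
  rw [sub_ne_zero]
  exact_mod_cast (show 2 * i + 1 ≠ 2 * j by lia)

theorem prod_two_mul_sub_div_add_one (k : ℕ) :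
    ∏ i ∈ Finset.range k, (2 * (k : K) - 2 * i) / (2 * k + 1 - 2 * i) = evenOddRatio k := by
  induction k with
  | zero => simp [evenOddRatio]
  | succ k ih =>
    rw [Finset.prod_range_succ', evenOddRatio, Finset.prod_Icc_succ_top (by lia), ← evenOddRatio,
      Rat.cast_mul, ← ih]
    push_cast
    congr 1
    · exact Finset.prod_congr rfl fun i _ => by congr 1 <;> ring
    · simp

theorem prod_two_mul_sub_div_sub_one (k : ℕ) :
    ∏ i ∈ Finset.range k, (2 * (k : K) - 2 * i) / (2 * k - 1 - 2 * i) =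
      (2 * k + 1) * evenOddRatio k := by
  induction k with
  | zero => simp [evenOddRatio]
  | succ k ih =>
    have hprod : ∏ i ∈ Finset.range k, (2 * ((k + 1 : ℕ) : K) - 2 * (i + 1 : ℕ)) /
        (2 * ((k + 1 : ℕ) : K) - 1 - 2 * (i + 1 : ℕ)) = (2 * k + 1) * evenOddRatio k := by
      rw [← ih]
      refine Finset.prod_congr rfl fun i _ => ?_
      push_cast
      congr 1 <;> ring
    have hk : 2 * (k : K) + 1 ≠ 0 := by exact_mod_cast (2 * k).succ_ne_zero
    have hk' : 2 * ((k : K) + 1) + 1 ≠ 0 := by exact_mod_cast (2 * (k + 1)).succ_ne_zero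
    rw [Finset.prod_range_succ', hprod, evenOddRatio, evenOddRatio,
      Finset.prod_Icc_succ_top (by lia)]
    push_cast
    rw [show 2 * ((k : K) + 1) - 1 - 2 * 0 = 2 * k + 1 by ring]
    field_simp
    ring

theorem cauchyDet_even_update_odd (k : ℕ) {w : K} (hw : ∀ j ≤ k, w - 2 * (j : K) ≠ 0) :
    cauchyDet (fun a => 2 * (a : K)) (Function.update (fun b : ℕ => 2 * (b : K) + 1) k w) (k + 1) =
      (2 * k + 1) * evenOddRatio k / (w - 2 * k) *
        (∏ i ∈ Finset.range k, (w - (2 * i + 1)) / (w - 2 * i)) *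
        cauchyDet (fun a => 2 * (a : K)) (fun b => 2 * (b : K) + 1) k := by
  have hy : ∀ i < k, Function.update (fun b : ℕ => 2 * (b : K) + 1) k w i = 2 * i + 1 := fun i hi =>
    Function.update_of_ne hi.ne _ _
  have hne : ∀ i ≤ k, ∀ j ≤ k,
      Function.update (fun b : ℕ => 2 * (b : K) + 1) k w i - 2 * (j : K) ≠ 0 := fun i hi j hj => by
    rcases hi.eq_or_lt with rfl | hi
    · simpa using hw j hj
    · rw [hy i hi]
      exact two_mul_add_one_sub_two_mul_ne_zero i j
  rw [cauchyDet_succ hne, cauchyDet_congr hy, Function.update_self,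
    ← prod_two_mul_sub_div_sub_one, div_mul_eq_mul_div, ← Finset.prod_mul_distrib, div_eq_inv_mul]
  congr 2
  refine Finset.prod_congr rfl fun i hi => ?_
  rw [hy i (Finset.mem_range.1 hi), ← neg_sub (2 * (k : K)) (2 * i),
    show 2 * (i : K) + 1 - 2 * k = -(2 * k - 1 - 2 * i) by ring, div_neg, neg_div, neg_mul_neg,
    div_mul_div_comm, div_mul_div_comm, mul_comm (w - _)]

theorem four_pow_mul_cauchyDet_even_odd (k : ℕ) :
    (4 : K) ^ k * ((∏ a ∈ Finset.range k, (2 * (a : K) + 1)⁻¹) *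
      cauchyDet (fun a => 2 * (a : K)) (fun b => 2 * (b : K) + 1) k) = mahlerConst (2 * k) := by
  induction k with
  | zero => simp [cauchyDet, mahlerConst]
  | succ k ih =>
    have hrec := cauchyDet_even_update_odd k fun j _ =>
      two_mul_add_one_sub_two_mul_ne_zero (K := K) k j
    have hprod : ∏ i ∈ Finset.range k, (2 * (k : K) + 1 - (2 * i + 1)) / (2 * k + 1 - 2 * i) =
        evenOddRatio k := by
      simpa only [add_sub_add_right_eq_sub] using prod_two_mul_sub_div_add_one k
    have hk : 2 * (k : K) + 1 ≠ 0 := by exact_mod_cast (2 * k).succ_ne_zero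
    rw [Function.update_eq_self, hprod, add_sub_cancel_left] at hrec
    rw [hrec, Nat.mul_succ, mahlerConst_two_mul_add k two_ne_zero le_rfl, Rat.cast_mul, ← ih,
      Finset.prod_range_succ]
    push_cast
    field_simp
    ring

end Evaluation

section RealAverage

variable {s : ℂ} {n k : ℕ}

theorem sub_natCast_ne_zero_of_lt_re (hs : (n : ℝ) < s.re) {m : ℕ} (hm : m ≤ n) : s - m ≠ 0 := by
  rintro h
  rw [sub_eq_zero.1 h, Complex.natCast_re] at hs
  exact hm.not_gt (Nat.cast_lt.1 hs)

theorem realAverage_eq_cauchyDet (hs : (n : ℝ) < s.re) :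
    realAverage s n Fin.elim0 =
      (∏ b ∈ Finset.range ((n + 1) / 2),
        if 2 * b + 1 < n then 4 * (s / (s - (2 * b + 2))) else 2 * s) *
        ((∏ a ∈ Finset.range ((n + 1) / 2), (2 * (a : ℂ) + 1)⁻¹) *
          cauchyDet (fun a => 2 * (a : ℂ))
            (fun b => if 2 * b + 1 < n then 2 * (b : ℂ) + 1 else s - 1) ((n + 1) / 2)) := by
  rw [realAverage_eq_det_even hs, ← det_scaled_cauchy]
  congr 2
  ext b a
  split_ifs
  · simp only [div_eq_mul_inv, mul_inv]
    ring
  · rw [← sub_sub s, sub_right_comm s]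
    simp only [div_eq_mul_inv]
    ring

theorem realAverage_two_mul (hs : ((2 * k : ℕ) : ℝ) < s.re) :
    realAverage s (2 * k) Fin.elim0 =
      mahlerConst (2 * k) * ∏ b ∈ Finset.range k, s / (s - (2 * b + 2)) := by
  have hlt : ∀ b ∈ Finset.range k, 2 * b + 1 < 2 * k := fun b hb => by
    rw [Finset.mem_range] at hb
    lia
  rw [realAverage_eq_cauchyDet hs, show (2 * k + 1) / 2 = k by lia,
    cauchyDet_congr (y' := fun b => 2 * (b : ℂ) + 1)
      fun b hb => if_pos (hlt b (Finset.mem_range.2 hb)),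
    Finset.prod_congr rfl fun b hb => if_pos (hlt b hb), Finset.prod_mul_distrib,
    Finset.prod_const, Finset.card_range, ← four_pow_mul_cauchyDet_even_odd]
  ring

theorem realAverage_two_mul_add_one (hs : ((2 * k + 1 : ℕ) : ℝ) < s.re) :
    realAverage s (2 * k + 1) Fin.elim0 =
      mahlerConst (2 * k + 1) * ∏ b ∈ Finset.range (k + 1), s / (s - (2 * b + 1)) := by
  have hlt : ∀ b ∈ Finset.range k, 2 * b + 1 < 2 * k + 1 := fun b hb => by
    rw [Finset.mem_range] at hb
    lia
  have hodd : ∀ j ≤ k, s - 1 - 2 * (j : ℂ) ≠ 0 := fun j hj => by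
    simpa [sub_sub, add_comm] using sub_natCast_ne_zero_of_lt_re (m := 2 * j + 1) hs (by lia)
  have hk : 2 * (k : ℂ) + 1 ≠ 0 := by exact_mod_cast (2 * k).succ_ne_zero
  have hcancel : (∏ b ∈ Finset.range k, s / (s - (2 * b + 2))) *
      ∏ i ∈ Finset.range k, (s - 1 - (2 * (i : ℂ) + 1)) / (s - 1 - 2 * i) =
      ∏ b ∈ Finset.range k, s / (s - (2 * b + 1)) := by
    rw [← Finset.prod_mul_distrib]
    refine Finset.prod_congr rfl fun b hb => ?_
    have heven := sub_natCast_ne_zero_of_lt_re (m := 2 * b + 2) hs (hlt b hb)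
    push_cast at heven
    rw [show s - 1 - (2 * (b : ℂ) + 1) = s - (2 * b + 2) by ring,
      show s - 1 - 2 * (b : ℂ) = s - (2 * b + 1) by ring, div_mul_div_cancel₀ heven]
  have hnodes : cauchyDet (fun a => 2 * (a : ℂ))
      (fun b => if 2 * b + 1 < 2 * k + 1 then 2 * (b : ℂ) + 1 else s - 1) (k + 1) =
      cauchyDet (fun a => 2 * (a : ℂ))
        (Function.update (fun b : ℕ => 2 * (b : ℂ) + 1) k (s - 1)) (k + 1) :=
    cauchyDet_congr fun b hb => by
      rw [Function.update_apply]
      split_ifs <;> first | rfl | lia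
  rw [realAverage_eq_cauchyDet hs, show (2 * k + 1 + 1) / 2 = k + 1 by lia, hnodes,
    cauchyDet_even_update_odd k hodd, Finset.prod_range_succ,
    Finset.prod_congr rfl fun b hb => if_pos (hlt b hb), Finset.prod_mul_distrib,
    Finset.prod_const, Finset.card_range, if_neg (lt_irrefl _), Finset.prod_range_succ,
    Finset.prod_range_succ _ k, mahlerConst_two_mul_add k one_ne_zero one_le_two, ← hcancel,
    show s - (2 * (k : ℂ) + 1) = s - 1 - 2 * k by ring, Rat.cast_mul,
    ← four_pow_mul_cauchyDet_even_odd]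
  push_cast
  field_simp [hodd k le_rfl]

theorem realAverage_eval (hn : 1 ≤ n) (hs : (n : ℝ) < s.re) :
    realAverage s n Fin.elim0 = mahlerConst n *
      ∏ m ∈ Finset.range ((n - 1) / 2 + 1), s / (s - ((n : ℂ) - 2 * m)) := by
  rw [← Finset.prod_range_reflect]
  have hcast : ∀ b ∈ Finset.range ((n - 1) / 2 + 1),
      (((n - 1) / 2 + 1 - 1 - b : ℕ) : ℂ) = ((n - 1) / 2 : ℕ) - b := fun b hb => by
    rw [Nat.add_sub_cancel, Nat.cast_sub (Nat.lt_succ_iff.1 (Finset.mem_range.1 hb))]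
  rw [Finset.prod_congr rfl fun b hb => by rw [hcast b hb]]
  obtain ⟨k, rfl | rfl⟩ := Nat.even_or_odd' n
  · obtain ⟨k, rfl⟩ := Nat.exists_eq_succ_of_ne_zero (show k ≠ 0 by lia)
    rw [realAverage_two_mul hs, show (2 * (k + 1) - 1) / 2 = k by lia]
    congr 1
    refine Finset.prod_congr rfl fun b _ => ?_
    push_cast
    ring_nf
  · rw [realAverage_two_mul_add_one hs, show (2 * k + 1 - 1) / 2 = k by lia]
    congr 1
    refine Finset.prod_congr rfl fun b _ => ?_
    push_cast
    ring_nf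

end RealAverage

end CauchyDeterminant

section ComplexAverages

open Polynomial ExteriorAlgebra

/-- The integral of `max 1 |z| ^ (-2 * s) * |z| ^ (2 * p)` over the plane, in closed form. -/
noncomputable def diskMoment (s : ℂ) (p : ℕ) : ℂ :=
  (Real.pi : ℂ) / (p + 1) * (s / (s - (p + 1 : ℕ)))

/-- The wedge of the coefficient vectors of the monomials with exponents `p i`. -/
noncomputable def monomialBlade {n k : ℕ} (p : Fin k → Fin n) : ExteriorAlgebra ℂ (Fin n → ℂ) :=
  ιMulti ℂ k fun i => monomialVec ℂ n (p i)

variable {s : ℂ} {n k m : ℕ}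

section Orthogonality

variable (c : Fin n → ℂ)

theorem norm_sum_pow_mul_sq (z : ℂ) :
    (‖∑ p : Fin n, z ^ (p : ℕ) * c p‖ ^ 2 : ℂ) =
      ∑ p : Fin n, ∑ q : Fin n,
        z ^ (p : ℕ) * starRingEnd ℂ z ^ (q : ℕ) * (c p * starRingEnd ℂ (c q)) := by
  rw [← Complex.mul_conj', map_sum, Finset.sum_mul_sum]
  simp only [map_mul, map_pow, mul_mul_mul_comm]

theorem integrable_max_norm_cpow_mul_pow_mul_conj_mul (hs : (n : ℝ) < s.re) (p q : Fin n) :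
    Integrable fun z : ℂ => ((max 1 ‖z‖ : ℝ) : ℂ) ^ (-(2 * s)) *
      (z ^ (p : ℕ) * starRingEnd ℂ z ^ (q : ℕ) * (c p * starRingEnd ℂ (c q))) := by
  simp only [← mul_assoc _ _ (c p * _)]
  refine (integrable_max_norm_cpow_mul_pow_mul_conj ?_).mul_const _
  calc ((p + q + 2 : ℕ) : ℝ) ≤ 2 * n := by exact_mod_cast (show (p + q + 2 : ℕ) ≤ 2 * n by lia)
    _ < (2 * s).re := by simpa using hs

theorem integrable_max_norm_cpow_mul_norm_sum_sq (hs : (n : ℝ) < s.re) :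
    Integrable fun z : ℂ => ((max 1 ‖z‖ : ℝ) : ℂ) ^ (-(2 * s)) *
      (‖∑ p : Fin n, z ^ (p : ℕ) * c p‖ ^ 2 : ℂ) := by
  simp only [norm_sum_pow_mul_sq, Finset.mul_sum]
  exact integrable_finsetSum _ fun p _ => integrable_finsetSum _ fun q _ =>
    integrable_max_norm_cpow_mul_pow_mul_conj_mul c hs p q

theorem integral_max_norm_cpow_mul_norm_sum_sq (hs : (n : ℝ) < s.re) :
    ∫ z : ℂ, ((max 1 ‖z‖ : ℝ) : ℂ) ^ (-(2 * s)) *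
        (‖∑ p : Fin n, z ^ (p : ℕ) * c p‖ ^ 2 : ℂ) =
      ∑ p : Fin n, diskMoment s p * (‖c p‖ ^ 2 : ℂ) := by
  have hint := integrable_max_norm_cpow_mul_pow_mul_conj_mul c hs
  have hmoment (p q : Fin n) : ∫ z : ℂ, ((max 1 ‖z‖ : ℝ) : ℂ) ^ (-(2 * s)) *
      (z ^ (p : ℕ) * starRingEnd ℂ z ^ (q : ℕ) * (c p * starRingEnd ℂ (c q))) =
      if p = q then diskMoment s p * (‖c p‖ ^ 2 : ℂ) else 0 := by
    have hp : ((p + 1 : ℕ) : ℝ) < s.re := (Nat.cast_le.2 p.is_lt).trans_lt hs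
    simp only [← mul_assoc _ _ (c p * _), integral_mul_const]
    rw [integral_max_norm_cpow_mul_pow_mul_conj hp, ite_mul, zero_mul]
    simp only [Fin.val_inj]
    split_ifs with hpq
    · rw [← hpq, Complex.mul_conj', diskMoment]
    · rfl
  simp only [norm_sum_pow_mul_sq, Finset.mul_sum]
  rw [integral_finsetSum _ fun p _ => integrable_finsetSum _ fun q _ => hint p q]
  refine Finset.sum_congr rfl fun p _ => ?_
  rw [integral_finsetSum _ fun q _ => hint p q]
  simp only [hmoment, Finset.sum_ite_eq, Finset.mem_univ, if_true]

end Orthogonality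

theorem complexAverage_zero (s : ℂ) (t : Fin m → ℂ) : complexAverage s 0 t = 1 := by
  have hone (a : Fin 0 → ℂ) : monicOfCoeffs a = 1 :=
    (monic_monicOfCoeffs a).natDegree_eq_zero.1 (natDegree_monicOfCoeffs a)
  simp [complexAverage, complexWeight, hone, measureReal_def, volume_pi]

theorem detForm_mul_ι_powerVec_mul (ω η : ExteriorAlgebra ℂ (Fin n → ℂ)) (z : ℂ) :
    detForm ℂ n (ω * (ι ℂ (powerVec n z) * η)) =
      ∑ p : Fin n, z ^ (p : ℕ) * detForm ℂ n (ω * (ι ℂ (monomialVec ℂ n p) * η)) := by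
  rw [powerVec_eq_sum, Finset.sum_range]
  simp only [map_sum, map_smul, Finset.sum_mul, Finset.mul_sum, smul_mul_assoc, mul_smul_comm,
    smul_eq_mul]

theorem monomialBlade_snoc (p : Fin k → Fin n) (q : Fin n) :
    monomialBlade (Fin.snoc p q : Fin (k + 1) → Fin n) =
      monomialBlade p * ι ℂ (monomialVec ℂ n q) := by
  rw [monomialBlade, ιMulti_succ_last]
  simp only [Fin.snoc_castSucc, Fin.snoc_last, monomialBlade]

theorem complexWeight_X_sub_C_mul (t : Fin m → ℂ) (z : ℂ) :
    (‖(Matrix.vandermonde t).det‖ ^ 2 : ℂ) * complexWeight s t (X - C z) =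
      ((max 1 ‖z‖ : ℝ) : ℂ) ^ (-(2 * s)) *
        (‖(Matrix.vandermonde (Matrix.vecCons z t)).det‖ ^ 2 : ℂ) := by
  rw [complexWeight_X_sub_C, det_vandermonde_vecCons, norm_mul, norm_prod]
  push_cast
  rw [mul_pow, Finset.prod_pow]
  ring

theorem factorial_mul_norm_det_vandermonde_sq_mul_complexAverage (hs : (n : ℝ) < s.re)
    (t : Fin m → ℂ) (hn : m + k = n) :
    (k.factorial : ℂ) * ((‖(Matrix.vandermonde t).det‖ ^ 2 : ℂ) * complexAverage s k t) =
      ∑ p : Fin k → Fin n, (∏ i, diskMoment s (p i)) *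
        (‖detForm ℂ n (monomialBlade p * vandermondeBlade n t)‖ ^ 2 : ℂ) := by
  induction k generalizing m with
  | zero =>
    obtain rfl : m = n := hn
    simp [complexAverage_zero, monomialBlade, detForm_vandermondeBlade]
  | succ k ih =>
    have hpeel := complexAverage_succ (n := k) (s := s) t (by rwa [add_comm (k + 1), hn])
    calc ((k + 1).factorial : ℂ) *
          ((‖(Matrix.vandermonde t).det‖ ^ 2 : ℂ) * complexAverage s (k + 1) t)
        = k.factorial * ((‖(Matrix.vandermonde t).det‖ ^ 2 : ℂ) *
            (((k + 1 : ℕ) : ℂ) * complexAverage s (k + 1) t)) := by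
          rw [Nat.factorial_succ]
          push_cast
          ring
      _ = ∫ z : ℂ, ((max 1 ‖z‖ : ℝ) : ℂ) ^ (-(2 * s)) * (k.factorial *
            ((‖(Matrix.vandermonde (Matrix.vecCons z t)).det‖ ^ 2 : ℂ) *
              complexAverage s k (Matrix.vecCons z t))) := by
          rw [hpeel, ← integral_const_mul, ← integral_const_mul]
          simp only [← mul_assoc (_ ^ 2 : ℂ), complexWeight_X_sub_C_mul]
          simp only [mul_assoc, mul_left_comm (k.factorial : ℂ)]
      _ = ∑ p : Fin k → Fin n, (∏ i, diskMoment s (p i)) * ∫ z : ℂ,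
            ((max 1 ‖z‖ : ℝ) : ℂ) ^ (-(2 * s)) * (‖∑ q : Fin n, z ^ (q : ℕ) * detForm ℂ n
              (monomialBlade p * (ι ℂ (monomialVec ℂ n q) * vandermondeBlade n t))‖ ^ 2 : ℂ) := by
          simp only [ih (Matrix.vecCons _ t) (by lia), vandermondeBlade_vecCons,
            detForm_mul_ι_powerVec_mul, Finset.mul_sum, mul_left_comm _ (Finset.prod _ _)]
          rw [integral_finsetSum _ fun p _ =>
            (integrable_max_norm_cpow_mul_norm_sum_sq _ hs).const_mul _]
          simp only [integral_const_mul]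
      _ = ∑ p : Fin (k + 1) → Fin n, (∏ i, diskMoment s (p i)) *
            (‖detForm ℂ n (monomialBlade p * vandermondeBlade n t)‖ ^ 2 : ℂ) := by
          rw [← (Fin.snocEquiv fun _ : Fin (k + 1) => Fin n).sum_comp, Fintype.sum_prod_type_right]
          simp only [integral_max_norm_cpow_mul_norm_sum_sq _ hs, Fin.snocEquiv, Equiv.coe_fn_mk,
            monomialBlade_snoc, Fin.prod_univ_castSucc, Fin.snoc_castSucc, Fin.snoc_last,
            Finset.mul_sum, mul_assoc]

theorem detForm_monomialBlade (p : Fin n → Fin n) :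
    detForm ℂ n (monomialBlade p) = ((1 : Matrix (Fin n) (Fin n) ℂ).submatrix p id).det := by
  rw [monomialBlade, detForm_ιMulti]
  congr 1
  ext i j
  simp only [Matrix.of_apply, monomialVec, Matrix.submatrix_apply, Matrix.one_apply, id,
    Fin.val_inj, eq_comm]

theorem sum_prod_mul_norm_detForm_monomialBlade_sq (c : Fin n → ℂ) :
    ∑ p : Fin n → Fin n, (∏ i, c (p i)) * (‖detForm ℂ n (monomialBlade p)‖ ^ 2 : ℂ) =
      n.factorial * ∏ q, c q := by
  simp only [detForm_monomialBlade]
  rw [← Fintype.sum_of_injective (fun σ : Equiv.Perm (Fin n) => (σ : Fin n → Fin n))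
    DFunLike.coe_injective (fun _ => ∏ q, c q)]
  · simp [Fintype.card_perm]
  · intro p hp
    obtain ⟨i, j, hij, hne⟩ : ∃ i j, p i = p j ∧ i ≠ j := by
      simpa [Function.Injective] using fun h : Function.Injective p =>
        hp ⟨Equiv.ofBijective p (Finite.injective_iff_bijective.1 h), rfl⟩
    rw [Matrix.det_zero_of_row_eq hne (funext fun l => by
      simp only [Matrix.submatrix_apply, Matrix.one_apply, hij])]
    simp
  · intro σ
    rw [Matrix.det_permute, Matrix.det_one, mul_one, Equiv.prod_comp σ c]
    rcases Int.units_eq_one_or (Equiv.Perm.sign σ) with h | h <;> simp [h]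

theorem complexAverage_eval (hs : (n : ℝ) < s.re) :
    complexAverage s n Fin.elim0 =
      (Real.pi : ℂ) ^ n / n.factorial * ∏ p ∈ Finset.Icc 1 n, s / (s - p) := by
  have hfactorial : (n.factorial : ℂ) ≠ 0 := by exact_mod_cast n.factorial_ne_zero
  have hsum := factorial_mul_norm_det_vandermonde_sq_mul_complexAverage hs Fin.elim0 (zero_add n)
  simp only [vandermondeBlade, ιMulti_zero_apply, mul_one, Matrix.det_fin_zero, norm_one,
    Complex.ofReal_one, one_pow, one_mul] at hsum
  rw [sum_prod_mul_norm_detForm_monomialBlade_sq fun q => diskMoment s q] at hsum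
  have hshift : ∏ q : Fin n, diskMoment s q =
      ∏ p ∈ Finset.Ico 1 (n + 1), (Real.pi : ℂ) / p * (s / (s - p)) := by
    rw [← Finset.prod_range, Finset.range_eq_Ico, ← Finset.prod_Ico_add' _ 0 n 1]
    simp only [diskMoment, Nat.cast_add, Nat.cast_one]
  rw [mul_left_cancel₀ hfactorial hsum, hshift, Finset.prod_mul_distrib, Finset.prod_div_distrib,
    Finset.prod_const, Nat.card_Ico, Nat.add_sub_cancel, ← Nat.cast_prod,
    Finset.prod_Ico_id_eq_factorial, Finset.Ico_add_one_right_eq_Icc]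

end ComplexAverages

section RationalContinuation

open Polynomial

theorem denom_eval_ne_zero_and_eval_eq {K : Type*} [Field K] {p q : K[X]} {x : K}
    (hq : q.eval x ≠ 0) {R : RatFunc K} (hR : R = algebraMap K[X] _ p / algebraMap K[X] _ q) :
    R.denom.eval x ≠ 0 ∧ R.eval (RingHom.id K) x = p.eval x / q.eval x := by
  have hdenom : R.denom.eval x ≠ 0 := fun h =>
    hq (eval_eq_zero_of_dvd_of_eval_eq_zero (hR ▸ RatFunc.denom_div_dvd p q) h)
  have hcross := (RatFunc.num_mul_eq_mul_denom_iff (fun h => hq (by rw [h, eval_zero]))).2 hR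
  refine ⟨hdenom, (div_eq_div_iff hdenom hq).2 ?_⟩
  simpa only [eval_mul, RatFunc.eval, eval₂_id] using congrArg (eval x) hcross

theorem continuesToRational_of_eq_div {F : ℂ → ℂ} {σ : ℝ} {R : RatFunc ℂ} {p q : ℂ[X]}
    (hR : R = algebraMap ℂ[X] _ p / algebraMap ℂ[X] _ q)
    (h : ∀ s : ℂ, σ < s.re → q.eval s ≠ 0 ∧ F s = p.eval s / q.eval s) :
    ContinuesToRational F σ R := by
  refine ⟨fun s hs => ?_, fun s hs => ?_⟩
  · have hanalytic : AnalyticAt ℂ (fun z => p.eval z / q.eval z) s :=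
      (p.differentiable.analyticAt s).div (q.differentiable.analyticAt s) (h s hs).1
    refine hanalytic.congr ?_
    filter_upwards [(isOpen_lt continuous_const Complex.continuous_re).mem_nhds hs] with z hz
    exact (h z hz).2.symm
  · obtain ⟨hdenom, heval⟩ := denom_eval_ne_zero_and_eval_eq (h s hs).1 hR
    exact ⟨hdenom, (h s hs).2.trans heval.symm⟩

theorem continuesToRational_const_mul_prod {ι : Type*} {F : ℂ → ℂ} {σ : ℝ} {S : Finset ι} {c : ℂ}
    {b : ι → ℂ} (hb : ∀ s : ℂ, σ < s.re → ∀ i ∈ S, s - b i ≠ 0)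
    (hF : ∀ s : ℂ, σ < s.re → F s = c * ∏ i ∈ S, s / (s - b i)) :
    ContinuesToRational F σ
      (RatFunc.C c * ∏ i ∈ S, RatFunc.X / (RatFunc.X - RatFunc.C (b i))) := by
  refine continuesToRational_of_eq_div (p := C c * ∏ _i ∈ S, X) (q := ∏ i ∈ S, (X - C (b i)))
    ?_ fun s hs => ⟨?_, ?_⟩
  · simp only [map_mul, map_prod, map_sub, RatFunc.algebraMap_C, RatFunc.algebraMap_X,
      Finset.prod_div_distrib, mul_div_assoc]
  · simpa only [eval_prod, eval_sub, eval_X, eval_C] using Finset.prod_ne_zero_iff.2 (hb s hs)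
  · simp only [hF s hs, eval_mul, eval_prod, eval_sub, eval_X, eval_C, Finset.prod_div_distrib,
      mul_div_assoc]

end RationalContinuation

section MomentFunctions

open Polynomial

variable {N : ℕ} {s : ℂ}

/-- Reversal of a vector, which turns the descending coefficients of `monicPoly` into the ascending
ones of `monicOfCoeffs`. -/
def revVec (K : Type*) [MeasurableSpace K] (N : ℕ) : (Fin N → K) ≃ᵐ (Fin N → K) :=
  MeasurableEquiv.piCongrLeft (fun _ => K) Fin.revPerm

theorem revVec_apply {K : Type*} [MeasurableSpace K] (b : Fin N → K) :
    revVec K N b = fun i => b i.rev := by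
  funext i
  have h := MeasurableEquiv.piCongrLeft_apply_apply (β := fun _ => K) Fin.revPerm b i.rev
  rwa [Fin.revPerm_apply, Fin.rev_rev] at h

theorem volume_preserving_revVec (K : Type*) [MeasureSpace K] [SigmaFinite (volume : Measure K)]
    (N : ℕ) : MeasurePreserving (revVec K N) volume volume :=
  volume_measurePreserving_piCongrLeft (fun _ => K) Fin.revPerm

theorem monicPoly_eq_monicOfCoeffs (b : Fin N → ℂ) :
    monicPoly b = monicOfCoeffs fun i => b i.rev := by
  rw [monicPoly, ← Equiv.sum_comp Fin.revPerm, monicOfCoeffs, polyOfCoeffs,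
    Fintype.linearCombination_apply]
  refine congrArg _ (Finset.sum_congr rfl fun i _ => ?_)
  rw [Fin.revPerm_apply, Fin.val_rev, C_mul', show N - (N - (i + 1) + 1) = (i : ℕ) by lia]

theorem realMomentIntegrand_mahlerMeasure (b : Fin N → ℝ) :
    realMomentIntegrand mahlerMeasure N s b =
      realWeight s Fin.elim0 (monicOfCoeffs (revVec ℝ N b)) := by
  simp [realMomentIntegrand, monicRestriction, monicPoly_eq_monicOfCoeffs, realWeight,
    map_monicOfCoeffs, revVec_apply]

theorem complexMomentIntegrand_mahlerMeasure (b : Fin N → ℂ) :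
    complexMomentIntegrand mahlerMeasure N s b =
      complexWeight s Fin.elim0 (monicOfCoeffs (revVec ℂ N b)) := by
  simp [complexMomentIntegrand, monicRestriction, monicPoly_eq_monicOfCoeffs, complexWeight,
    revVec_apply]

theorem integrable_realMomentIntegrand (hs : (N : ℝ) < s.re) :
    Integrable (realMomentIntegrand mahlerMeasure N s) := by
  rw [funext realMomentIntegrand_mahlerMeasure]
  exact ((volume_preserving_revVec ℝ N).integrable_comp_emb (revVec ℝ N).measurableEmbedding).2
    (integrable_realWeight Fin.elim0 hs)

theorem integrable_complexMomentIntegrand (hs : (N : ℝ) < s.re) :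
    Integrable (complexMomentIntegrand mahlerMeasure N s) := by
  rw [funext complexMomentIntegrand_mahlerMeasure]
  exact ((volume_preserving_revVec ℂ N).integrable_comp_emb (revVec ℂ N).measurableEmbedding).2
    (integrable_complexWeight Fin.elim0 hs)

theorem realMoment_mahlerMeasure : realMoment mahlerMeasure N s = realAverage s N Fin.elim0 := by
  rw [realMoment, funext realMomentIntegrand_mahlerMeasure]
  exact (volume_preserving_revVec ℝ N).integral_comp (revVec ℝ N).measurableEmbedding
    fun a => realWeight s Fin.elim0 (monicOfCoeffs a)

theorem complexMoment_mahlerMeasure :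
    complexMoment mahlerMeasure N s = complexAverage s N Fin.elim0 := by
  rw [complexMoment, funext complexMomentIntegrand_mahlerMeasure]
  exact (volume_preserving_revVec ℂ N).integral_comp (revVec ℂ N).measurableEmbedding
    fun a => complexWeight s Fin.elim0 (monicOfCoeffs a)

theorem realMoment_eval (hN : 1 ≤ N) (hs : (N : ℝ) < s.re) :
    realMoment mahlerMeasure N s = mahlerConst N *
      ∏ m ∈ Finset.range ((N - 1) / 2 + 1), s / (s - ((N : ℂ) - 2 * m)) := by
  rw [realMoment_mahlerMeasure, realAverage_eval hN hs]

theorem complexMoment_eval (hs : (N : ℝ) < s.re) :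
    complexMoment mahlerMeasure N s =
      (Real.pi : ℂ) ^ N / N.factorial * ∏ n ∈ Finset.Icc 1 N, s / (s - n) := by
  rw [complexMoment_mahlerMeasure, complexAverage_eval hs]

theorem continuesToRational_realMoment (hN : 1 ≤ N) :
    ContinuesToRational (realMoment mahlerMeasure N) N (RatFunc.C (mahlerConst N : ℂ) *
      ∏ m ∈ Finset.range ((N - 1) / 2 + 1),
        RatFunc.X / (RatFunc.X - RatFunc.C ((N : ℂ) - 2 * (m : ℂ)))) := by
  refine continuesToRational_const_mul_prod (fun s hs m hm => ?_) fun s hs => realMoment_eval hN hs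
  have hm : 2 * m ≤ N := by
    rw [Finset.mem_range] at hm
    lia
  simpa [Nat.cast_sub hm] using sub_natCast_ne_zero_of_lt_re hs (N.sub_le (2 * m))

theorem continuesToRational_complexMoment :
    ContinuesToRational (complexMoment mahlerMeasure N) N
      (RatFunc.C ((Real.pi : ℂ) ^ N / (N.factorial : ℂ)) *
        ∏ n ∈ Finset.Icc 1 N, RatFunc.X / (RatFunc.X - RatFunc.C (n : ℂ))) :=
  continuesToRational_const_mul_prod
    (fun _ hs _ hn => sub_natCast_ne_zero_of_lt_re hs (Finset.mem_Icc.1 hn).2)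
    fun _ hs => complexMoment_eval hs

end MomentFunctions

theorem theorem7 (N : ℕ) (hN : 1 ≤ N) :
    -- the complex moment function
    (ContinuesToRational (complexMoment Polynomial.mahlerMeasure N) N
        (RatFunc.C ((Real.pi : ℂ) ^ N / (N.factorial : ℂ)) *
          ∏ n ∈ Finset.Icc 1 N, RatFunc.X / (RatFunc.X - RatFunc.C (n : ℂ))) ∧
      ∀ s : ℂ, (N : ℝ) < s.re →
        Integrable (complexMomentIntegrand Polynomial.mahlerMeasure N s) ∧
        complexMoment Polynomial.mahlerMeasure N s =
          (Real.pi : ℂ) ^ N / (N.factorial : ℂ) *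
            ∏ n ∈ Finset.Icc 1 N, s / (s - (n : ℂ))) ∧
    -- the real moment function
    (ContinuesToRational (realMoment Polynomial.mahlerMeasure N) N
        (RatFunc.C (mahlerConst N : ℂ) *
          ∏ m ∈ Finset.range ((N - 1) / 2 + 1),
            RatFunc.X / (RatFunc.X - RatFunc.C ((N : ℂ) - 2 * (m : ℂ)))) ∧
      ∀ s : ℂ, (N : ℝ) < s.re →
        Integrable (realMomentIntegrand Polynomial.mahlerMeasure N s) ∧
        realMoment Polynomial.mahlerMeasure N s =
          (mahlerConst N : ℂ) *
            ∏ m ∈ Finset.range ((N - 1) / 2 + 1), s / (s - ((N : ℂ) - 2 * (m : ℂ)))) :=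
  ⟨⟨continuesToRational_complexMoment, fun _ hs =>
      ⟨integrable_complexMomentIntegrand hs, complexMoment_eval hs⟩⟩,
    ⟨continuesToRational_realMoment hN, fun _ hs =>
      ⟨integrable_realMomentIntegrand hs, realMoment_eval hN hs⟩⟩⟩
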